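/- Let $V$ be a finite-dimensional rational vector space with a non-degenerate symmetric bilinear form $(\cdot,\cdot)$, and let $L\subseteq V$ be an even lattice, i.e., a finitely generated subgroup of full rank with $(x,x)\in 2\mathbb{Z}$ for every $x\in L$, with dual lattice $L^{*}=\{\nu\in V\mid(\nu,L)\subseteq\mathbb{Z}\}$. Let $\Gamma_{L}$ be the group of those elements of $\mathrm{O}(V)$ that preserve $L$, act trivially on $L^{*}/L$, and lie in the identity component $\mathrm{SO}^{+}(V_{\mathbb{R}})$ of $\mathrm{O}(V_{\mathbb{R}})$. Let $U\subseteq V$ be a 2-dimensional isotropic subspace, and set $$I=U\cap L,\quad I_{L^{*}}=U\cap L^{*},\quad W=U^{\perp}/U,\quad \Lambda=(U^{\perp}\cap L)/I\subseteq W,\quad \Delta_{\Lambda}=\Lambda^{*}/\Lambda,$$ where $W$ carries the induced bilinear form, $\Lambda$ is an even lattice in $W$, and $\Gamma_{\Lambda}\subseteq\mathrm{O}(W)$ is defined like $\Gamma_{L}$. Let $\mathcal{P}_{U}$ be the stabilizer of $U$ in $\mathrm{O}(V)$, and let $\Gamma_{L,I}$ be the group of those elements of $\Gamma_{L}\cap\mathcal{P}_{U}$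 that lie in the identity component of the stabilizer of $U_{\mathbb{R}}$ in $\mathrm{O}(V_{\mathbb{R}})$. Let $\mathrm{Hom}^{as}(U^{*},U)\subseteq\mathcal{P}_{U}$ be the normal subgroup of those elements that act trivially on $U^{\perp}$, set $\overline{\mathcal{P}}_{U}=\mathcal{P}_{U}/\mathrm{Hom}^{as}(U^{*},U)$, and let $\overline{\Gamma}_{L,I}$ be the image of $\Gamma_{L,I}$ in $\overline{\mathcal{P}}_{U}$. Fix a basis $(e_{1},e_{2})$ of $I$ over $\mathbb{Z}$, which identifies $\mathrm{SL}(I)$ with $\mathrm{SL}_{2}(\mathbb{Z})$. For a lattice $I\subseteq J\subseteq U$ let $\mathrm{SL}(J,I)=\{M\in\mathrm{SL}(I)\mid u-Mu\in I\ \forall u\in J\}$, and let $\Gamma_{L^{*}}\subseteq\mathrm{SL}_{2}(\mathbb{Z})$ be the subgroup corresponding to $\mathrm{SL}(I_{L^{*}},I)$. Let $$\tilde{H}(\Lambda,\mathbb{Z})=\big\{(\lambda,\mu,t)\in\Lambda\times\Lambda\times\tfrac12\mathbb{Z}\;\big|\;t\in\tfrac{(\lambda,\mu)}{2}+\mathbb{Z}\big\},\qquad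 (\lambda,\mu,t)(\lambda',\mu',t')=\Big(\lambda+\lambda',\mu+\mu',t+t'+\tfrac{(\lambda,\mu')-(\mu,\lambda')}{2}\Big).$$ Then $\Gamma_{L^{*}}$ is a congruence subgroup of $\mathrm{SL}_{2}(\mathbb{Z})$, and there are short exact sequences $$1\to\tilde{H}(\Lambda,\mathbb{Z})\xrightarrow{\,j\,}\Gamma_{L,I}\xrightarrow{\,r\,}\Gamma_{L^{*}}\times\Gamma_{\Lambda}\to1\quad\text{and}\quad 1\to\Lambda\times\Lambda\xrightarrow{\,k\,}\overline{\Gamma}_{L,I}\xrightarrow{\,\bar r\,}\Gamma_{L^{*}}\times\Gamma_{\Lambda}\to1,$$ in which $r$ takes $A$ to the pair consisting of the matrix of $A|_{I}$ in the basis $(e_{1},e_{2})$ and of the action of $A$ on $W$; the element $j(\lambda,\mu,t)$ takes $z\in U^{\perp}$ to $z-(\lambda,z+U)e_{1}-(\mu,z+U)e_{2}$, while $j(0,0,t)$ takes any $v\in V$ to $v-t\big((v,e_{2})e_{1}-(v,e_{1})e_{2}\big)$; the map $\bar r$ is induced from $r$; and $k(\lambda,\mu)$ is the image of $j(\lambda,\mu,t)$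 in $\overline{\Gamma}_{L,I}$ for every admissible $t$. Moreover, let $\tilde{I}\subseteq L^{*}$ be a subgroup whose pairing with $I$ is unimodular, i.e., is integral and identifies $\tilde{I}$ with $\mathrm{Hom}(I,\mathbb{Z})$. Set $\tilde{U}=\tilde{I}_{\mathbb{Q}}$ and $\tilde{W}=(U\oplus\tilde{U})^{\perp}$ (which projects isomorphically onto $W$), and let $\tilde{I}_{L}$ be the group of those $\mu\in\tilde{I}$ for which there is $\nu\in L$ with $(\mu,x)=(\nu,x)$ for every $x\in I$. Then there are a symmetric linear map $\alpha:\tilde{U}\to U$ for which $\{\tilde{u}-\alpha\tilde{u}\mid\tilde{u}\in\tilde{U}\}$ is isotropic and a homomorphism $\iota:\tilde{I}_{L}\to\Delta_{\Lambda}$ such that for $u\in U$, $w\in\tilde{W}$, and $\tilde{u}\in\tilde{U}$ one has $u+w+\tilde{u}\in L$ if and only if $\tilde{u}\in\tilde{I}_{L}$, the class of $w$ in $W$ lies in $\Lambda^{*}$ and maps to $\iota\tilde{u}$ in $\Delta_{\Lambda}$, and $u\in-2\alpha\tilde{u}+I$ (these properties determine $\alpha$ and $\iota$). Let $I_{\iota}\subseteq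 U$ be the pre-image of the image of the $\mathbb{Q}/\mathbb{Z}$-dual $\iota^{*}:\Delta_{\Lambda}\to U/I_{L^{*}}$ of $\iota$, and let $\Gamma_{\iota}\subseteq\mathrm{SL}_{2}(\mathbb{Z})$ correspond to $\mathrm{SL}(I_{\iota},I)$. Then $\Gamma_{\iota}$ is a congruence subgroup contained in $\Gamma_{L^{*}}$, and the second exact sequence splits over $\Gamma_{\iota}\times\Gamma_{\Lambda}$: there is a homomorphism $s:\Gamma_{\iota}\times\Gamma_{\Lambda}\to\overline{\Gamma}_{L,I}$ such that $\bar r\circ s$ is the inclusion into $\Gamma_{L^{*}}\times\Gamma_{\Lambda}$, and all elements of $\mathcal{P}_{U}$ representing elements of the image of $s$ stabilize $U\oplus\tilde{U}$. -/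

import Mathlib

open scoped TensorProduct MatrixGroups

namespace IntegralParabolic

/-! ## Orthogonal groups, stabilizers, identity components -/

section Groups

variable {k E : Type*} [Field k] [AddCommGroup E] [Module k E]

/-- The orthogonal group `O(E)` of a bilinear form. -/
def orthogonalGroup (B : LinearMap.BilinForm k E) : Subgroup (E ≃ₗ[k] E) where
  carrier := {A | ∀ x y, B (A x) (A y) = B x y}
  mul_mem' {A A'} hA hA' x y := by
    rw [LinearEquiv.mul_apply, LinearEquiv.mul_apply, hA, hA']
  one_mem' _ _ := rfl
  inv_mem' {A} hA x y := by
    have h := hA (A⁻¹ x) (A⁻¹ y)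
    rw [← LinearEquiv.mul_apply, ← LinearEquiv.mul_apply, mul_inv_cancel] at h
    exact h.symm

/-- The group of linear automorphisms that map a subspace onto itself. -/
def stabilizer (U : Submodule k E) : Subgroup (E ≃ₗ[k] E) where
  carrier := {A | ∀ x, A x ∈ U ↔ x ∈ U}
  mul_mem' {A A'} hA hA' x := by
    rw [LinearEquiv.mul_apply, hA, hA']
  one_mem' _ := Iff.rfl
  inv_mem' {A} hA x := by
    rw [← hA (A⁻¹ x), ← LinearEquiv.mul_apply, mul_inv_cancel, LinearEquiv.coe_one, id]

/-- The parabolic subgroup `P_U`: the stabilizer of `U` in the orthogonal group. -/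
def parabolic (B : LinearMap.BilinForm k E) (U : Submodule k E) : Subgroup (E ≃ₗ[k] E) :=
  orthogonalGroup B ⊓ stabilizer U

end Groups

section IdentityComponent

variable {E : Type*} [AddCommGroup E] [Module ℝ E]

/-- The set of endomorphisms underlying a group of linear automorphisms. -/
def endSet (G : Subgroup (E ≃ₗ[ℝ] E)) : Set (Module.End ℝ E) :=
  {f | ∃ A ∈ G, (A : E →ₗ[ℝ] E) = f}

lemma translate_mem (G : Subgroup (E ≃ₗ[ℝ] E)) {A A' D : E ≃ₗ[ℝ] E} (hA : A ∈ G)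
    (hD : (D : E →ₗ[ℝ] E) ∈
      @connectedComponentIn (Module.End ℝ E) (moduleTopology ℝ _) (endSet G)
        (A' : E →ₗ[ℝ] E)) :
    ((A * D : E ≃ₗ[ℝ] E) : E →ₗ[ℝ] E) ∈
      @connectedComponentIn (Module.End ℝ E) (moduleTopology ℝ _) (endSet G)
        ((A * A' : E ≃ₗ[ℝ] E) : E →ₗ[ℝ] E) := by
  let _ : TopologicalSpace (Module.End ℝ E) := moduleTopology ℝ _
  have : IsModuleTopology ℝ (Module.End ℝ E) := ⟨rfl⟩
  have : ContinuousAdd (Module.End ℝ E) := IsModuleTopology.toContinuousAdd ℝ _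
  have hA' : (A' : E →ₗ[ℝ] E) ∈ endSet G := connectedComponentIn_nonempty_iff.1 ⟨_, hD⟩
  have hc : Continuous (LinearMap.mulLeft ℝ (A : Module.End ℝ E)) :=
    IsModuleTopology.continuous_of_linearMap _
  have himg : Set.MapsTo (LinearMap.mulLeft ℝ (A : Module.End ℝ E)) (endSet G) (endSet G) := by
    rintro f ⟨C, hC, rfl⟩
    exact ⟨A * C, G.mul_mem hA hC, rfl⟩
  exact connectedComponentIn_mono _ himg.image_subset
    (hc.continuousOn.mapsTo_connectedComponentIn hA' hD)

/-- The identity component of a group `G` of automorphisms of a finite-dimensional real vector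
space `E`: the connected component of the identity of `G`, where `G` is topologized as a subset
of `End(E)`, and the latter space carries its canonical (Euclidean) topology. -/
def identityComponent (G : Subgroup (E ≃ₗ[ℝ] E)) : Subgroup (E ≃ₗ[ℝ] E) where
  carrier := {A | (A : E →ₗ[ℝ] E) ∈
    @connectedComponentIn (Module.End ℝ E) (moduleTopology ℝ _) (endSet G)
      ((1 : E ≃ₗ[ℝ] E) : E →ₗ[ℝ] E)}
  one_mem' := by
    let _ : TopologicalSpace (Module.End ℝ E) := moduleTopology ℝ _
    exact mem_connectedComponentIn ⟨1, G.one_mem, rfl⟩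
  mul_mem' {A D} hA hD := by
    let _ : TopologicalSpace (Module.End ℝ E) := moduleTopology ℝ _
    have hAG : A ∈ G := by
      obtain ⟨A', hA', h⟩ := connectedComponentIn_subset _ _ hA
      rwa [← LinearEquiv.toLinearMap_injective h]
    have h := translate_mem G hAG hD
    rw [mul_one, ← connectedComponentIn_eq hA] at h
    exact h
  inv_mem' {A} hA := by
    let _ : TopologicalSpace (Module.End ℝ E) := moduleTopology ℝ _
    have hAG : A ∈ G := by
      obtain ⟨A', hA', h⟩ := connectedComponentIn_subset _ _ hA
      rwa [← LinearEquiv.toLinearMap_injective h]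
    have h1 : ((1 : E ≃ₗ[ℝ] E) : E →ₗ[ℝ] E) ∈
        connectedComponentIn (endSet G) (A : E →ₗ[ℝ] E) := by
      rw [← connectedComponentIn_eq hA]
      exact mem_connectedComponentIn ⟨1, G.one_mem, rfl⟩
    have h := translate_mem G (G.inv_mem hAG) h1
    rwa [mul_one, inv_mul_cancel] at h

end IdentityComponent

/-! ## Discriminant kernels and the arithmetic parabolic group -/

section Arithmetic

variable {V : Type*} [AddCommGroup V] [Module ℚ V]

/-- Extension of scalars from `GL(V)` to `GL(V_ℝ)`, where `V_ℝ = ℝ ⊗ V`. -/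
noncomputable def realExt : (V ≃ₗ[ℚ] V) →* ((ℝ ⊗[ℚ] V) ≃ₗ[ℝ] (ℝ ⊗[ℚ] V)) where
  toFun A := A.baseChange ℚ ℝ V V
  map_one' := LinearEquiv.baseChange_one ..
  map_mul' _ _ := LinearEquiv.baseChange_mul ..

/-- The automorphisms that map the lattice `L` onto itself and act trivially on `L* / L`. -/
def trivialOnDiscriminant (B : LinearMap.BilinForm ℚ V) (L : Submodule ℤ V) :
    Subgroup (V ≃ₗ[ℚ] V) where
  carrier := {A | (∀ x, A x ∈ L ↔ x ∈ L) ∧ ∀ x ∈ B.dualSubmodule L, A x - x ∈ L}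
  mul_mem' hA hA' := by
    refine ⟨fun x => by rw [LinearEquiv.mul_apply, hA.1, hA'.1], fun x hx => ?_⟩
    have h := L.add_mem ((hA.1 _).2 (hA'.2 x hx)) (hA.2 x hx)
    rw [map_sub] at h
    simpa [LinearEquiv.mul_apply] using h
  one_mem' := ⟨fun _ => Iff.rfl, fun x _ => by simp⟩
  inv_mem' {A} hA := by
    have hi : ∀ x, A (A⁻¹ x) = x := fun x => by
      rw [← LinearEquiv.mul_apply, mul_inv_cancel, LinearEquiv.coe_one, id]
    refine ⟨fun x => by rw [← hA.1 (A⁻¹ x), hi], fun x hx => ?_⟩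
    rw [← hA.1, map_sub, hi, ← neg_sub]
    exact L.neg_mem (hA.2 x hx)

/-- The group `Γ_L`: the intersection of the kernel of `Aut(L) → Aut(L* / L)` with the identity
component `SO⁺(V_ℝ)` of the real orthogonal group. -/
noncomputable def discriminantKernel (B : LinearMap.BilinForm ℚ V) (L : Submodule ℤ V) :
    Subgroup (V ≃ₗ[ℚ] V) :=
  orthogonalGroup B ⊓ trivialOnDiscriminant B L ⊓
    (identityComponent (orthogonalGroup (LinearMap.BilinForm.baseChange ℝ B))).comap realExt

/-- The group `Γ_{L,I}` (with `U = I_ℚ`), as a subgroup of `P_U`: those elements of `Γ_L`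
in `P_U` that lie in the identity component of the real parabolic group `P_{U_ℝ}`. -/
noncomputable def GammaLI (B : LinearMap.BilinForm ℚ V) (L : Submodule ℤ V)
    (U : Submodule ℚ V) : Subgroup (parabolic B U) :=
  (discriminantKernel B L ⊓
    (identityComponent
      (parabolic (LinearMap.BilinForm.baseChange ℝ B) (U.baseChange ℝ))).comap
        realExt).subgroupOf (parabolic B U)

lemma apply_mem_orthogonal {B : LinearMap.BilinForm ℚ V} {U : Submodule ℚ V}
    (A : parabolic B U) {z : V} (hz : z ∈ B.orthogonal U) : A.1 z ∈ B.orthogonal U := by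
  intro u hu
  have hi : A.1 (A.1⁻¹ u) = u := by
    rw [← LinearEquiv.mul_apply, mul_inv_cancel, LinearEquiv.coe_one, id]
  have hu' : A.1⁻¹ u ∈ U := by rw [← A.2.2, hi]; exact hu
  have h := hz _ hu'
  change B u (A.1 z) = 0
  rw [← hi, A.2.1]
  exact h

/-- The subgroup `Hom^as(U*, U)` of `P_U`, i.e., the group of those elements of `P_U` that
act trivially on `U^⊥`. -/
def homAs (B : LinearMap.BilinForm ℚ V) (U : Submodule ℚ V) : Subgroup (parabolic B U) where
  carrier := {A | ∀ z ∈ B.orthogonal U, A.1 z = z}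
  mul_mem' hA hA' z hz := by
    rw [Subgroup.coe_mul, LinearEquiv.mul_apply, hA' z hz, hA z hz]
  one_mem' _ _ := rfl
  inv_mem' {A} hA z hz := by
    have h : A⁻¹.1 (A.1 z) = z := by
      change (A.1⁻¹ * A.1) z = z
      rw [inv_mul_cancel, LinearEquiv.coe_one, id]
    rw [hA z hz] at h
    exact h

instance homAs_normal (B : LinearMap.BilinForm ℚ V) (U : Submodule ℚ V) :
    (homAs B U).Normal where
  conj_mem N hN A z hz := by
    change A.1 (N.1 (A⁻¹.1 z)) = z
    rw [hN _ (apply_mem_orthogonal A⁻¹ hz)]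
    change (A.1 * A.1⁻¹) z = z
    rw [mul_inv_cancel, LinearEquiv.coe_one, id]

/-- The quotient `P_U / Hom^as(U*, U)`. -/
abbrev ParabolicBar (B : LinearMap.BilinForm ℚ V) (U : Submodule ℚ V) : Type _ :=
  parabolic B U ⧸ homAs B U

/-- The image of `Γ_{L,I}` in the quotient `P_U / Hom^as(U*, U)`. -/
noncomputable def GammaLIBar (B : LinearMap.BilinForm ℚ V) (L : Submodule ℤ V)
    (U : Submodule ℚ V) : Subgroup (ParabolicBar B U) :=
  (GammaLI B L U).map (QuotientGroup.mk' (homAs B U))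

/-- The projection from `Γ_{L,I}` onto its image in `P_U / Hom^as(U*, U)`. -/
noncomputable def toBar (B : LinearMap.BilinForm ℚ V) (L : Submodule ℤ V)
    (U : Submodule ℚ V) : GammaLI B L U →* GammaLIBar B L U :=
  (QuotientGroup.mk' (homAs B U)).subgroupMap (GammaLI B L U)

end Arithmetic

/-! ## The quadratic space `W = U^⊥ / U` and the lattice `Λ` -/

section QuotientSpace

variable {V : Type*} [AddCommGroup V] [Module ℚ V]

/-- The space `W = U^⊥ / U`. -/
abbrev W (B : LinearMap.BilinForm ℚ V) (U : Submodule ℚ V) : Type _ :=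
  B.orthogonal U ⧸ U.submoduleOf (B.orthogonal U)

/-- The projection from `U^⊥` to `W`. -/
abbrev toW (B : LinearMap.BilinForm ℚ V) (U : Submodule ℚ V) :
    B.orthogonal U →ₗ[ℚ] W B U :=
  (U.submoduleOf (B.orthogonal U)).mkQ

/-- The bilinear form on `W` that is induced from the one on `V`. -/
noncomputable def formW (B : LinearMap.BilinForm ℚ V) (hB : B.IsSymm) (U : Submodule ℚ V) :
    LinearMap.BilinForm ℚ (W B U) :=
  LinearMap.liftQ₂ (U.submoduleOf (B.orthogonal U)) (U.submoduleOf (B.orthogonal U))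
    (B.restrict (B.orthogonal U))
    (fun u hu => by
      rw [LinearMap.mem_ker]
      ext z
      exact z.2 u.1 hu)
    (fun u hu => by
      rw [LinearMap.mem_ker]
      ext z
      change B z.1 u.1 = 0
      rw [hB.eq]
      exact z.2 u.1 hu)

lemma formW_toW (B : LinearMap.BilinForm ℚ V) (hB : B.IsSymm) (U : Submodule ℚ V)
    (z z' : B.orthogonal U) : formW B hB U (toW B U z) (toW B U z') = B z.1 z'.1 := rfl

lemma formW_symm (B : LinearMap.BilinForm ℚ V) (hB : B.IsSymm) (U : Submodule ℚ V) :
    (formW B hB U).IsSymm where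
  eq x y := by
    obtain ⟨z, rfl⟩ := Submodule.mkQ_surjective _ x
    obtain ⟨z', rfl⟩ := Submodule.mkQ_surjective _ y
    rw [formW_toW, formW_toW, hB.eq]

/-- The lattice `Λ = (L ∩ U^⊥) / (L ∩ U)` in `W`, i.e., the image of `L ∩ U^⊥` in `W`. -/
def latticeW (B : LinearMap.BilinForm ℚ V) (L : Submodule ℤ V) (U : Submodule ℚ V) :
    Submodule ℤ (W B U) :=
  (L.comap ((B.orthogonal U).subtype.restrictScalars ℤ)).map ((toW B U).restrictScalars ℤ)

/-- A lattice is even if `(x, x)` is an even integer for every `x` in it. -/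
def IsEven (B : LinearMap.BilinForm ℚ V) (L : Submodule ℤ V) : Prop :=
  ∀ x ∈ L, ∃ n : ℤ, B x x = 2 * n

lemma latticeW_integral (B : LinearMap.BilinForm ℚ V) (hB : B.IsSymm) (L : Submodule ℤ V)
    (hL : IsEven B L) (U : Submodule ℚ V) :
    ∀ x ∈ latticeW B L U, ∀ y ∈ latticeW B L U, ∃ n : ℤ, formW B hB U x y = n := by
  rintro _ ⟨z, hz, rfl⟩ _ ⟨z', hz', rfl⟩
  obtain ⟨a, ha⟩ := hL _ hz
  obtain ⟨b, hb⟩ := hL _ hz'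
  obtain ⟨c, hc⟩ := hL _ (L.add_mem hz hz')
  refine ⟨c - a - b, ?_⟩
  change B z.1 z'.1 = _
  change B z.1 z.1 = _ at ha
  change B z'.1 z'.1 = _ at hb
  change B (z.1 + z'.1) (z.1 + z'.1) = _ at hc
  have := hB.eq z.1 z'.1
  simp only [map_add, LinearMap.add_apply] at hc
  push_cast
  linarith

/-- The group `Γ_Λ`: the discriminant kernel of the lattice `Λ` in `W`. -/
noncomputable def GammaW (B : LinearMap.BilinForm ℚ V) (hB : B.IsSymm) (L : Submodule ℤ V)
    (U : Submodule ℚ V) : Subgroup (W B U ≃ₗ[ℚ] W B U) :=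
  discriminantKernel (formW B hB U) (latticeW B L U)

/-- The discriminant group `Δ_Λ = Λ* / Λ`. -/
abbrev discriminantGroup {X : Type*} [AddCommGroup X] [Module ℚ X]
    (b : LinearMap.BilinForm ℚ X) (Λ : Submodule ℤ X) : Type _ :=
  b.dualSubmodule Λ ⧸ Λ.submoduleOf (b.dualSubmodule Λ)

end QuotientSpace

/-! ## Heisenberg groups -/

section Heisenberg

variable {X : Type*} [AddCommGroup X] [Module ℚ X]

/-- The set `X × X × ℚ` underlying the rational Heisenberg group of a quadratic space `X`. -/
@[ext]
structure Heisenberg (b : LinearMap.BilinForm ℚ X) where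
  fst : X
  snd : X
  t : ℚ

namespace Heisenberg

variable {b : LinearMap.BilinForm ℚ X}

instance : Mul (Heisenberg b) :=
  ⟨fun h h' => ⟨h.fst + h'.fst, h.snd + h'.snd,
    h.t + h'.t + (b h.fst h'.snd - b h.snd h'.fst) / 2⟩⟩

instance : One (Heisenberg b) := ⟨⟨0, 0, 0⟩⟩

/-- The inverse; the last coordinate is just `-t` when `b` is symmetric. -/
instance : Inv (Heisenberg b) :=
  ⟨fun h => ⟨-h.fst, -h.snd, -h.t + (b h.fst h.snd - b h.snd h.fst) / 2⟩⟩

@[simp] lemma mul_fst (h h' : Heisenberg b) : (h * h').fst = h.fst + h'.fst := rfl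
@[simp] lemma mul_snd (h h' : Heisenberg b) : (h * h').snd = h.snd + h'.snd := rfl
@[simp] lemma mul_t (h h' : Heisenberg b) :
    (h * h').t = h.t + h'.t + (b h.fst h'.snd - b h.snd h'.fst) / 2 := rfl
@[simp] lemma one_fst : (1 : Heisenberg b).fst = 0 := rfl
@[simp] lemma one_snd : (1 : Heisenberg b).snd = 0 := rfl
@[simp] lemma one_t : (1 : Heisenberg b).t = 0 := rfl
@[simp] lemma inv_fst (h : Heisenberg b) : h⁻¹.fst = -h.fst := rfl
@[simp] lemma inv_snd (h : Heisenberg b) : h⁻¹.snd = -h.snd := rfl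
@[simp] lemma inv_t (h : Heisenberg b) :
    h⁻¹.t = -h.t + (b h.fst h.snd - b h.snd h.fst) / 2 := rfl

instance : Group (Heisenberg b) :=
  Group.ofLeftAxioms
    (fun x y z => by
      ext
      · simp [add_assoc]
      · simp [add_assoc]
      · simp only [mul_t, mul_fst, mul_snd, map_add, LinearMap.add_apply]
        ring)
    (fun x => by ext <;> simp)
    (fun x => by
      ext
      · simp
      · simp
      · simp only [mul_t, inv_t, inv_fst, inv_snd, map_neg, LinearMap.neg_apply, one_t]
        ring)

end Heisenberg

/-- The integral Heisenberg group `H̃(Λ, ℤ)`, consisting of the triples `(λ, μ, t)` with `λ` and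
`μ` in `Λ` and with `t ∈ (λ, μ) / 2 + ℤ`, as a subgroup of the rational one. -/
def integralHeisenberg (b : LinearMap.BilinForm ℚ X) (hb : b.IsSymm) (Λ : Submodule ℤ X)
    (hΛ : ∀ x ∈ Λ, ∀ y ∈ Λ, ∃ n : ℤ, b x y = n) : Subgroup (Heisenberg b) where
  carrier := {h | h.fst ∈ Λ ∧ h.snd ∈ Λ ∧ ∃ n : ℤ, h.t = b h.fst h.snd / 2 + n}
  mul_mem' {h h'} := by
    rintro ⟨h1, h2, n, hn⟩ ⟨h1', h2', n', hn'⟩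
    refine ⟨Λ.add_mem h1 h1', Λ.add_mem h2 h2', ?_⟩
    obtain ⟨m, hm⟩ := hΛ _ h2 _ h1'
    refine ⟨n + n' - m, ?_⟩
    have := hb.eq h'.fst h.snd
    simp only [Heisenberg.mul_t, Heisenberg.mul_fst, Heisenberg.mul_snd, map_add,
      LinearMap.add_apply]
    push_cast
    linarith
  one_mem' := ⟨Λ.zero_mem, Λ.zero_mem, 0, by simp⟩
  inv_mem' {h} := by
    rintro ⟨h1, h2, n, hn⟩
    refine ⟨Λ.neg_mem h1, Λ.neg_mem h2, ?_⟩
    obtain ⟨m, hm⟩ := hΛ _ h1 _ h2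
    refine ⟨-n - m, ?_⟩
    have := hb.eq h.fst h.snd
    simp only [Heisenberg.inv_t, Heisenberg.inv_fst, Heisenberg.inv_snd, map_neg,
      LinearMap.neg_apply]
    push_cast
    linarith

/-- The integral Heisenberg group `H̃(Λ, ℤ)` of the lattice `Λ` in `W`. -/
noncomputable abbrev HeisenbergW {V : Type*} [AddCommGroup V] [Module ℚ V]
    (B : LinearMap.BilinForm ℚ V) (hB : B.IsSymm) (L : Submodule ℤ V) (hL : IsEven B L)
    (U : Submodule ℚ V) : Subgroup (Heisenberg (formW B hB U)) :=
  integralHeisenberg (formW B hB U) (formW_symm B hB U) (latticeW B L U)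
    (latticeW_integral B hB L hL U)

end Heisenberg

/-! ## The lattices inside `U` and the associated subgroups of `SL₂(ℤ)` -/

section Congruence

variable {V : Type*} [AddCommGroup V] [Module ℚ V]

/-- The intersection of a lattice `L` with a subspace `U`. With `L` it gives `I = U ∩ L`, and
with `L*` it gives `I_{L*} = U ∩ L*`. -/
def interLattice (L : Submodule ℤ V) (U : Submodule ℚ V) : Submodule ℤ V :=
  U.restrictScalars ℤ ⊓ L

/-- The vector of `U` with the given rational coordinates in a basis of `I`. -/
noncomputable def ofCoords {I : Submodule ℤ V} (e : Module.Basis (Fin 2) ℤ I) :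
    (Fin 2 → ℚ) →ₗ[ℚ] V :=
  Fintype.linearCombination ℚ (fun i => (e i : V))

lemma ofCoords_mem_iff {I : Submodule ℤ V} (e : Module.Basis (Fin 2) ℤ I) (c : Fin 2 → ℚ) :
    ofCoords e c ∈ I ↔ ∃ n : Fin 2 → ℤ, c = fun i => (n i : ℚ) := by
  have hli : LinearIndependent ℚ (fun i => (e i : V)) := by
    have h := e.linearIndependent.map' I.subtype (Submodule.ker_subtype I)
    exact (LinearIndependent.iff_fractionRing ℤ ℚ).1 h
  have key : ∀ n : Fin 2 → ℤ, ofCoords e (fun i => (n i : ℚ)) = ((∑ i, n i • e i : I) : V) := by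
    intro n
    simp [ofCoords, Fintype.linearCombination_apply, Int.cast_smul_eq_zsmul]
  constructor
  · intro h
    refine ⟨e.repr ⟨_, h⟩, ?_⟩
    apply hli.fintypeLinearCombination_injective
    change ofCoords e c = ofCoords e _
    rw [key, e.sum_repr]
  · rintro ⟨n, rfl⟩
    rw [key]
    exact Subtype.property _

lemma ofCoords_mulVec_mem {I : Submodule ℤ V} (e : Module.Basis (Fin 2) ℤ I) (M : SL(2, ℤ))
    {c : Fin 2 → ℚ} (hc : ofCoords e c ∈ I) :
    ofCoords e (((M : SL(2, ℚ)) : Matrix (Fin 2) (Fin 2) ℚ).mulVec c) ∈ I := by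
  rw [ofCoords_mem_iff] at hc ⊢
  obtain ⟨n, rfl⟩ := hc
  refine ⟨M.1.mulVec n, ?_⟩
  ext i
  simp [Matrix.mulVec, dotProduct]

/-- The group `SL(J, I)` of those automorphisms `M` of `I` of determinant 1 that satisfy
`u - M u ∈ I` for every `u ∈ J` (where `J ⊆ U = I_ℚ`), viewed as a subgroup of `SL₂(ℤ)` through
the basis `e` of `I`. A vector `u ∈ U` is represented by its coordinates `c` in the basis, and
`M` operates on `U` by multiplying the coordinate vector by the matrix. -/
def SLJI {I : Submodule ℤ V} (e : Module.Basis (Fin 2) ℤ I) (J : Submodule ℤ V) :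
    Subgroup SL(2, ℤ) where
  carrier := {M | ∀ c : Fin 2 → ℚ, ofCoords e c ∈ J →
    ofCoords e c - ofCoords e (((M : SL(2, ℚ)) : Matrix (Fin 2) (Fin 2) ℚ).mulVec c) ∈ I}
  mul_mem' {M N} hM hN c hc := by
    have h := I.add_mem (hM c hc) (ofCoords_mulVec_mem e M
      (c := c - ((N : SL(2, ℚ)) : Matrix (Fin 2) (Fin 2) ℚ).mulVec c)
      (by rw [map_sub]; exact hN c hc))
    rw [Matrix.mulVec_sub, map_sub, sub_add_sub_cancel, Matrix.mulVec_mulVec] at h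
    rw [map_mul, Matrix.SpecialLinearGroup.coe_mul]
    exact h
  one_mem' c _ := by simp
  inv_mem' {M} hM c hc := by
    have h1 := hM c hc
    rw [← map_sub] at h1
    have h := I.neg_mem (ofCoords_mulVec_mem e M⁻¹ h1)
    have hMM : (((M⁻¹ : SL(2, ℤ)) : SL(2, ℚ)) : Matrix (Fin 2) (Fin 2) ℚ) *
        ((M : SL(2, ℚ)) : Matrix (Fin 2) (Fin 2) ℚ) = 1 := by
      rw [← Matrix.SpecialLinearGroup.coe_mul, ← map_mul, inv_mul_cancel, map_one,
        Matrix.SpecialLinearGroup.coe_one]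
    rw [Matrix.mulVec_sub, Matrix.mulVec_mulVec, hMM, Matrix.one_mulVec, map_sub,
      neg_sub] at h
    exact h

/-- The group `Γ_{L*} = SL(I_{L*}, I)`, as a subgroup of `SL₂(ℤ)` through the basis `e` of
`I = U ∩ L`, where `I_{L*} = U ∩ L*`. -/
def GammaLdual (B : LinearMap.BilinForm ℚ V) (L : Submodule ℤ V) (U : Submodule ℚ V)
    (e : Module.Basis (Fin 2) ℤ (interLattice L U)) : Subgroup SL(2, ℤ) :=
  SLJI e (interLattice (B.dualSubmodule L) U)

end Congruence

/-! ## Unimodular complements and the map `ι` -/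

section Complement

variable {V : Type*} [AddCommGroup V] [Module ℚ V]

/-- The pairing between two subgroups of `V` is unimodular if it is integral and identifies the
second one with the `ℤ`-dual of the first one. (For a lattice `I` in `U`, this implies that
the pairing between `U` and the subspace spanned by the second subgroup is non-degenerate.) -/
def IsUnimodularPairing (B : LinearMap.BilinForm ℚ V) (I Itilde : Submodule ℤ V) : Prop :=
  (∀ x ∈ I, ∀ y ∈ Itilde, ∃ n : ℤ, B x y = n) ∧
    ∀ f : I →ₗ[ℤ] ℤ, ∃! y : Itilde, ∀ x : I, B x.1 y.1 = (f x : ℚ)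

/-- The lattice `Ĩ_L` of those elements of `Ĩ` whose pairing with `I = U ∩ L` coincides with that
of some element of `L`. -/
def tildeIL (B : LinearMap.BilinForm ℚ V) (L : Submodule ℤ V) (U : Submodule ℚ V)
    (Itilde : Submodule ℤ V) : Submodule ℤ V where
  carrier := {μ | μ ∈ Itilde ∧ ∃ ν ∈ L, ∀ x ∈ interLattice L U, B μ x = B ν x}
  add_mem' := by
    rintro a b ⟨ha, ν, hν, h⟩ ⟨hb, ν', hν', h'⟩
    refine ⟨Itilde.add_mem ha hb, ν + ν', L.add_mem hν hν', fun x hx => ?_⟩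
    simp [h x hx, h' x hx]
  zero_mem' := ⟨Itilde.zero_mem, 0, L.zero_mem, fun _ _ => rfl⟩
  smul_mem' := by
    rintro n a ⟨ha, ν, hν, h⟩
    refine ⟨Itilde.smul_mem n ha, n • ν, L.smul_mem n hν, fun x hx => ?_⟩
    simp [h x hx]

/-- The characterization of the correction map `α : Ũ → U`: it is symmetric, and the space of the
vectors `ũ - α ũ` for `ũ ∈ Ũ` is isotropic. There is a unique such map. -/
def IsCorrectionMap (B : LinearMap.BilinForm ℚ V) (U Utilde : Submodule ℚ V)
    (α : Utilde →ₗ[ℚ] U) : Prop :=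
  (∀ x y : Utilde, B (α x).1 y.1 = B x.1 (α y).1) ∧
    ∀ x y : Utilde, B (x.1 - (α x).1) (y.1 - (α y).1) = 0

/-- The characterization of the homomorphism `ι : Ĩ_L → Δ_Λ`: for `u ∈ U`, `w ∈ W̃ = (U ⊕ Ũ)^⊥`,
and `ũ ∈ Ũ`, the sum `u + w + ũ` lies in `L` if and only if `ũ ∈ Ĩ_L`, the class of `w` in
`W` lies in `Λ*` and represents `ι ũ`, and `u ∈ -2 α ũ + I`. There is a unique such `ι`. -/
def IsIota (B : LinearMap.BilinForm ℚ V) (hB : B.IsSymm) (L : Submodule ℤ V)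
    (U : Submodule ℚ V) (Itilde : Submodule ℤ V)
    (α : Submodule.span ℚ (Itilde : Set V) →ₗ[ℚ] U)
    (ι : tildeIL B L U Itilde →ₗ[ℤ] discriminantGroup (formW B hB U) (latticeW B L U)) :
    Prop :=
  ∀ (u : U) (w : B.orthogonal U) (x : Submodule.span ℚ (Itilde : Set V)),
    w.1 ∈ B.orthogonal (U ⊔ Submodule.span ℚ (Itilde : Set V)) →
    (u.1 + w.1 + x.1 ∈ L ↔
      ∃ (hx : x.1 ∈ tildeIL B L U Itilde)
        (hw : toW B U w ∈ (formW B hB U).dualSubmodule (latticeW B L U)),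
        Submodule.Quotient.mk ⟨toW B U w, hw⟩ = ι ⟨x.1, hx⟩ ∧
          u.1 + (2 : ℚ) • (α x).1 ∈ interLattice L U)

/-- The lattice `I_ι ⊆ U`, the pre-image in `U` of the image of the `ℚ/ℤ`-dual map
`ι* : Δ_Λ → U / I_{L*}`. For `w ∈ Λ*`, the coset `ι*(w + Λ)` consists of those `u ∈ U` with
`(u, ũ) ≡ (w, ι ũ)` modulo `ℤ` for every `ũ ∈ Ĩ_L`. -/
def latticeIota (B : LinearMap.BilinForm ℚ V) (hB : B.IsSymm) (L : Submodule ℤ V)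
    (U : Submodule ℚ V) (Itilde : Submodule ℤ V)
    (ι : tildeIL B L U Itilde →ₗ[ℤ] discriminantGroup (formW B hB U) (latticeW B L U)) :
    Submodule ℤ V where
  carrier := {u | u ∈ U ∧ ∃ w ∈ (formW B hB U).dualSubmodule (latticeW B L U),
    ∀ (x : tildeIL B L U Itilde) (w' : (formW B hB U).dualSubmodule (latticeW B L U)),
      Submodule.Quotient.mk w' = ι x → ∃ n : ℤ, B u x.1 = formW B hB U w w'.1 + n}
  add_mem' := by
    rintro u u' ⟨hu, w, hw, h⟩ ⟨hu', w', hw', h'⟩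
    refine ⟨U.add_mem hu hu', w + w', Submodule.add_mem _ hw hw', fun x v hv => ?_⟩
    obtain ⟨n, hn⟩ := h x v hv
    obtain ⟨n', hn'⟩ := h' x v hv
    refine ⟨n + n', ?_⟩
    simp only [map_add, LinearMap.add_apply, hn, hn']
    push_cast
    ring
  zero_mem' := ⟨U.zero_mem, 0, Submodule.zero_mem _, fun _ _ _ => ⟨0, by simp⟩⟩
  smul_mem' := by
    rintro m u ⟨hu, w, hw, h⟩
    refine ⟨(U.restrictScalars ℤ).smul_mem m hu, m • w, Submodule.smul_mem _ m hw,
      fun x v hv => ?_⟩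
    obtain ⟨n, hn⟩ := h x v hv
    refine ⟨m * n, ?_⟩
    simp only [map_zsmul, LinearMap.smul_apply, hn, zsmul_eq_mul]
    push_cast
    ring

/-- The group `Γ_ι = SL(I_ι, I)`, as a subgroup of `SL₂(ℤ)` through the basis `e` of `I`. -/
def GammaIota (B : LinearMap.BilinForm ℚ V) (hB : B.IsSymm) (L : Submodule ℤ V)
    (U : Submodule ℚ V) (e : Module.Basis (Fin 2) ℤ (interLattice L U)) (Itilde : Submodule ℤ V)
    (ι : tildeIL B L U Itilde →ₗ[ℤ] discriminantGroup (formW B hB U) (latticeW B L U)) :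
    Subgroup SL(2, ℤ) :=
  SLJI e (latticeIota B hB L U Itilde ι)

end Complement

end IntegralParabolic

/-! A basis `e` of `I`, a dual isotropic pair `f` and a section `sec` of `U^⊥ → W` split `V` into
two isotropic planes and a copy of `W` (`SplitData`). In such coordinates the elements needed from
`P_U` are explicit: unipotents `unip x y t`, which multiply as in the Heisenberg group, and Levi
elements `levi (M, g)`. The arithmetic rests on choosing `f` as a modification, by vectors of `U`,
of a dual system `g` inside `L*` (`IntegralSplit`). Vectors of `U^⊥` cannot tell `f` from `g`, so
`sec` maps `Λ` into `L` and `proj` maps `L*` into `Λ*`, although `f` itself need not lie in `L*`.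

The real condition is handled by paths. Unipotents lie on quadratic paths, `SL₂(ℤ)` is generated by
elementary matrices lying on affine paths, and the actions on `W` and on `V` depend affinely on each
other. Conversely, the determinant on `U` never vanishes on the real parabolic group, so it is
positive on the identity component; this forces determinant one on `I`.

For the kernel of `r` (`exists_eq_unip`), an element `A` that is trivial on `I` and `W` moves `g i`
by vectors of `L ∩ U^⊥`, whose classes in `Λ` are the Heisenberg coordinates; what remains is a skew
map with one integral entry. For surjectivity (`exists_lift`), a Levi element is multiplied by a
unipotent that makes it move `L* ∩ U^⊥` by vectors of `L`. By `exists_unip_mul_trivial` a central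
unipotent then achieves triviality on all of `L*/L`: isometry and evenness make the symmetric part
of the obstruction integral, and the skew part is exactly what the center can remove.

A unimodular complement provides a dual system generating `Ĩ`. The `U`-component of a vector in `L*
∩ U^⊥` then lies in `I_ι` (`leviInt_sub_mem`), so over `Γ_ι × Γ_Λ` the Levi element needs only a
central correction. The correction dies modulo `Hom^as(U*, U)`, and the Levi homomorphism becomes
the splitting. -/

namespace IntegralParabolic

/-! ### Identity components: paths, affine maps and signs of determinants. -/

section IdentityComponent

variable {E F : Type*} [AddCommGroup E] [Module ℝ E] [AddCommGroup F] [Module ℝ F]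

lemma identityComponent_mono {G H : Subgroup (E ≃ₗ[ℝ] E)} (h : G ≤ H) :
    identityComponent G ≤ identityComponent H := by
  intro A hA
  let _ : TopologicalSpace (Module.End ℝ E) := moduleTopology ℝ _
  refine connectedComponentIn_mono _ ?_ hA
  rintro f ⟨C, hC, rfl⟩
  exact ⟨C, h hC, rfl⟩

/-- The end point of a quadratic path in `G` that starts at the identity lies in the identity
component. -/
lemma mem_identityComponent_of_path {G : Subgroup (E ≃ₗ[ℝ] E)} (c : ℝ → (E ≃ₗ[ℝ] E))
    (X Y : Module.End ℝ E)
    (hc : ∀ s, (c s : E →ₗ[ℝ] E) = LinearMap.id + s • X + (s ^ 2) • Y)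
    (hG : ∀ s, c s ∈ G) : c 1 ∈ identityComponent G := by
  let _ : TopologicalSpace (Module.End ℝ E) := moduleTopology ℝ _
  have : IsModuleTopology ℝ (Module.End ℝ E) := ⟨rfl⟩
  have : ContinuousAdd (Module.End ℝ E) := IsModuleTopology.toContinuousAdd ℝ _
  have : ContinuousSMul ℝ (Module.End ℝ E) := IsModuleTopology.toContinuousSMul ℝ _
  let p : ℝ → Module.End ℝ E := fun s => LinearMap.id + s • X + (s ^ 2) • Y
  have hp : Continuous p := by fun_prop
  have hpre : IsPreconnected (Set.range p) := isPreconnected_range hp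
  have hsub : Set.range p ⊆ endSet G := by
    rintro _ ⟨s, rfl⟩
    exact ⟨c s, hG s, hc s⟩
  refine hpre.subset_connectedComponentIn ⟨0, ?_⟩ hsub ⟨1, (hc 1).symm⟩
  ext x
  simp [p]

/-- An affine map between spaces of endomorphisms that maps one group into another, and the
identity to the identity, preserves identity components. -/
lemma mem_identityComponent_of_affine {G : Subgroup (E ≃ₗ[ℝ] E)} {H : Subgroup (F ≃ₗ[ℝ] F)}
    (Φ : Module.End ℝ E →ₗ[ℝ] Module.End ℝ F) (C : Module.End ℝ F)
    (hΦ : ∀ A ∈ G, ∃ A' ∈ H, (A' : F →ₗ[ℝ] F) = C + Φ (A : E →ₗ[ℝ] E))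
    (h1 : C + Φ LinearMap.id = LinearMap.id) {A : E ≃ₗ[ℝ] E} (hA : A ∈ identityComponent G)
    {A' : F ≃ₗ[ℝ] F} (hA' : (A' : F →ₗ[ℝ] F) = C + Φ (A : E →ₗ[ℝ] E)) :
    A' ∈ identityComponent H := by
  let _ : TopologicalSpace (Module.End ℝ E) := moduleTopology ℝ _
  let _ : TopologicalSpace (Module.End ℝ F) := moduleTopology ℝ _
  have : IsModuleTopology ℝ (Module.End ℝ E) := ⟨rfl⟩
  have : IsModuleTopology ℝ (Module.End ℝ F) := ⟨rfl⟩
  have : ContinuousAdd (Module.End ℝ F) := IsModuleTopology.toContinuousAdd ℝ _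
  have : ContinuousSMul ℝ (Module.End ℝ F) := IsModuleTopology.toContinuousSMul ℝ _
  have hc : Continuous (fun f => C + Φ f) :=
    continuous_const.add (IsModuleTopology.continuous_of_linearMap Φ)
  have hmaps : Set.MapsTo (fun f => C + Φ f) (endSet G) (endSet H) := by
    rintro f ⟨A, hA, rfl⟩
    exact hΦ A hA
  have hone : ((1 : E ≃ₗ[ℝ] E) : E →ₗ[ℝ] E) ∈ endSet G := ⟨1, G.one_mem, rfl⟩
  have h := hc.continuousOn.mapsTo_connectedComponentIn hone hA
  have h' := connectedComponentIn_mono _ hmaps.image_subset h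
  change (A' : F →ₗ[ℝ] F) ∈ connectedComponentIn (endSet H) _
  rw [hA']
  have h2 : C + Φ ((1 : E ≃ₗ[ℝ] E) : E →ₗ[ℝ] E) = ((1 : F ≃ₗ[ℝ] F) : F →ₗ[ℝ] F) := h1
  rw [h2] at h'
  exact h'

/-- A two-by-two determinant of linear functionals that does not vanish on a group and is positive
at the identity is positive on the identity component. -/
lemma det_pos_of_mem_identityComponent {G : Subgroup (E ≃ₗ[ℝ] E)}
    (p q r s : Module.End ℝ E →ₗ[ℝ] ℝ)
    (hne : ∀ A ∈ G, p (A : E →ₗ[ℝ] E) * q (A : E →ₗ[ℝ] E) -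
      r (A : E →ₗ[ℝ] E) * s (A : E →ₗ[ℝ] E) ≠ 0)
    (h1 : 0 < p LinearMap.id * q LinearMap.id - r LinearMap.id * s LinearMap.id)
    {A : E ≃ₗ[ℝ] E} (hA : A ∈ identityComponent G) :
    0 < p (A : E →ₗ[ℝ] E) * q (A : E →ₗ[ℝ] E) - r (A : E →ₗ[ℝ] E) * s (A : E →ₗ[ℝ] E) := by
  let _ : TopologicalSpace (Module.End ℝ E) := moduleTopology ℝ _
  have : IsModuleTopology ℝ (Module.End ℝ E) := ⟨rfl⟩
  have hp := IsModuleTopology.continuous_of_linearMap p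
  have hq := IsModuleTopology.continuous_of_linearMap q
  have hr := IsModuleTopology.continuous_of_linearMap r
  have hs := IsModuleTopology.continuous_of_linearMap s
  have hc : Continuous (fun f => p f * q f - r f * s f) := by fun_prop
  by_contra hneg
  have hpre := isPreconnected_connectedComponentIn (F := endSet G)
    (x := ((1 : E ≃ₗ[ℝ] E) : E →ₗ[ℝ] E))
  have hone := mem_connectedComponentIn (F := endSet G)
    (x := ((1 : E ≃ₗ[ℝ] E) : E →ₗ[ℝ] E)) ⟨1, G.one_mem, rfl⟩
  -- A non-positive value at `A` would force a zero somewhere on the connected component, which lies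
  -- inside `G`.
  obtain ⟨f, hf, hf0⟩ := hpre.intermediate_value hA hone hc.continuousOn
    ⟨not_lt.1 hneg, h1.le⟩
  obtain ⟨A', hA', rfl⟩ := connectedComponentIn_subset _ _ hf
  exact hne A' hA' hf0

end IdentityComponent

/-- A decomposition of a quadratic space `V` as the orthogonal direct sum of the isotropic plane
`U` with basis `e`, an isotropic plane with the dual basis `f`, and the image of a quadratic
space `X`. -/
structure SplitData {k V X : Type*} [Field k] [AddCommGroup V] [Module k V] [AddCommGroup X]
    [Module k X] (B : LinearMap.BilinForm k V) (b : LinearMap.BilinForm k X)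
    (U : Submodule k V) where
  e : Fin 2 → V
  f : Fin 2 → V
  sec : X →ₗ[k] V
  proj : V →ₗ[k] X
  symm : B.IsSymm
  symm' : b.IsSymm
  span_e : U = Submodule.span k (Set.range e)
  ee : ∀ i j, B (e i) (e j) = 0
  ff : ∀ i j, B (f i) (f j) = 0
  ef : ∀ i j, B (e i) (f j) = if i = j then 1 else 0
  proj_sec : ∀ x, proj (sec x) = x
  proj_e : ∀ i, proj (e i) = 0
  proj_f : ∀ i, proj (f i) = 0
  adj : ∀ x v, B (sec x) v = b x (proj v)
  decomp : ∀ v, ∑ i, B v (f i) • e i + sec (proj v) + ∑ i, B v (e i) • f i = v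

namespace SplitData

variable {k V X : Type*} [Field k] [AddCommGroup V] [Module k V] [AddCommGroup X]
  [Module k X] {B : LinearMap.BilinForm k V} {b : LinearMap.BilinForm k X}
  {U : Submodule k V} (D : SplitData B b U)

lemma fe (i j : Fin 2) : B (D.f i) (D.e j) = if i = j then 1 else 0 := by
  rw [D.symm.eq, D.ef]
  simp [eq_comm]

lemma adj' (x : X) (v : V) : B v (D.sec x) = b (D.proj v) x := by
  rw [D.symm.eq, D.adj, D.symm'.eq]

lemma e_mem (i : Fin 2) : D.e i ∈ U := by
  exact D.span_e.ge (Submodule.subset_span ⟨i, rfl⟩)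

lemma mem_of_eq {v : V} {c : Fin 2 → k} (h : v = ∑ i, c i • D.e i) : v ∈ U := by
  rw [h]
  exact U.sum_mem fun i _ => U.smul_mem _ (D.e_mem i)

lemma exists_of_mem {u : V} (hu : u ∈ U) : ∃ c : Fin 2 → k, u = ∑ i, c i • D.e i := by
  rw [D.span_e] at hu
  obtain ⟨c, hc⟩ := (Submodule.mem_span_range_iff_exists_fun k).1 hu
  exact ⟨c, hc.symm⟩

lemma proj_of_mem {u : V} (hu : u ∈ U) : D.proj u = 0 := by
  obtain ⟨c, rfl⟩ := D.exists_of_mem hu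
  simp [D.proj_e]

lemma eq_sum_of_mem {u : V} (hu : u ∈ U) : u = ∑ i, B u (D.f i) • D.e i := by
  obtain ⟨c, hc⟩ := D.exists_of_mem hu
  conv_lhs => rw [hc]
  simp [hc, D.ef, Fin.sum_univ_two]

lemma mem_orthogonal_iff {z : V} : z ∈ B.orthogonal U ↔ ∀ i, B z (D.e i) = 0 := by
  constructor
  · intro h i
    rw [D.symm.eq]
    exact h _ (D.e_mem i)
  · intro h u hu
    obtain ⟨c, rfl⟩ := D.exists_of_mem hu
    change B _ z = 0
    simp [D.symm.eq _ z, h]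

lemma sec_mem_orthogonal (x : X) : D.sec x ∈ B.orthogonal U := by
  rw [D.mem_orthogonal_iff]
  intro i
  rw [D.adj, D.proj_e, map_zero]

lemma decomp_orthogonal {z : V} (hz : z ∈ B.orthogonal U) :
    ∑ i, B z (D.f i) • D.e i + D.sec (D.proj z) = z := by
  have h := D.decomp z
  rw [D.mem_orthogonal_iff] at hz
  simpa [hz] using h

lemma sub_sec_mem {z : V} (hz : z ∈ B.orthogonal U) : z - D.sec (D.proj z) ∈ U :=
  D.mem_of_eq (c := fun i => B z (D.f i)) (by
    conv_lhs => rw [← D.decomp_orthogonal hz]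
    simp [D.proj_sec, D.proj_e])

lemma le_orthogonal (D : SplitData B b U) : U ≤ B.orthogonal U := by
  intro u hu
  rw [D.mem_orthogonal_iff]
  obtain ⟨c, rfl⟩ := D.exists_of_mem hu
  simp [D.ee]

lemma ext_of_apply {v w : V} (he : ∀ i, B v (D.e i) = B w (D.e i))
    (hf : ∀ i, B v (D.f i) = B w (D.f i)) (hp : D.proj v = D.proj w) : v = w := by
  rw [← D.decomp v, ← D.decomp w]
  simp only [he, hf, hp]

/-! ### Unipotent elements -/

/-- The endomorphism underlying a unipotent element of the parabolic group. -/
def unipEnd (x y : X) (t : k) : Module.End k V :=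
  LinearMap.id - (b x ∘ₗ D.proj).smulRight (D.e 0) - (b y ∘ₗ D.proj).smulRight (D.e 1) +
    (B.flip (D.e 0)).smulRight (D.sec x - (b x x / 2) • D.e 0 + (t - b x y / 2) • D.e 1) +
    (B.flip (D.e 1)).smulRight (D.sec y - (b y y / 2) • D.e 1 - (t + b x y / 2) • D.e 0)

lemma unipEnd_apply (x y : X) (t : k) (v : V) : D.unipEnd x y t v =
    v - b x (D.proj v) • D.e 0 - b y (D.proj v) • D.e 1 +
      B v (D.e 0) • (D.sec x - (b x x / 2) • D.e 0 + (t - b x y / 2) • D.e 1) +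
      B v (D.e 1) • (D.sec y - (b y y / 2) • D.e 1 - (t + b x y / 2) • D.e 0) := rfl

lemma unipEnd_zero : D.unipEnd 0 0 0 = LinearMap.id := by
  ext v
  simp [unipEnd_apply]

/-- The last parameter carries the Heisenberg cocycle; this is the reason for the shape of the group
law. -/
lemma unipEnd_mul [CharZero k] (x y x' y' : X) (t t' : k) :
    D.unipEnd x y t * D.unipEnd x' y' t' =
      D.unipEnd (x + x') (y + y') (t + t' + (b x y' - b y x') / 2) := by
  ext v
  have h1 := D.symm'.eq x x'
  have h3 := D.symm'.eq y x'
  have h4 := D.symm'.eq y y'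
  simp only [Module.End.mul_apply, unipEnd_apply, map_add, map_sub, map_smul,
    LinearMap.add_apply, D.ee, D.proj_e, D.proj_sec, D.adj, map_zero,
    sub_zero, add_zero, zero_smul, ← h1, ← h3, ← h4]
  module

/-- The quadratic coefficients in `unipEnd` are dictated by isometry: they make the images of `f 0`
and `f 1` isotropic and mutually orthogonal. The parameter `t` enters these images with opposite
signs and therefore stays free. -/
lemma unipEnd_orthogonal [CharZero k] (x y : X) (t : k) (v w : V) :
    B (D.unipEnd x y t v) (D.unipEnd x y t w) = B v w := by
  have h0 := D.symm.eq (D.e 0) w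
  have h1 := D.symm.eq (D.e 1) w
  have h2 := D.symm'.eq x y
  have h3 := D.symm'.eq (D.proj v) x
  have h4 := D.symm'.eq (D.proj v) y
  simp only [unipEnd_apply, map_add, map_sub, map_smul,
    LinearMap.add_apply, LinearMap.sub_apply, LinearMap.smul_apply, D.ee, D.proj_e, D.proj_sec,
    D.adj, D.adj', map_zero, LinearMap.zero_apply, sub_zero, add_zero, smul_eq_mul, mul_zero, h0, h1, ← h2,
    h3, h4]
  ring

/-- A unipotent element, as an automorphism of `V`. -/
def unipEquiv [CharZero k] (x y : X) (t : k) : V ≃ₗ[k] V :=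
  LinearEquiv.ofLinearMap (D.unipEnd x y t) (D.unipEnd (-x) (-y) (-t))
    (by
      have h := D.unipEnd_mul x y (-x) (-y) t (-t)
      have h2 := D.symm'.eq x y
      rw [← D.unipEnd_zero]
      refine h.trans ?_
      congr 1 <;> simp [h2])
    (by
      have h := D.unipEnd_mul (-x) (-y) x y (-t) t
      have h2 := D.symm'.eq x y
      rw [← D.unipEnd_zero]
      refine h.trans ?_
      congr 1 <;> simp [h2])

end SplitData

lemma apply_mem_orthogonal_of_mem {k V : Type*} [Field k] [AddCommGroup V] [Module k V]
    {B : LinearMap.BilinForm k V} {U : Submodule k V} {A : V ≃ₗ[k] V} (hA : A ∈ parabolic B U)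
    {z : V} (hz : z ∈ B.orthogonal U) : A z ∈ B.orthogonal U := by
  intro u hu
  have hu' : A.symm u ∈ U := by
    rw [← hA.2]
    simpa using hu
  have h := hA.1 (A.symm u) z
  rw [LinearEquiv.apply_symm_apply] at h
  change B u (A z) = 0
  rw [h]
  exact hz _ hu'

lemma mem_parabolic_of {k V : Type*} [Field k] [AddCommGroup V] [Module k V]
    {B : LinearMap.BilinForm k V} {U : Submodule k V} {A : V ≃ₗ[k] V}
    (h : ∀ x y, B (A x) (A y) = B x y) (hU : ∀ u ∈ U, A u ∈ U) (hU' : ∀ u ∈ U, A.symm u ∈ U) :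
    A ∈ parabolic B U := by
  refine ⟨h, fun x => ⟨fun hx => ?_, hU x⟩⟩
  simpa using hU' _ hx

namespace SplitData

variable {k V X : Type*} [Field k] [AddCommGroup V] [Module k V] [AddCommGroup X]
  [Module k X] {B : LinearMap.BilinForm k V} {b : LinearMap.BilinForm k X}
  {U : Submodule k V} (D : SplitData B b U)

lemma unipEnd_of_orthogonal (x y : X) (t : k) {z : V} (hz : z ∈ B.orthogonal U) :
    D.unipEnd x y t z = z - b x (D.proj z) • D.e 0 - b y (D.proj z) • D.e 1 := by
  rw [D.mem_orthogonal_iff] at hz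
  simp [unipEnd_apply, hz]

lemma unipEnd_of_mem (x y : X) (t : k) {u : V} (hu : u ∈ U) : D.unipEnd x y t u = u := by
  rw [D.unipEnd_of_orthogonal x y t (D.le_orthogonal hu), D.proj_of_mem hu]
  simp

/-- A unipotent element of the parabolic group. -/
def unip [CharZero k] (x y : X) (t : k) : parabolic B U :=
  ⟨D.unipEquiv x y t, mem_parabolic_of (D.unipEnd_orthogonal x y t)
    (fun u hu => by
      change D.unipEnd x y t u ∈ U
      rwa [D.unipEnd_of_mem x y t hu])
    (fun u hu => by
      change D.unipEnd _ _ _ u ∈ U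
      rwa [D.unipEnd_of_mem _ _ _ hu])⟩

lemma unip_apply [CharZero k] (x y : X) (t : k) (v : V) :
    (D.unip x y t).1 v = D.unipEnd x y t v := rfl

lemma unip_mul [CharZero k] (x y x' y' : X) (t t' : k) :
    D.unip x y t * D.unip x' y' t' =
      D.unip (x + x') (y + y') (t + t' + (b x y' - b y x') / 2) := by
  apply Subtype.ext
  apply LinearEquiv.toLinearMap_injective
  exact D.unipEnd_mul x y x' y' t t'

lemma unip_zero [CharZero k] : D.unip 0 0 0 = 1 := by
  apply Subtype.ext
  apply LinearEquiv.toLinearMap_injective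
  exact D.unipEnd_zero

/-- Scaling all three parameters gives a path of degree two starting at the identity, in the form
required by `mem_identityComponent_of_path`. -/
lemma unip_path (x y : X) (t : k) (s : k) : D.unipEnd (s • x) (s • y) (s * t) =
    LinearMap.id + s • (- (b x ∘ₗ D.proj).smulRight (D.e 0) -
      (b y ∘ₗ D.proj).smulRight (D.e 1) + (B.flip (D.e 0)).smulRight (D.sec x + t • D.e 1) +
      (B.flip (D.e 1)).smulRight (D.sec y - t • D.e 0)) +
    (s ^ 2) • (-(B.flip (D.e 0)).smulRight ((b x x / 2) • D.e 0 + (b x y / 2) • D.e 1) -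
      (B.flip (D.e 1)).smulRight ((b y y / 2) • D.e 1 + (b x y / 2) • D.e 0)) := by
  ext v
  simp only [unipEnd_apply, map_smul, LinearMap.smul_apply, LinearMap.add_apply,
    LinearMap.sub_apply, LinearMap.neg_apply, LinearMap.smulRight_apply, LinearMap.comp_apply,
    LinearMap.BilinForm.flip_apply, LinearMap.id_apply, smul_eq_mul]
  module

/-! ### Levi elements -/

/-- The endomorphism that acts through matrices on the two isotropic planes, and through an
endomorphism on their common orthogonal complement. -/
def leviEnd (P Q : Matrix (Fin 2) (Fin 2) k) (g : Module.End k X) : Module.End k V :=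
  ∑ i, (B.flip (D.f i)).smulRight (∑ j, P j i • D.e j) + D.sec ∘ₗ g ∘ₗ D.proj +
    ∑ i, (B.flip (D.e i)).smulRight (∑ j, Q j i • D.f j)

lemma leviEnd_apply (P Q : Matrix (Fin 2) (Fin 2) k) (g : Module.End k X) (v : V) :
    D.leviEnd P Q g v = ∑ i, B v (D.f i) • (∑ j, P j i • D.e j) + D.sec (g (D.proj v)) +
      ∑ i, B v (D.e i) • (∑ j, Q j i • D.f j) := by
  simp [leviEnd]

lemma leviEnd_one : D.leviEnd 1 1 1 = LinearMap.id := by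
  ext v
  rw [leviEnd_apply]
  conv_rhs => rw [← D.decomp v]
  simp [Matrix.one_apply]

lemma proj_leviEnd (P Q : Matrix (Fin 2) (Fin 2) k) (g : Module.End k X) (v : V) :
    D.proj (D.leviEnd P Q g v) = g (D.proj v) := by
  simp [leviEnd_apply, D.proj_e, D.proj_f, D.proj_sec]

lemma leviEnd_e (P Q : Matrix (Fin 2) (Fin 2) k) (g : Module.End k X) (v : V) (i : Fin 2) :
    B (D.leviEnd P Q g v) (D.e i) = ∑ j, Q i j * B v (D.e j) := by
  fin_cases i <;> simp [leviEnd_apply, D.ee, D.fe, D.adj, D.proj_e, mul_comm]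

lemma leviEnd_f (P Q : Matrix (Fin 2) (Fin 2) k) (g : Module.End k X) (v : V) (i : Fin 2) :
    B (D.leviEnd P Q g v) (D.f i) = ∑ j, P i j * B v (D.f j) := by
  fin_cases i <;> simp [leviEnd_apply, D.ff, D.ef, D.adj, D.proj_f, mul_comm]

lemma leviEnd_mul (P Q P' Q' : Matrix (Fin 2) (Fin 2) k) (g g' : Module.End k X) :
    D.leviEnd P Q g * D.leviEnd P' Q' g' = D.leviEnd (P * P') (Q * Q') (g * g') := by
  ext v
  apply D.ext_of_apply
  · intro i
    simp only [Module.End.mul_apply, leviEnd_e, Matrix.mul_apply, Fin.sum_univ_two]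
    ring
  · intro i
    simp only [Module.End.mul_apply, leviEnd_f, Matrix.mul_apply, Fin.sum_univ_two]
    ring
  · simp only [Module.End.mul_apply, proj_leviEnd]

lemma apply_eq (v w : V) : B v w = ∑ i, B v (D.f i) * B w (D.e i) + b (D.proj v) (D.proj w) +
    ∑ i, B v (D.e i) * B w (D.f i) := by
  conv_lhs => rw [← D.decomp w]
  simp only [map_add, map_smul, D.adj', smul_eq_mul, Fin.sum_univ_two]
  ring

lemma leviEnd_orthogonal {P Q : Matrix (Fin 2) (Fin 2) k} {g : Module.End k X}
    (hPQ : P.transpose * Q = 1) (hg : ∀ x y, b (g x) (g y) = b x y) (v w : V) :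
    B (D.leviEnd P Q g v) (D.leviEnd P Q g w) = B v w := by
  rw [D.apply_eq, D.apply_eq v w]
  simp only [leviEnd_e, leviEnd_f, proj_leviEnd, hg, Fin.sum_univ_two]
  have h00 := congrFun (congrFun hPQ 0) 0
  have h01 := congrFun (congrFun hPQ 0) 1
  have h10 := congrFun (congrFun hPQ 1) 0
  have h11 := congrFun (congrFun hPQ 1) 1
  simp [Matrix.mul_apply, Fin.sum_univ_two] at h00 h01 h10 h11
  linear_combination
    (B v (D.f 0) * B w (D.e 0) + B w (D.f 0) * B v (D.e 0)) * h00 +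
    (B v (D.f 0) * B w (D.e 1) + B w (D.f 0) * B v (D.e 1)) * h01 +
    (B v (D.f 1) * B w (D.e 0) + B w (D.f 1) * B v (D.e 0)) * h10 +
    (B v (D.f 1) * B w (D.e 1) + B w (D.f 1) * B v (D.e 1)) * h11

/-- The inverse transpose of a matrix of determinant one. -/
def contra (M : SL(2, k)) : Matrix (Fin 2) (Fin 2) k := ((M⁻¹ : SL(2, k)).1).transpose

lemma contra_eq (M : SL(2, k)) : contra M = !![M.1 1 1, -M.1 1 0; -M.1 0 1, M.1 0 0] := by
  rw [contra, Matrix.SpecialLinearGroup.coe_inv, Matrix.adjugate_fin_two]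
  ext i j
  fin_cases i <;> fin_cases j <;> rfl

lemma contra_mul (M N : SL(2, k)) : contra (M * N) = contra M * contra N := by
  rw [contra, mul_inv_rev, Matrix.SpecialLinearGroup.coe_mul, Matrix.transpose_mul]
  rfl

lemma contra_one : contra (1 : SL(2, k)) = 1 := by simp [contra]

lemma transpose_mul_contra (M : SL(2, k)) : M.1.transpose * contra M = 1 := by
  rw [contra, ← Matrix.transpose_mul, ← Matrix.SpecialLinearGroup.coe_mul, inv_mul_cancel]
  simp

lemma leviEnd_mul_inv (M : SL(2, k)) (g : X ≃ₗ[k] X) :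
    D.leviEnd M.1 (contra M) (g : X →ₗ[k] X) *
      D.leviEnd (M⁻¹).1 (contra M⁻¹) ((g⁻¹ : X ≃ₗ[k] X) : X →ₗ[k] X) = LinearMap.id := by
  rw [leviEnd_mul, ← Matrix.SpecialLinearGroup.coe_mul, ← contra_mul, mul_inv_cancel, contra_one,
    Matrix.SpecialLinearGroup.coe_one, ← D.leviEnd_one]
  congr 1
  ext x
  exact g.apply_symm_apply x

/-- A Levi element, as an automorphism of `V`. -/
def leviEquiv (M : SL(2, k)) (g : X ≃ₗ[k] X) : V ≃ₗ[k] V :=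
  LinearEquiv.ofLinearMap (D.leviEnd M.1 (contra M) (g : X →ₗ[k] X))
    (D.leviEnd (M⁻¹).1 (contra M⁻¹) ((g⁻¹ : X ≃ₗ[k] X) : X →ₗ[k] X))
    (D.leviEnd_mul_inv M g)
    (by
      have h := D.leviEnd_mul_inv M⁻¹ g⁻¹
      rw [inv_inv, inv_inv] at h
      exact h)

lemma leviEnd_of_mem (P Q : Matrix (Fin 2) (Fin 2) k) (g : Module.End k X) {u : V} (hu : u ∈ U) :
    D.leviEnd P Q g u = ∑ i, B u (D.f i) • (∑ j, P j i • D.e j) := by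
  have h := D.le_orthogonal hu
  rw [D.mem_orthogonal_iff] at h
  simp [leviEnd_apply, h, D.proj_of_mem hu]

lemma leviEnd_mem (P Q : Matrix (Fin 2) (Fin 2) k) (g : Module.End k X) {u : V} (hu : u ∈ U) :
    D.leviEnd P Q g u ∈ U := by
  rw [D.leviEnd_of_mem P Q g hu]
  exact U.sum_mem fun i _ => U.smul_mem _ (U.sum_mem fun j _ => U.smul_mem _ (D.e_mem j))

/-- The Levi subgroup of the parabolic group. -/
def levi : SL(2, k) × orthogonalGroup b →* parabolic B U where
  toFun p := ⟨D.leviEquiv p.1 p.2.1,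
    mem_parabolic_of (D.leviEnd_orthogonal (transpose_mul_contra p.1) p.2.2)
      (fun _ hu => D.leviEnd_mem _ _ _ hu) (fun _ hu => D.leviEnd_mem _ _ _ hu)⟩
  map_one' := by
    apply Subtype.ext
    apply LinearEquiv.toLinearMap_injective
    change D.leviEnd _ (contra 1) _ = _
    rw [contra_one]
    exact D.leviEnd_one
  map_mul' p q := by
    apply Subtype.ext
    apply LinearEquiv.toLinearMap_injective
    change D.leviEnd _ (contra (p.1 * q.1)) _ = D.leviEnd _ _ _ * D.leviEnd _ _ _
    rw [contra_mul, leviEnd_mul]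
    rfl

lemma levi_apply (p : SL(2, k) × orthogonalGroup b) (v : V) :
    (D.levi p).1 v = D.leviEnd p.1.1 (contra p.1) (p.2.1 : X →ₗ[k] X) v := rfl

/-! ### The actions on `U` and on `X` -/

/-- The matrix of the restriction to `U`. -/
def mat (A : Module.End k V) : Matrix (Fin 2) (Fin 2) k := fun i j => B (A (D.e j)) (D.f i)

/-- The induced endomorphism of `X`. -/
def act (A : Module.End k V) : Module.End k X := D.proj ∘ₗ A ∘ₗ D.sec

lemma apply_e {A : V ≃ₗ[k] V} (hA : A ∈ parabolic B U) (j : Fin 2) :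
    A (D.e j) = ∑ i, D.mat (A : V →ₗ[k] V) i j • D.e i :=
  D.eq_sum_of_mem ((hA.2 _).2 (D.e_mem j))

lemma mat_mul {A A' : V ≃ₗ[k] V} (hA : A ∈ parabolic B U) (hA' : A' ∈ parabolic B U) :
    D.mat ((A * A' : V ≃ₗ[k] V) : V →ₗ[k] V) =
      D.mat (A : V →ₗ[k] V) * D.mat (A' : V →ₗ[k] V) := by
  ext i j
  change B (A (A' (D.e j))) (D.f i) = _
  rw [D.apply_e hA', map_sum]
  fin_cases i <;> simp [Matrix.mul_apply, D.apply_e hA, D.ef, Fin.sum_univ_two, mul_comm]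

lemma mat_one : D.mat LinearMap.id = 1 := by
  ext i j
  simp [mat, D.ef, Matrix.one_apply, eq_comm]

lemma det_mat_ne_zero {A : V ≃ₗ[k] V} (hA : A ∈ parabolic B U) :
    (D.mat (A : V →ₗ[k] V)).det ≠ 0 := by
  have h := D.mat_mul hA ((parabolic B U).inv_mem hA)
  rw [mul_inv_cancel] at h
  have h' := congrArg Matrix.det (h.symm.trans D.mat_one)
  rw [Matrix.det_mul, Matrix.det_one] at h'
  exact left_ne_zero_of_mul_eq_one h'

/-- The vectors `z` and `sec (proj z)` differ by an element of `U`, which `A` keeps inside `U` and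
`proj` kills. -/
lemma proj_apply {A : V ≃ₗ[k] V} (hA : A ∈ parabolic B U) {z : V} (hz : z ∈ B.orthogonal U) :
    D.proj (A z) = D.act (A : V →ₗ[k] V) (D.proj z) := by
  have h := D.proj_of_mem ((hA.2 _).2 (D.sub_sec_mem hz))
  rw [map_sub, map_sub, sub_eq_zero] at h
  exact h

lemma act_mul {A A' : V ≃ₗ[k] V} (hA : A ∈ parabolic B U) (hA' : A' ∈ parabolic B U) :
    D.act ((A * A' : V ≃ₗ[k] V) : V →ₗ[k] V) =
      D.act (A : V →ₗ[k] V) * D.act (A' : V →ₗ[k] V) := by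
  ext x
  change D.proj (A (A' (D.sec x))) = _
  rw [D.proj_apply hA (apply_mem_orthogonal_of_mem hA' (D.sec_mem_orthogonal x))]
  rfl

lemma act_one : D.act LinearMap.id = LinearMap.id := by
  ext x
  exact D.proj_sec x

/-- On `U^⊥` the form depends only on the projections to `X`, and `A` preserves both the form and
`U^⊥`. -/
lemma act_orthogonal {A : V ≃ₗ[k] V} (hA : A ∈ parabolic B U) (x y : X) :
    b (D.act (A : V →ₗ[k] V) x) (D.act (A : V →ₗ[k] V) y) = b x y := by
  have key : ∀ z ∈ B.orthogonal U, ∀ w ∈ B.orthogonal U, B z w = b (D.proj z) (D.proj w) := by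
    intro z hz w hw
    rw [D.mem_orthogonal_iff] at hz hw
    rw [D.apply_eq]
    simp [hz, hw]
  have hs := D.sec_mem_orthogonal
  have h := hA.1 (D.sec x) (D.sec y)
  rw [key _ (apply_mem_orthogonal_of_mem hA (hs x)) _ (apply_mem_orthogonal_of_mem hA (hs y)),
    key _ (hs x) _ (hs y), D.proj_sec, D.proj_sec] at h
  exact h

/-- The isometry of `X` that is induced by an element of the parabolic group. -/
def actEquiv (A : parabolic B U) : X ≃ₗ[k] X :=
  LinearEquiv.ofLinearMap (D.act (A.1 : V →ₗ[k] V)) (D.act (A⁻¹.1 : V →ₗ[k] V))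
    (by
      have h := D.act_mul A.2 A⁻¹.2
      rw [← Subgroup.coe_mul, mul_inv_cancel] at h
      exact h.symm.trans D.act_one)
    (by
      have h := D.act_mul A⁻¹.2 A.2
      rw [← Subgroup.coe_mul, inv_mul_cancel] at h
      exact h.symm.trans D.act_one)

lemma actEquiv_mem (A : parabolic B U) : D.actEquiv A ∈ orthogonalGroup b :=
  D.act_orthogonal A.2

end SplitData

/-! ### Real points: which elements lie in the identity component of the real parabolic group. -/

namespace SplitData

variable {V X : Type*} [AddCommGroup V] [Module ℚ V] [AddCommGroup X] [Module ℚ X]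
  {B : LinearMap.BilinForm ℚ V} {b : LinearMap.BilinForm ℚ X} {U : Submodule ℚ V}
  (D : SplitData B b U)

/-- Extension of scalars from `ℚ` to `ℝ`. -/
noncomputable def real : SplitData (LinearMap.BilinForm.baseChange ℝ B)
    (LinearMap.BilinForm.baseChange ℝ b) (U.baseChange ℝ) where
  e i := 1 ⊗ₜ[ℚ] D.e i
  f i := 1 ⊗ₜ[ℚ] D.f i
  sec := D.sec.baseChange ℝ
  proj := D.proj.baseChange ℝ
  symm := ⟨(LinearMap.BilinForm.IsSymm.baseChange ℝ ⟨D.symm.eq⟩).eq⟩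
  symm' := ⟨(LinearMap.BilinForm.IsSymm.baseChange ℝ ⟨D.symm'.eq⟩).eq⟩
  span_e := by
    conv_lhs => rw [show U = Submodule.span ℚ (Set.range D.e) from D.span_e]
    rw [Submodule.baseChange_span, ← Set.range_comp]
    rfl
  ee i j := by simp [D.ee]
  ff i j := by simp [D.ff]
  ef i j := by simp [D.ef]
  proj_sec x := by
    induction x with
    | zero => simp
    | tmul s x => simp [D.proj_sec]
    | add x y hx hy => rw [map_add, map_add, hx, hy]
  proj_e i := by simp [D.proj_e]
  proj_f i := by simp [D.proj_f]
  adj x v := by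
    induction x with
    | zero => simp
    | add x y hx hy => simp only [map_add, LinearMap.add_apply, hx, hy]
    | tmul s x =>
      induction v with
      | zero => simp
      | add v w hv hw => simp only [map_add, hv, hw]
      | tmul r v => simp [D.adj]
  decomp v := by
    induction v with
    | zero => simp
    | add v w hv hw =>
      conv_rhs => rw [← hv, ← hw]
      simp only [map_add, LinearMap.add_apply, Fin.sum_univ_two]
      module
    | tmul r v =>
      conv_rhs => rw [← D.decomp v]
      simp [TensorProduct.tmul_add, TensorProduct.smul_tmul', TensorProduct.tmul_smul,
        Fin.sum_univ_two]

lemma real_e (i : Fin 2) : D.real.e i = 1 ⊗ₜ[ℚ] D.e i := rfl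
lemma real_f (i : Fin 2) : D.real.f i = 1 ⊗ₜ[ℚ] D.f i := rfl
lemma real_sec : D.real.sec = D.sec.baseChange ℝ := rfl
lemma real_proj : D.real.proj = D.proj.baseChange ℝ := rfl

lemma coe_realExt (A : V ≃ₗ[ℚ] V) :
    (realExt A : (ℝ ⊗[ℚ] V) →ₗ[ℝ] (ℝ ⊗[ℚ] V)) = (A : V →ₗ[ℚ] V).baseChange ℝ :=
  LinearEquiv.coe_baseChange ..

lemma one_tmul_rat_smul {Y : Type*} [AddCommGroup Y] [Module ℚ Y] (q : ℚ) (y : Y) :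
    (1 : ℝ) ⊗ₜ[ℚ] (q • y) = (q : ℝ) • ((1 : ℝ) ⊗ₜ[ℚ] y) := by
  rw [TensorProduct.tmul_smul, TensorProduct.smul_tmul', TensorProduct.smul_tmul', Rat.smul_def,
    smul_eq_mul]

lemma baseChange_one_tmul {Y : Type*} [AddCommGroup Y] [Module ℚ Y] (c : LinearMap.BilinForm ℚ Y)
    (x y : Y) : LinearMap.BilinForm.baseChange ℝ c (1 ⊗ₜ[ℚ] x) (1 ⊗ₜ[ℚ] y) = (c x y : ℝ) := by
  rw [LinearMap.BilinForm.baseChange_tmul, mul_one, Rat.smul_def, mul_one]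

lemma baseChange_unipEnd (x y : X) (t : ℚ) :
    (D.unipEnd x y t).baseChange ℝ = D.real.unipEnd (1 ⊗ₜ[ℚ] x) (1 ⊗ₜ[ℚ] y) (t : ℝ) := by
  ext v
  simp only [TensorProduct.AlgebraTensorModule.curry_apply,
    TensorProduct.curry_apply, LinearMap.coe_restrictScalars, LinearMap.baseChange_tmul,
    unipEnd_apply, real_e, real_sec, real_proj, TensorProduct.tmul_add, TensorProduct.tmul_sub,
    one_tmul_rat_smul, baseChange_one_tmul, Rat.cast_sub, Rat.cast_div, Rat.cast_add,
    Rat.cast_ofNat]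

lemma baseChange_leviEnd (P Q : Matrix (Fin 2) (Fin 2) ℚ) (g : Module.End ℚ X) :
    (D.leviEnd P Q g).baseChange ℝ =
      D.real.leviEnd (P.map (Rat.castHom ℝ)) (Q.map (Rat.castHom ℝ)) (g.baseChange ℝ) := by
  ext v
  simp only [TensorProduct.AlgebraTensorModule.curry_apply,
    TensorProduct.curry_apply, LinearMap.coe_restrictScalars, LinearMap.baseChange_tmul,
    leviEnd_apply, real_e, real_f, real_sec, real_proj, TensorProduct.tmul_add,
    one_tmul_rat_smul, baseChange_one_tmul, Fin.sum_univ_two, Matrix.map_apply,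
    eq_ratCast]

/-- The identity component of the real parabolic group. -/
noncomputable abbrev realComponent (B : LinearMap.BilinForm ℚ V) (U : Submodule ℚ V) :
    Subgroup ((ℝ ⊗[ℚ] V) ≃ₗ[ℝ] (ℝ ⊗[ℚ] V)) :=
  identityComponent (parabolic (LinearMap.BilinForm.baseChange ℝ B) (U.baseChange ℝ))

lemma realExt_unip_mem (x y : X) (t : ℚ) : realExt (D.unip x y t).1 ∈ realComponent B U := by
  have h := mem_identityComponent_of_path
    (G := parabolic (LinearMap.BilinForm.baseChange ℝ B) (U.baseChange ℝ))
    (fun s => (D.real.unip (s • (1 ⊗ₜ[ℚ] x)) (s • (1 ⊗ₜ[ℚ] y)) (s * (t : ℝ))).1) _ _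
    (fun s => D.real.unip_path (1 ⊗ₜ[ℚ] x) (1 ⊗ₜ[ℚ] y) (t : ℝ) s) (fun s => Subtype.property _)
  convert h using 1
  apply LinearEquiv.toLinearMap_injective
  rw [coe_realExt]
  simp only [one_smul, one_mul]
  exact D.baseChange_unipEnd x y t

/-- Meant for elementary matrices, which are affine in their parameter together with their
contragredients. The resulting Levi elements then form an affine path. -/
lemma exists_realExt_levi_mem (c : ℝ → SL(2, ℝ)) (P Q : Matrix (Fin 2) (Fin 2) ℝ)
    (hP : ∀ s, (c s).1 = 1 + s • P) (hQ : ∀ s, contra (c s) = 1 + s • Q) :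
    (D.real.levi (c 1, 1)).1 ∈ realComponent B U := by
  refine mem_identityComponent_of_path (fun s => (D.real.levi (c s, 1)).1)
    (D.real.leviEnd P Q 0) 0 (fun s => ?_) (fun s => Subtype.property _)
  change D.real.leviEnd (c s).1 (contra (c s)) 1 = _
  rw [hP, hQ, ← D.real.leviEnd_one]
  ext v
  simp [leviEnd_apply, Fin.sum_univ_two]
  module

/-- The Levi subgroup with integral matrices in its first factor. -/
noncomputable def leviInt : SL(2, ℤ) × orthogonalGroup b →* parabolic B U :=
  D.levi.comp ((Matrix.SpecialLinearGroup.map (Int.castRingHom ℚ)).prodMap (MonoidHom.id _))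

lemma leviInt_apply (M : SL(2, ℤ)) (g : orthogonalGroup b) :
    D.leviInt (M, g) = D.levi ((M : SL(2, ℚ)), g) := rfl

lemma contra_map (M : SL(2, ℤ)) :
    (contra (M : SL(2, ℚ))).map (Rat.castHom ℝ) = contra (M : SL(2, ℝ)) := by
  rw [contra_eq, contra_eq]
  ext i j
  fin_cases i <;> fin_cases j <;> simp

lemma coe_map_real (M : SL(2, ℤ)) :
    ((M : SL(2, ℚ)) : Matrix (Fin 2) (Fin 2) ℚ).map (Rat.castHom ℝ) = (M : SL(2, ℝ)).1 := by
  ext i j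
  simp

lemma coe_realExt_leviInt (M : SL(2, ℤ)) (g : orthogonalGroup b) :
    (realExt (D.leviInt (M, g)).1 : (ℝ ⊗[ℚ] V) →ₗ[ℝ] (ℝ ⊗[ℚ] V)) =
      D.real.leviEnd (M : SL(2, ℝ)).1 (contra (M : SL(2, ℝ)))
        (realExt g.1 : (ℝ ⊗[ℚ] X) →ₗ[ℝ] (ℝ ⊗[ℚ] X)) := by
  rw [coe_realExt, coe_realExt, ← contra_map, ← coe_map_real]
  exact D.baseChange_leviEnd _ _ _

lemma realExt_leviInt_one (M : SL(2, ℤ)) :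
    realExt (D.leviInt (M, 1)).1 = (D.real.levi ((M : SL(2, ℝ)), 1)).1 := by
  apply LinearEquiv.toLinearMap_injective
  rw [coe_realExt_leviInt]
  change _ = D.real.leviEnd _ _ _
  congr 1
  rw [show (1 : orthogonalGroup b).1 = 1 from rfl, map_one]
  rfl

/-- The upper triangular elementary matrices. -/
def upperMat {R : Type*} [CommRing R] (s : R) : SL(2, R) :=
  ⟨!![1, s; 0, 1], by simp [Matrix.det_fin_two]⟩

/-- The lower triangular elementary matrices. -/
def lowerMat {R : Type*} [CommRing R] (s : R) : SL(2, R) :=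
  ⟨!![1, 0; s, 1], by simp [Matrix.det_fin_two]⟩

lemma coe_upperMat {R : Type*} [CommRing R] (s : R) :
    (upperMat s : Matrix (Fin 2) (Fin 2) R) = !![1, s; 0, 1] := rfl

lemma coe_lowerMat {R : Type*} [CommRing R] (s : R) :
    (lowerMat s : Matrix (Fin 2) (Fin 2) R) = !![1, 0; s, 1] := rfl

lemma map_upperMat (s : ℤ) : ((upperMat s : SL(2, ℤ)) : SL(2, ℝ)) = upperMat (s : ℝ) := by
  ext i j
  rw [Matrix.SpecialLinearGroup.map_apply_coe, coe_upperMat, coe_upperMat]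
  fin_cases i <;> fin_cases j <;> simp

lemma map_lowerMat (s : ℤ) : ((lowerMat s : SL(2, ℤ)) : SL(2, ℝ)) = lowerMat (s : ℝ) := by
  ext i j
  rw [Matrix.SpecialLinearGroup.map_apply_coe, coe_lowerMat, coe_lowerMat]
  fin_cases i <;> fin_cases j <;> simp

lemma realExt_leviInt_upperMat_mem :
    realExt (D.leviInt (upperMat 1, 1)).1 ∈ realComponent B U := by
  rw [realExt_leviInt_one, map_upperMat, Int.cast_one]
  refine D.exists_realExt_levi_mem (fun s => upperMat s) !![0, 1; 0, 0] !![0, 0; -1, 0]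
    (fun s => ?_) (fun s => ?_)
  · rw [coe_upperMat]
    ext i j
    fin_cases i <;> fin_cases j <;> simp
  · rw [contra_eq, coe_upperMat]
    ext i j
    fin_cases i <;> fin_cases j <;> simp

lemma realExt_leviInt_lowerMat_mem :
    realExt (D.leviInt (lowerMat 1, 1)).1 ∈ realComponent B U := by
  rw [realExt_leviInt_one, map_lowerMat, Int.cast_one]
  refine D.exists_realExt_levi_mem (fun s => lowerMat s) !![0, 0; 1, 0] !![0, -1; 0, 0]
    (fun s => ?_) (fun s => ?_)
  · rw [coe_lowerMat]
    ext i j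
    fin_cases i <;> fin_cases j <;> simp
  · rw [contra_eq, coe_lowerMat]
    ext i j
    fin_cases i <;> fin_cases j <;> simp

/-- Replaces the generator `S` by elementary matrices, for which paths to the identity are
available. -/
lemma S_eq : ModularGroup.S = (upperMat 1)⁻¹ * lowerMat 1 * (upperMat 1)⁻¹ := by
  have h : upperMat 1 * ModularGroup.S * upperMat 1 = lowerMat 1 := by
    apply Subtype.ext
    rw [Matrix.SpecialLinearGroup.coe_mul, Matrix.SpecialLinearGroup.coe_mul,
      ModularGroup.coe_S, coe_upperMat, coe_lowerMat]
    simp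
  rw [← h]
  group

/-- The matrices whose Levi element lies in the identity component form a subgroup of `SL₂(ℤ)`; it
contains both generators `S` and `T`, the latter being `upperMat 1`. -/
lemma realExt_leviInt_one_mem (M : SL(2, ℤ)) :
    realExt (D.leviInt (M, 1)).1 ∈ realComponent B U := by
  let φ : SL(2, ℤ) →* ((ℝ ⊗[ℚ] V) ≃ₗ[ℝ] (ℝ ⊗[ℚ] V)) :=
    realExt.comp ((Subgroup.subtype _).comp (D.leviInt.comp (MonoidHom.inl _ _)))
  have hT : upperMat 1 ∈ (realComponent B U).comap φ := D.realExt_leviInt_upperMat_mem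
  have hl : lowerMat 1 ∈ (realComponent B U).comap φ := D.realExt_leviInt_lowerMat_mem
  have htop : (realComponent B U).comap φ = ⊤ := by
    rw [eq_top_iff, ← SpecialLinearGroup.SL2Z_generators, Subgroup.closure_le]
    rintro x (rfl | rfl)
    · rw [S_eq]
      exact mul_mem (mul_mem (inv_mem hT) hl) (inv_mem hT)
    · exact hT
  have h : M ∈ (realComponent B U).comap φ := htop ▸ Subgroup.mem_top M
  exact h

/-- With the matrix fixed at `1`, the Levi endomorphism is an affine function of `g`, so it carries
the identity component of `O(W_ℝ)` into that of the parabolic group. -/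
lemma realExt_leviInt_snd_mem (g : orthogonalGroup b)
    (hg : realExt g.1 ∈ identityComponent
      (orthogonalGroup (LinearMap.BilinForm.baseChange ℝ b))) :
    realExt (D.leviInt (1, g)).1 ∈ realComponent B U := by
  have hadd : ∀ g : Module.End ℝ (ℝ ⊗[ℚ] X), D.real.leviEnd 1 1 g =
      D.real.leviEnd 1 1 0 + (D.real.sec ∘ₗ g ∘ₗ D.real.proj) := by
    intro g
    ext v
    simp [leviEnd_apply]
    abel
  refine mem_identityComponent_of_affine
    (Φ := (LinearMap.llcomp ℝ _ _ _ D.real.sec) ∘ₗ (LinearMap.lcomp ℝ _ D.real.proj))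
    (C := D.real.leviEnd 1 1 0) (fun A hA => ?_) ?_ hg ?_
  · refine ⟨(D.real.levi (1, ⟨A, hA⟩)).1, Subtype.property _, ?_⟩
    change D.real.leviEnd 1 (contra 1) _ = _
    rw [contra_one, hadd]
    rfl
  · refine (hadd _).symm.trans D.real.leviEnd_one
  · rw [coe_realExt_leviInt, map_one, contra_one, Matrix.SpecialLinearGroup.coe_one, hadd]
    rfl

lemma realExt_leviInt_mem (M : SL(2, ℤ)) (g : orthogonalGroup b)
    (hg : realExt g.1 ∈ identityComponent
      (orthogonalGroup (LinearMap.BilinForm.baseChange ℝ b))) :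
    realExt (D.leviInt (M, g)).1 ∈ realComponent B U := by
  have h : ((M, g) : SL(2, ℤ) × orthogonalGroup b) = (M, 1) * (1, g) := by simp
  rw [h, map_mul, Subgroup.coe_mul, map_mul]
  exact mul_mem (D.realExt_leviInt_one_mem M) (D.realExt_leviInt_snd_mem g hg)

/-- The induced action `proj ∘ A ∘ sec` is linear in `A`, hence respects identity components. -/
lemma realExt_actEquiv_mem (A : parabolic B U) (hA : realExt A.1 ∈ realComponent B U) :
    realExt (D.actEquiv A) ∈ identityComponent
      (orthogonalGroup (LinearMap.BilinForm.baseChange ℝ b)) := by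
  refine mem_identityComponent_of_affine
    (Φ := (LinearMap.llcomp ℝ _ _ _ D.real.proj) ∘ₗ (LinearMap.lcomp ℝ _ D.real.sec))
    (C := 0) (fun A hA => ?_) ?_ hA ?_
  · refine ⟨D.real.actEquiv ⟨A, hA⟩, D.real.actEquiv_mem _, ?_⟩
    rw [zero_add]
    rfl
  · rw [zero_add]
    exact D.real.act_one
  · rw [zero_add, coe_realExt]
    change LinearMap.baseChange ℝ (D.act _) =
      D.real.proj ∘ₗ (realExt A.1 : (ℝ ⊗[ℚ] V) →ₗ[ℝ] (ℝ ⊗[ℚ] V)) ∘ₗ D.real.sec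
    rw [coe_realExt, act, LinearMap.baseChange_comp, LinearMap.baseChange_comp]
    rfl

/-- The determinant on `U_ℝ` is nonzero on the whole real parabolic group and equals one at the
identity. This sign is what excludes determinant `-1` on `I`. -/
lemma det_mat_pos (A : parabolic B U) (hA : realExt A.1 ∈ realComponent B U) :
    0 < (D.mat (A.1 : V →ₗ[ℚ] V)).det := by
  have hmat : ∀ i j, ((D.mat (A.1 : V →ₗ[ℚ] V) i j : ℚ) : ℝ) =
      D.real.mat (realExt A.1 : (ℝ ⊗[ℚ] V) →ₗ[ℝ] (ℝ ⊗[ℚ] V)) i j := by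
    intro i j
    rw [mat, mat, coe_realExt, real_e, real_f, LinearMap.baseChange_tmul, baseChange_one_tmul]
  let p (i j : Fin 2) : Module.End ℝ (ℝ ⊗[ℚ] V) →ₗ[ℝ] ℝ :=
    ((LinearMap.BilinForm.baseChange ℝ B).flip (D.real.f i)) ∘ₗ LinearMap.applyₗ (D.real.e j)
  have h := det_pos_of_mem_identityComponent (p 0 0) (p 1 1) (p 0 1) (p 1 0)
    (fun A hA => by
      have h := D.real.det_mat_ne_zero hA
      rw [Matrix.det_fin_two] at h
      exact h)
    (by
      have h := congrArg Matrix.det D.real.mat_one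
      rw [Matrix.det_fin_two, Matrix.det_one] at h
      have h' := zero_lt_one (α := ℝ)
      rw [← h] at h'
      exact h') hA
  change 0 < D.real.mat (realExt A.1 : (ℝ ⊗[ℚ] V) →ₗ[ℝ] (ℝ ⊗[ℚ] V)) 0 0 *
    D.real.mat (realExt A.1 : (ℝ ⊗[ℚ] V) →ₗ[ℝ] (ℝ ⊗[ℚ] V)) 1 1 -
    D.real.mat (realExt A.1 : (ℝ ⊗[ℚ] V) →ₗ[ℝ] (ℝ ⊗[ℚ] V)) 0 1 *
    D.real.mat (realExt A.1 : (ℝ ⊗[ℚ] V) →ₗ[ℝ] (ℝ ⊗[ℚ] V)) 1 0 at h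
  rw [← hmat, ← hmat, ← hmat, ← hmat] at h
  rw [Matrix.det_fin_two]
  exact_mod_cast h

end SplitData

/-! ### Lattices, sections adapted to them, and duality. -/

section Lattice

variable {V Y : Type*} [AddCommGroup V] [Module ℚ V] [AddCommGroup Y] [Module ℚ Y]

lemma mem_dualSubmodule_iff {B : LinearMap.BilinForm ℚ V} {L : Submodule ℤ V} {v : V} :
    v ∈ B.dualSubmodule L ↔ ∀ y ∈ L, ∃ n : ℤ, B v y = n := by
  simp only [LinearMap.BilinForm.mem_dualSubmodule, Submodule.mem_one, eq_comm,
    algebraMap_int_eq, eq_intCast]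

/-- A surjection of rational vector spaces has a section that maps the image of a given finitely
generated group into that group. -/
lemma exists_lattice_section (π : V →ₗ[ℚ] Y) (N : Submodule ℤ V) (hfg : N.FG)
    (hspan : Submodule.span ℚ (π '' N) = ⊤) :
    ∃ s : Y →ₗ[ℚ] V, (∀ y, π (s y) = y) ∧
      ∀ y ∈ N.map (π.restrictScalars ℤ), s y ∈ N := by
  -- The image of `N` is a lattice, hence free over `ℤ`. Lifting a basis of it into `N` and
  -- extending linearly over `ℚ` gives the section.
  have hlat : Submodule.IsLattice ℚ (N.map (π.restrictScalars ℤ)) := ⟨hfg.map _, hspan⟩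
  let c := Module.Free.chooseBasis ℤ (N.map (π.restrictScalars ℤ))
  let c' := c.extendOfIsLattice ℚ
  have hlift : ∀ i, ∃ v ∈ N, π v = c' i := by
    intro i
    obtain ⟨v, hv, h⟩ := (c i).2
    exact ⟨v, hv, by rw [Module.Basis.extendOfIsLattice_apply, ← h]; rfl⟩
  choose l hl hπ using hlift
  refine ⟨c'.constr ℚ l, fun y => ?_, fun y hy => ?_⟩
  · have h : π ∘ₗ c'.constr ℚ l = LinearMap.id := by
      apply c'.ext
      intro i
      simp [hπ]
    exact LinearMap.congr_fun h y
  · have h := c.sum_repr ⟨y, hy⟩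
    have h' : y = ∑ i, c.repr ⟨y, hy⟩ i • c' i := by
      conv_lhs => rw [show y = ((⟨y, hy⟩ : N.map (π.restrictScalars ℤ)) : Y) from rfl, ← h]
      simp only [c', Module.Basis.extendOfIsLattice_apply, Submodule.coe_sum, Submodule.coe_smul]
    rw [h', map_sum]
    refine N.sum_mem fun i _ => ?_
    rw [map_zsmul, Module.Basis.constr_basis]
    exact N.smul_mem _ (hl i)

lemma exists_smul_mem {L : Submodule ℤ V} (hspan : Submodule.span ℚ (L : Set V) = ⊤) (v : V) :
    ∃ n : ℕ, n ≠ 0 ∧ n • v ∈ L := by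
  have hv : v ∈ Submodule.span ℚ (L : Set V) := hspan ▸ Submodule.mem_top
  induction hv using Submodule.span_induction with
  | mem x hx => exact ⟨1, one_ne_zero, by simpa using hx⟩
  | zero => exact ⟨1, one_ne_zero, by simp⟩
  | add x y _ _ hx hy =>
    obtain ⟨n, hn, h⟩ := hx
    obtain ⟨m, hm, h'⟩ := hy
    refine ⟨n * m, mul_ne_zero hn hm, ?_⟩
    rw [smul_add]
    refine L.add_mem ?_ ?_
    · rw [mul_comm, mul_smul]
      exact L.nsmul_mem h m
    · rw [mul_smul]
      exact L.nsmul_mem h' n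
  | smul q x _ hx =>
    obtain ⟨n, hn, h⟩ := hx
    refine ⟨q.den * n, mul_ne_zero q.den_nz hn, ?_⟩
    have : (q.den * n) • q • x = q.num • (n • x) := by
      rw [← Nat.cast_smul_eq_nsmul ℚ, ← Int.cast_smul_eq_zsmul ℚ, ← Nat.cast_smul_eq_nsmul ℚ,
        smul_smul, smul_smul]
      congr 1
      have := Rat.den_mul_eq_num q
      push_cast
      rw [← this]
      ring
    rw [this]
    exact L.smul_mem _ h

/-- Some multiple of a finitely generated group lies in a given lattice. -/
lemma exists_forall_smul_mem {L N : Submodule ℤ V} (hspan : Submodule.span ℚ (L : Set V) = ⊤)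
    (hN : N.FG) : ∃ n : ℕ, n ≠ 0 ∧ ∀ v ∈ N, n • v ∈ L := by
  obtain ⟨S, rfl⟩ := hN
  choose m hm hmem using exists_smul_mem hspan
  refine ⟨∏ x ∈ S, m x, Finset.prod_ne_zero_iff.2 fun x _ => hm x, fun v hv => ?_⟩
  induction hv using Submodule.span_induction with
  | mem x hx =>
    obtain ⟨c, hc⟩ := Finset.dvd_prod_of_mem m hx
    rw [hc, mul_comm, mul_smul]
    exact L.nsmul_mem (hmem x) c
  | zero => simp
  | add x y _ _ hx hy => rw [smul_add]; exact L.add_mem hx hy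
  | smul a x _ hx => rw [smul_comm]; exact L.smul_mem a hx

lemma exists_apply_eq [FiniteDimensional ℚ V] {B : LinearMap.BilinForm ℚ V}
    (hnd : B.Nondegenerate) (φ : V →ₗ[ℚ] ℚ) : ∃ v, ∀ w, B v w = φ w := by
  refine ⟨(B.toDual hnd).symm φ, fun w => ?_⟩
  rw [LinearMap.BilinForm.apply_toDual_symm_apply]

/-- A functional on a subspace `X` that is integral on `L ∩ X` is represented by an element of
the dual lattice. -/
lemma exists_dual_extension [FiniteDimensional ℚ V] {B : LinearMap.BilinForm ℚ V}
    (hnd : B.Nondegenerate) (L : Submodule ℤ V) [hlat : Submodule.IsLattice ℚ L]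
    (X : Submodule ℚ V) (φ : X →ₗ[ℚ] ℚ) (hφ : ∀ x : X, x.1 ∈ L → ∃ n : ℤ, φ x = n) :
    ∃ v ∈ B.dualSubmodule L, ∀ x : X, B v x = φ x := by
  -- With this section, `id - s ∘ mkQ` projects `V` onto `X` and maps `L` into `L ∩ X`. Composing it
  -- with `φ` extends `φ` to a functional that is integral on `L`.
  obtain ⟨s, hs, hsL⟩ := exists_lattice_section X.mkQ L hlat.fg (by
    rw [Submodule.span_image, hlat.span_eq_top, Submodule.map_top, Submodule.range_mkQ])
  let p : V →ₗ[ℚ] X := (LinearMap.id - s ∘ₗ X.mkQ).codRestrict X (fun v => by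
    rw [← Submodule.Quotient.mk_eq_zero, ← Submodule.mkQ_apply, LinearMap.sub_apply,
      LinearMap.id_apply, LinearMap.comp_apply, map_sub, hs, sub_self])
  have hp : ∀ v, (p v : V) = v - s (X.mkQ v) := fun _ => rfl
  obtain ⟨v, hv⟩ := exists_apply_eq hnd (φ ∘ₗ p)
  refine ⟨v, ?_, fun x => ?_⟩
  · rw [mem_dualSubmodule_iff]
    intro y hy
    rw [hv]
    exact hφ _ (L.sub_mem hy (hsL _ ⟨y, hy, rfl⟩))
  · rw [hv]
    change φ (p x) = φ x
    congr 1
    apply Subtype.ext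
    rw [hp, Submodule.mkQ_apply, (Submodule.Quotient.mk_eq_zero X).2 x.2, map_zero, sub_zero]

lemma exists_basis_span_eq (L : Submodule ℤ V) [hlat : Submodule.IsLattice ℚ L] :
    ∃ (n : ℕ) (c : Module.Basis (Fin n) ℚ V), Submodule.span ℤ (Set.range c) = L := by
  let c := Module.finBasis ℤ L
  refine ⟨_, c.extendOfIsLattice ℚ, ?_⟩
  have h1 := congrArg (Submodule.map L.subtype) c.span_eq
  rw [Submodule.map_span, Submodule.map_top, Submodule.range_subtype, ← Set.range_comp] at h1
  convert h1 using 3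
  ext i
  exact Module.Basis.extendOfIsLattice_apply ..

lemma dual_dual {B : LinearMap.BilinForm ℚ V} (hB : B.IsSymm)
    (hnd : B.Nondegenerate) (L : Submodule ℤ V) [hlat : Submodule.IsLattice ℚ L] :
    B.dualSubmodule (B.dualSubmodule L) = L := by
  obtain ⟨n, c, hc⟩ := exists_basis_span_eq L
  have := LinearMap.BilinForm.dualSubmodule_dualSubmodule_of_basis (R := ℤ) B hnd hB c
  rwa [hc] at this

lemma dual_isLattice {B : LinearMap.BilinForm ℚ V}
    (hnd : B.Nondegenerate) (L : Submodule ℤ V) [hlat : Submodule.IsLattice ℚ L] :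
    Submodule.IsLattice ℚ (B.dualSubmodule L) := by
  classical
  obtain ⟨n, c, hc⟩ := exists_basis_span_eq L
  have h := LinearMap.BilinForm.dualSubmodule_span_of_basis (R := ℤ) B hnd c
  rw [hc] at h
  rw [h]
  refine ⟨Submodule.fg_span (Set.finite_range _), ?_⟩
  rw [Submodule.span_span_of_tower]
  exact Module.Basis.span_eq _

lemma le_dual_of_isEven {B : LinearMap.BilinForm ℚ V} (hB : B.IsSymm) {L : Submodule ℤ V}
    (hL : IsEven B L) : L ≤ B.dualSubmodule L := by
  intro x hx
  rw [mem_dualSubmodule_iff]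
  intro y hy
  obtain ⟨a, ha⟩ := hL _ hx
  obtain ⟨b, hb⟩ := hL _ hy
  obtain ⟨c, hc⟩ := hL _ (L.add_mem hx hy)
  refine ⟨c - a - b, ?_⟩
  have := hB.eq x y
  simp only [map_add, LinearMap.add_apply] at hc
  push_cast
  linarith

end Lattice

/-! ### The splitting determined by a dual system of a basis of `U`. -/

section SplitOf

variable {V : Type*} [AddCommGroup V] [Module ℚ V]

/-- The isotropic modification of a dual system `g` of a basis `ε` of an isotropic subspace. -/
def isotropize (B : LinearMap.BilinForm ℚ V) (ε g : Fin 2 → V) (j : Fin 2) : V :=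
  g j - ∑ i, (B (g j) (g i) / 2) • ε i

variable {B : LinearMap.BilinForm ℚ V} {U : Submodule ℚ V} {ε g : Fin 2 → V}

lemma apply_isotropize (hε : ∀ i j, B (ε i) (ε j) = 0) (i j : Fin 2) :
    B (ε i) (isotropize B ε g j) = B (ε i) (g j) := by
  simp [isotropize, hε]

/-- The correction contributes minus half of the Gram matrix of `g` from each of the two arguments,
and the corrections pair to zero with each other. -/
lemma isotropize_isotropic (hB : B.IsSymm) (hε : ∀ i j, B (ε i) (ε j) = 0)
    (hg : ∀ i j, B (ε i) (g j) = if i = j then 1 else 0) (i j : Fin 2) :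
    B (isotropize B ε g i) (isotropize B ε g j) = 0 := by
  have hg' : ∀ i j, B (g i) (ε j) = if i = j then 1 else 0 := by
    intro i j
    rw [hB.eq, hg]
    simp [eq_comm]
  have h01 := hB.eq (g 0) (g 1)
  fin_cases i <;> fin_cases j <;>
    simp [isotropize, hε, hg, hg', Fin.sum_univ_two] <;> linarith

/-- The projection onto `U^⊥` along the span of `f`. -/
def projOrthogonal (B : LinearMap.BilinForm ℚ V) (ε f : Fin 2 → V) : V →ₗ[ℚ] V :=
  LinearMap.id - ∑ i, (B.flip (ε i)).smulRight (f i)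

lemma projOrthogonal_apply (ε f : Fin 2 → V) (v : V) :
    projOrthogonal B ε f v = v - ∑ i, B v (ε i) • f i := by
  simp [projOrthogonal]

lemma mem_orthogonal_of_span (hB : B.IsSymm) (hspan : U = Submodule.span ℚ (Set.range ε))
    {z : V} (hz : ∀ i, B z (ε i) = 0) : z ∈ B.orthogonal U := by
  intro u hu
  rw [hspan] at hu
  obtain ⟨c, rfl⟩ := (Submodule.mem_span_range_iff_exists_fun ℚ).1 hu
  change B _ z = 0
  simp [hB.eq _ z, hz]

/-- The decomposition of `V` that is determined by a basis `ε` of the isotropic plane `U` and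
a dual system `g`. -/
noncomputable def splitOf (hB : B.IsSymm) (hspan : U = Submodule.span ℚ (Set.range ε))
    (hiso : U ≤ B.orthogonal U) (hg : ∀ i j, B (ε i) (g j) = if i = j then 1 else 0) :
    SplitData B (formW B hB U) U :=
  have hmem : ∀ i, ε i ∈ U := fun i => hspan.ge (Submodule.subset_span ⟨i, rfl⟩)
  have hε : ∀ i j, B (ε i) (ε j) = 0 := fun i j => hiso (hmem j) _ (hmem i)
  have hεf : ∀ i j, B (ε i) (isotropize B ε g j) = if i = j then 1 else 0 := fun i j => by
    rw [apply_isotropize hε, hg]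
  have hfε : ∀ i j, B (isotropize B ε g i) (ε j) = if i = j then 1 else 0 := fun i j => by
    rw [hB.eq, hεf]
    simp [eq_comm]
  have hff := isotropize_isotropic hB hε hg
  let pr : V →ₗ[ℚ] B.orthogonal U :=
    (projOrthogonal B ε (isotropize B ε g)).codRestrict (B.orthogonal U) (fun v => by
      refine mem_orthogonal_of_span hB hspan fun i => ?_
      rw [projOrthogonal_apply]
      fin_cases i <;> simp [hfε])
  -- Removing the `ε`-part selects the representative orthogonal to the isotropic dual vectors. It
  -- kills `U`, so it descends to `W`.
  let lift : B.orthogonal U →ₗ[ℚ] V :=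
    (projOrthogonal B (isotropize B ε g) ε) ∘ₗ (B.orthogonal U).subtype
  let sec : W B U →ₗ[ℚ] V := (U.submoduleOf (B.orthogonal U)).liftQ lift (by
    rintro ⟨z, hz⟩ hzU
    obtain ⟨c, rfl⟩ := (Submodule.mem_span_range_iff_exists_fun ℚ).1 (hspan.le hzU)
    change projOrthogonal B _ _ _ = 0
    rw [projOrthogonal_apply]
    simp [Fin.sum_univ_two, hεf])
  have hpr : ∀ z : B.orthogonal U, pr z.1 = z := fun z => by
    apply Subtype.ext
    change projOrthogonal B _ _ _ = _
    rw [projOrthogonal_apply]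
    have : ∀ i, B z.1 (ε i) = 0 := fun i => by
      rw [hB.eq]
      exact z.2 _ (hmem i)
    simp [this]
  { e := ε
    f := isotropize B ε g
    sec := sec
    proj := toW B U ∘ₗ pr
    symm := hB
    symm' := formW_symm B hB U
    span_e := hspan
    ee := hε
    ff := hff
    ef := hεf
    proj_sec := fun x => by
      obtain ⟨z, rfl⟩ := Submodule.mkQ_surjective _ x
      have hz : sec (toW B U z) = (z - ∑ i, B z.1 (isotropize B ε g i) •
          (⟨ε i, hiso (hmem i)⟩ : B.orthogonal U) : B.orthogonal U) := by
        change projOrthogonal B _ _ _ = _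
        rw [projOrthogonal_apply]
        simp
      rw [LinearMap.comp_apply, hz, hpr, map_sub, map_sum, sub_eq_self]
      refine Finset.sum_eq_zero fun i _ => ?_
      rw [map_smul, Submodule.mkQ_apply, (Submodule.Quotient.mk_eq_zero _).2, smul_zero]
      exact hmem i
    proj_e := fun i => by
      have h := hpr ⟨ε i, hiso (hmem i)⟩
      rw [LinearMap.comp_apply, h, Submodule.mkQ_apply, Submodule.Quotient.mk_eq_zero]
      exact hmem i
    proj_f := fun i => by
      have : pr (isotropize B ε g i) = 0 := by
        apply Subtype.ext
        change projOrthogonal B _ _ _ = 0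
        rw [projOrthogonal_apply]
        fin_cases i <;> simp [hfε]
      rw [LinearMap.comp_apply, this, map_zero]
    adj := fun x v => by
      obtain ⟨z, rfl⟩ := Submodule.mkQ_surjective _ x
      change B (projOrthogonal B _ _ _) v = B z.1 (projOrthogonal B _ _ _)
      rw [projOrthogonal_apply, projOrthogonal_apply]
      simp [hB.eq (ε _) v, mul_comm]
    decomp := fun v => by
      change _ + projOrthogonal B _ _ (projOrthogonal B _ _ _) + _ = _
      rw [projOrthogonal_apply, projOrthogonal_apply]
      simp [hff, Fin.sum_univ_two] }

variable (hB : B.IsSymm) (hspan : U = Submodule.span ℚ (Set.range ε))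
  (hiso : U ≤ B.orthogonal U) (hg : ∀ i j, B (ε i) (g j) = if i = j then 1 else 0)

lemma splitOf_proj (z : B.orthogonal U) : (splitOf hB hspan hiso hg).proj z.1 = toW B U z := by
  change toW B U _ = _
  congr 1
  apply Subtype.ext
  change projOrthogonal B _ _ _ = _
  rw [projOrthogonal_apply]
  have : ∀ i, B z.1 (ε i) = 0 := fun i => by
    rw [hB.eq]
    exact z.2 _ (hspan.ge (Submodule.subset_span ⟨i, rfl⟩))
  simp [this]

end SplitOf

/-! ### Membership in the arithmetic group, and reduction to `I` and `W`. -/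

section Criteria

variable {V : Type*} [AddCommGroup V] [Module ℚ V] {B : LinearMap.BilinForm ℚ V}
  {L : Submodule ℤ V} {U : Submodule ℚ V}

/-- Since `L ⊆ L*`, the displacement condition gives `A L ⊆ L`. If conversely `A x ∈ L`, then
isometry makes `x` pair integrally with `L`, so `x ∈ L*` and `x` differs from `A x` by a vector of
`L`. -/
lemma mem_trivialOnDiscriminant_of {A : V ≃ₗ[ℚ] V} (hLd : L ≤ B.dualSubmodule L)
    (hA : A ∈ orthogonalGroup B) (h : ∀ x ∈ B.dualSubmodule L, A x - x ∈ L) :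
    A ∈ trivialOnDiscriminant B L := by
  refine ⟨fun x => ⟨fun hx => ?_, fun hx => ?_⟩, h⟩
  · have hxd : x ∈ B.dualSubmodule L := by
      rw [mem_dualSubmodule_iff]
      intro y hy
      have h1 := hLd hx
      have h2 : A y ∈ L := by
        have := L.add_mem (h y (hLd hy)) hy
        rwa [sub_add_cancel] at this
      rw [mem_dualSubmodule_iff] at h1
      obtain ⟨n, hn⟩ := h1 _ h2
      exact ⟨n, by rw [← hn, hA]⟩
    have := L.sub_mem hx (h x hxd)
    rwa [sub_sub_cancel] at this
  · have := L.add_mem (h x (hLd hx)) hx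
    rwa [sub_add_cancel] at this

/-- The identity component of the real parabolic group lies in that of the full orthogonal group, so
the condition involving `SO⁺(V_ℝ)` is automatic. -/
lemma mem_GammaLI_iff {A : parabolic B U} : A ∈ GammaLI B L U ↔
    A.1 ∈ trivialOnDiscriminant B L ∧ realExt A.1 ∈ SplitData.realComponent B U := by
  constructor
  · intro h
    exact ⟨h.1.1.2, h.2⟩
  · intro h
    exact ⟨⟨⟨A.2.1, h.1⟩, identityComponent_mono inf_le_left h.2⟩, h.2⟩

end Criteria

/-- A decomposition of `V` for which the dual basis `f` of `U` is the isotropic modification of a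
system of vectors in the dual lattice. -/
structure IntegralSplit {V : Type*} [AddCommGroup V] [Module ℚ V] (B : LinearMap.BilinForm ℚ V)
    (hB : B.IsSymm) (L : Submodule ℤ V) (U : Submodule ℚ V)
    (ε : Module.Basis (Fin 2) ℤ (interLattice L U)) extends SplitData B (formW B hB U) U where
  e_eq : ∀ i, toSplitData.e i = ε i
  proj_eq : ∀ z : B.orthogonal U, toSplitData.proj z = toW B U z
  g : Fin 2 → V
  g_mem : ∀ i, g i ∈ B.dualSubmodule L
  sub_g : ∀ i, toSplitData.f i - g i ∈ U

/-- The pair that consists of a matrix and an automorphism of `W` describes the action of an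
element of the parabolic group on `U` and on `W`. -/
def IsReduction {V : Type*} [AddCommGroup V] [Module ℚ V] {B : LinearMap.BilinForm ℚ V}
    {L : Submodule ℤ V} {U : Submodule ℚ V} (ε : Module.Basis (Fin 2) ℤ (interLattice L U))
    (A : parabolic B U) (M : SL(2, ℤ)) (γ : W B U ≃ₗ[ℚ] W B U) : Prop :=
  (∀ i, A.1 (ε i) = ∑ m, M.1 m i • (ε m : V)) ∧
    ∀ z : B.orthogonal U, γ (toW B U z) = toW B U ⟨A.1 z, apply_mem_orthogonal A z.2⟩

section Reduction

variable {V : Type*} [AddCommGroup V] [Module ℚ V] {B : LinearMap.BilinForm ℚ V}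
  {L : Submodule ℤ V} {U : Submodule ℚ V} {ε : Module.Basis (Fin 2) ℤ (interLattice L U)}

lemma linearIndependent_coe {I : Submodule ℤ V} (e : Module.Basis (Fin 2) ℤ I) :
    LinearIndependent ℚ (fun i => (e i : V)) := by
  have h := e.linearIndependent.map' I.subtype (Submodule.ker_subtype I)
  exact (LinearIndependent.iff_fractionRing ℤ ℚ).1 h

lemma IsReduction.mul {A A' : parabolic B U} {M M' : SL(2, ℤ)} {γ γ' : W B U ≃ₗ[ℚ] W B U}
    (h : IsReduction ε A M γ) (h' : IsReduction ε A' M' γ') :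
    IsReduction ε (A * A') (M * M') (γ * γ') := by
  refine ⟨fun i => ?_, fun z => ?_⟩
  · change A.1 (A'.1 (ε i)) = _
    rw [h'.1]
    simp only [map_add, map_zsmul, h.1, Matrix.SpecialLinearGroup.coe_mul, Matrix.mul_apply,
      Fin.sum_univ_two]
    module
  · rw [LinearEquiv.mul_apply, h'.2, h.2]
    rfl

/-- Uniqueness turns pointwise choices of the pair into a homomorphism, and makes that homomorphism
independent of any splitting. -/
lemma IsReduction.eq {A : parabolic B U} {M M' : SL(2, ℤ)} {γ γ' : W B U ≃ₗ[ℚ] W B U}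
    (h : IsReduction ε A M γ) (h' : IsReduction ε A M' γ') : M = M' ∧ γ = γ' := by
  constructor
  · ext m i
    have h1 := (h.1 i).symm.trans (h'.1 i)
    have hli := (linearIndependent_coe ε).restrict_scalars' ℤ
    exact congrFun (hli.fintypeLinearCombination_injective (a₁ := fun m => M.1 m i)
      (a₂ := fun m => M'.1 m i) (by simpa [Fintype.linearCombination_apply] using h1)) m
  · ext x
    obtain ⟨z, rfl⟩ := Submodule.mkQ_surjective _ x
    rw [h.2, h'.2]

lemma isReduction_one : IsReduction (B := B) ε 1 1 1 := by
  refine ⟨fun i => ?_, fun z => rfl⟩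
  change (ε i : V) = _
  simp [Matrix.one_apply]

lemma IsReduction.exists_apply_eq {A : parabolic B U} {M : SL(2, ℤ)}
    {γ : W B U ≃ₗ[ℚ] W B U} (h : IsReduction ε A M γ) {u : V} (hu : u ∈ interLattice L U) :
    ∃ u' ∈ interLattice L U, A.1 u' = u := by
  have hs : ∀ i, ∃ u' ∈ interLattice L U, A.1 u' = ε i := by
    intro i
    refine ⟨∑ m, (M⁻¹).1 m i • (ε m : V),
      Submodule.sum_mem _ fun m _ => Submodule.smul_mem _ _ (ε m).2, ?_⟩
    have hM : M.1 * (M⁻¹).1 = 1 := by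
      rw [← Matrix.SpecialLinearGroup.coe_mul, mul_inv_cancel, Matrix.SpecialLinearGroup.coe_one]
    have h0 := congrFun (congrFun hM 0) i
    have h1 := congrFun (congrFun hM 1) i
    simp only [Matrix.mul_apply, Fin.sum_univ_two] at h0 h1
    simp only [map_add, map_zsmul, h.1, Fin.sum_univ_two]
    trans (1 : Matrix (Fin 2) (Fin 2) ℤ) 0 i • (ε 0 : V) +
      (1 : Matrix (Fin 2) (Fin 2) ℤ) 1 i • (ε 1 : V)
    · rw [← h0, ← h1]
      module
    · revert i
      simp [Fin.forall_fin_two]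
  choose v hv hA using hs
  have hsum := ε.sum_repr ⟨u, hu⟩
  refine ⟨∑ i, ε.repr ⟨u, hu⟩ i • v i,
    Submodule.sum_mem _ fun m _ => Submodule.smul_mem _ _ (hv m), ?_⟩
  have h2 := congrArg Subtype.val hsum
  simp only [Submodule.coe_sum, Submodule.coe_smul] at h2
  simp only [map_sum, map_zsmul, hA]
  exact h2

end Reduction

/-! ### Integrality in an adapted splitting, and the central correction. -/

namespace IntegralSplit

variable {V : Type*} [AddCommGroup V] [Module ℚ V] {B : LinearMap.BilinForm ℚ V}
  {hB : B.IsSymm} {L : Submodule ℤ V} {U : Submodule ℚ V}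
  {ε : Module.Basis (Fin 2) ℤ (interLattice L U)} (D : IntegralSplit B hB L U ε)

lemma e_mem_lattice (i : Fin 2) : D.e i ∈ L := by
  rw [D.e_eq]
  exact (ε i).2.2

/-- The difference of `f i` and `g i` lies in `U`, which pairs to zero with `U^⊥`. In this way `f`
inherits the integrality of `g`. -/
lemma apply_g_of_orthogonal {z : V} (hz : z ∈ B.orthogonal U) (i : Fin 2) :
    B z (D.g i) = B z (D.f i) := by
  have h := hz _ (D.sub_g i)
  change B _ z = 0 at h
  rw [hB.eq, map_sub, sub_eq_zero] at h
  exact h.symm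

lemma eg (i j : Fin 2) : B (D.e i) (D.g j) = if i = j then 1 else 0 := by
  rw [D.apply_g_of_orthogonal (D.le_orthogonal (D.e_mem i)), D.ef]

lemma ge (i j : Fin 2) : B (D.g i) (D.e j) = if i = j then 1 else 0 := by
  rw [hB.eq, D.eg]
  simp [eq_comm]

lemma mem_of_apply_g {u : V} (hu : u ∈ U) (h : ∀ i, ∃ n : ℤ, B u (D.g i) = n) : u ∈ L := by
  rw [D.eq_sum_of_mem hu]
  refine L.sum_mem fun i _ => ?_
  obtain ⟨n, hn⟩ := h i
  rw [← D.apply_g_of_orthogonal (D.le_orthogonal hu), hn, Int.cast_smul_eq_zsmul]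
  exact L.smul_mem _ (D.e_mem_lattice i)

lemma apply_g_int {l : V} (hl : l ∈ L) (i : Fin 2) : ∃ n : ℤ, B l (D.g i) = n := by
  obtain ⟨n, hn⟩ := mem_dualSubmodule_iff.1 (D.g_mem i) l hl
  exact ⟨n, by rw [hB.eq, hn]⟩

/-- The section is orthogonal to the `g i`, so the `U`-component of a lattice vector in `U^⊥` has
the same integral pairings with them as the vector itself. Hence `sec` maps `Λ` into `L`; it need
not map `Λ*` into `L*`, which is the source of the corrections below. -/
lemma sub_sec_mem_lattice {z : V} (hz : z ∈ B.orthogonal U) (hzL : z ∈ L) :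
    z - D.sec (D.proj z) ∈ L := by
  refine D.mem_of_apply_g (D.sub_sec_mem hz) fun i => ?_
  have h : B (D.sec (D.proj z)) (D.g i) = 0 := by
    rw [D.apply_g_of_orthogonal (D.sec_mem_orthogonal _), D.adj, D.proj_f, map_zero]
  rw [map_sub, LinearMap.sub_apply, h, sub_zero]
  exact D.apply_g_int hzL i

lemma sec_mem {x : W B U} (hx : x ∈ latticeW B L U) : D.sec x ∈ L := by
  obtain ⟨z, hz, rfl⟩ := hx
  have h := D.sub_sec_mem_lattice z.2 hz
  have h' := L.sub_mem hz h
  change z.1 - _ ∈ L at h'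
  rw [sub_sub_cancel, D.proj_eq] at h'
  exact h'

lemma proj_mem_dual {v : V} (hv : v ∈ B.dualSubmodule L) :
    D.proj v ∈ (formW B hB U).dualSubmodule (latticeW B L U) := by
  rw [mem_dualSubmodule_iff] at hv ⊢
  intro y hy
  obtain ⟨n, hn⟩ := hv _ (D.sec_mem hy)
  exact ⟨n, by rw [← hn, D.adj']⟩

lemma proj_mem_lattice {z : V} (hz : z ∈ B.orthogonal U) (hzL : z ∈ L) :
    D.proj z ∈ latticeW B L U :=
  ⟨⟨z, hz⟩, hzL, (D.proj_eq ⟨z, hz⟩).symm⟩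

lemma formW_separating (D : IntegralSplit B hB L U ε) (hnd : B.Nondegenerate) {x : W B U} (hx : ∀ y, formW B hB U x y = 0) :
    x = 0 := by
  have h : D.sec x = 0 := hnd.1 _ fun v => by rw [D.adj, hx]
  rw [← D.proj_sec x, h, map_zero]

lemma formW_nondegenerate (D : IntegralSplit B hB L U ε) (hnd : B.Nondegenerate) :
    (formW B hB U).Nondegenerate :=
  ⟨fun _ hx => D.formW_separating hnd hx, fun x hx => D.formW_separating hnd fun y => by
    rw [(formW_symm B hB U).eq]
    exact hx y⟩

/-- Splits `L*` into the span of the `g i` and `L* ∩ U^⊥`, so that triviality on `L*/L` can be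
tested on the two parts separately. -/
lemma sub_sum_mem {v : V} (hv : v ∈ B.dualSubmodule L) :
    v - ∑ i, B v (D.e i) • D.g i ∈ B.dualSubmodule L ∧
      v - ∑ i, B v (D.e i) • D.g i ∈ B.orthogonal U := by
  constructor
  · refine Submodule.sub_mem _ hv (Submodule.sum_mem _ fun i _ => ?_)
    obtain ⟨n, hn⟩ := mem_dualSubmodule_iff.1 hv _ (D.e_mem_lattice i)
    rw [hn, Int.cast_smul_eq_zsmul]
    exact Submodule.smul_mem _ _ (D.g_mem i)
  · rw [D.mem_orthogonal_iff]
    intro i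
    fin_cases i <;> simp [D.ge, Fin.sum_univ_two]

/-- The unipotent elements that correspond to the integral Heisenberg group move the dual
lattice by vectors from the lattice. -/
lemma unipEnd_sub_mem (hL : IsEven B L) {x y : W B U} (hx : x ∈ latticeW B L U)
    (hy : y ∈ latticeW B L U) {t : ℚ} {n : ℤ} (ht : t = formW B hB U x y / 2 + n) {v : V}
    (hv : v ∈ B.dualSubmodule L) : D.unipEnd x y t v - v ∈ L := by
  have hv' := mem_dualSubmodule_iff.1 hv
  have hx' := D.sec_mem hx
  have hy' := D.sec_mem hy
  obtain ⟨a, ha⟩ := hv' _ hx'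
  obtain ⟨c, hc⟩ := hv' _ hy'
  obtain ⟨p, hp⟩ := hv' _ (D.e_mem_lattice 0)
  obtain ⟨q, hq⟩ := hv' _ (D.e_mem_lattice 1)
  obtain ⟨k, hk⟩ := hL _ hx'
  obtain ⟨l, hl⟩ := hL _ hy'
  obtain ⟨m, hm⟩ := latticeW_integral B hB L hL U x hx y hy
  rw [D.adj', (formW_symm B hB U).eq] at ha hc
  rw [D.adj, D.proj_sec] at hk hl
  -- Evenness makes half of the norms of `x` and `y` the integers `k` and `l`. The condition on `t`
  -- gives the values `n` and `n + m` for `t` minus and plus half the pairing of `x` and `y`.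
  have key : D.unipEnd x y t v - v = (-a - q * (n + m) - p * k) • D.e 0 +
      (-c - q * l + p * n) • D.e 1 + p • D.sec x + q • D.sec y := by
    rw [D.unipEnd_apply, ha, hc, hp, hq, hk, hl, hm, ht, hm]
    simp only [← Int.cast_smul_eq_zsmul ℚ]
    push_cast
    module
  rw [key]
  exact L.add_mem (L.add_mem (L.add_mem (L.smul_mem _ (D.e_mem_lattice 0))
    (L.smul_mem _ (D.e_mem_lattice 1))) (L.smul_mem _ hx')) (L.smul_mem _ hy')

lemma unip_mem (hL : IsEven B L) {x y : W B U} (hx : x ∈ latticeW B L U)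
    (hy : y ∈ latticeW B L U) {t : ℚ} {n : ℤ} (ht : t = formW B hB U x y / 2 + n) :
    D.unip x y t ∈ GammaLI B L U := by
  rw [mem_GammaLI_iff]
  exact ⟨mem_trivialOnDiscriminant_of (le_dual_of_isEven hB hL) (D.unip x y t).2.1
    fun v hv => D.unipEnd_sub_mem hL hx hy ht hv, D.realExt_unip_mem x y t⟩

/-- An element of the parabolic group that acts trivially on the quotient of `L* ∩ U^⊥` modulo
`L` can be corrected to act trivially on `L* / L`. -/
lemma exists_unip_mul_trivial [FiniteDimensional ℚ V] [Submodule.IsLattice ℚ L]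
    (hnd : B.Nondegenerate) (hL : IsEven B L) {A : parabolic B U} {M : SL(2, ℤ)}
    {γ : W B U ≃ₗ[ℚ] W B U} (hA : IsReduction ε A M γ)
    (hγ : ∀ x, γ x ∈ latticeW B L U ↔ x ∈ latticeW B L U)
    (hz : ∀ z ∈ B.dualSubmodule L, z ∈ B.orthogonal U → A.1 z - z ∈ L) :
    ∃ t, (D.unip 0 0 t * A).1 ∈ trivialOnDiscriminant B L := by
  have hLd := le_dual_of_isEven hB hL
  have hlat := dual_isLattice hnd L
  have hsymm : ∀ z, A.1 (A.1.symm z) = z := fun z => A.1.apply_symm_apply z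
  -- A preimage exists up to `U`, because `γ` preserves `Λ`; the error lies in `I`, which `A` maps
  -- onto itself.
  have hinv1 : ∀ l ∈ L, l ∈ B.orthogonal U → A.1.symm l ∈ L := by
    intro l hl hlU
    have h1 : γ.symm (toW B U ⟨l, hlU⟩) ∈ latticeW B L U := by
      rw [← hγ, LinearEquiv.apply_symm_apply]
      exact ⟨⟨l, hlU⟩, hl, rfl⟩
    obtain ⟨l', hl', h⟩ := h1
    change toW B U l' = _ at h
    change l'.1 ∈ L at hl'
    have h2 : toW B U ⟨A.1 l', apply_mem_orthogonal A l'.2⟩ = toW B U ⟨l, hlU⟩ := by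
      rw [← hA.2, h, LinearEquiv.apply_symm_apply]
    have h3 : A.1 l' - l ∈ U := (Submodule.Quotient.eq (U.submoduleOf (B.orthogonal U))).1 h2
    have h4 : A.1 l' - l ∈ L := by
      have := L.sub_mem (L.add_mem (hz _ (hLd hl') l'.2) hl') hl
      rwa [sub_add_cancel] at this
    obtain ⟨u, hu, hAu⟩ := hA.exists_apply_eq ⟨h3, h4⟩
    have h5 : A.1.symm l = l' - u := by
      rw [LinearEquiv.symm_apply_eq, map_sub, hAu, sub_sub_cancel]
    rw [h5]
    exact L.sub_mem hl' hu.2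
  have hinv : ∀ z ∈ B.dualSubmodule L, z ∈ B.orthogonal U → A.1.symm z - z ∈ L := by
    intro z hzd hzU
    have h1 := hinv1 _ (hz z hzd hzU)
      (Submodule.sub_mem _ (apply_mem_orthogonal A hzU) hzU)
    rw [map_sub, LinearEquiv.symm_apply_apply] at h1
    rw [← neg_sub]
    exact L.neg_mem h1
  -- The displacement of `g i` pairs integrally with `L* ∩ U^⊥`, because `A⁻¹` moves the latter by
  -- vectors of `L`. Since `L** = L`, some `l ∈ L` has the same pairings with `U^⊥`, and the
  -- difference lies in `U^⊥⊥ = U`.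
  have hdec : ∀ i, ∃ l ∈ L, A.1 (D.g i) - D.g i - l ∈ U := by
    intro i
    obtain ⟨l, hl, h⟩ := exists_dual_extension hnd (B.dualSubmodule L) (B.orthogonal U)
      ((B (A.1 (D.g i) - D.g i)) ∘ₗ (B.orthogonal U).subtype) (fun z hzd => by
        change ∃ n : ℤ, B (A.1 (D.g i) - D.g i) z.1 = n
        have h1 : B (A.1 (D.g i)) z.1 = B (D.g i) (A.1.symm z.1) := by
          rw [← A.2.1 (D.g i), hsymm]
        rw [map_sub, LinearMap.sub_apply, h1, ← map_sub]
        exact mem_dualSubmodule_iff.1 (D.g_mem i) _ (hinv _ hzd z.2))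
    rw [dual_dual hB hnd] at hl
    refine ⟨l, hl, ?_⟩
    refine (LinearMap.BilinForm.orthogonal_orthogonal hnd hB.isRefl U).le fun z hzU => ?_
    have := h ⟨z, hzU⟩
    change B l z = B (A.1 (D.g i) - D.g i) z at this
    change B z _ = 0
    rw [hB.eq, map_sub, LinearMap.sub_apply, this, sub_self]
  choose l hl hu using hdec
  have hE : ∀ u ∈ U, u = ∑ i, B u (A.1 (D.g i)) • A.1 (D.e i) := by
    intro u hu
    have hu' : A.1.symm u ∈ U := by rw [← A.2.2, hsymm]; exact hu
    have h1 := D.eq_sum_of_mem hu'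
    have h2 := congrArg A.1 h1
    rw [hsymm, map_sum] at h2
    conv_lhs => rw [h2]
    refine Finset.sum_congr rfl fun i _ => ?_
    rw [map_smul, ← D.apply_g_of_orthogonal (D.le_orthogonal hu'), ← A.2.1, hsymm]
  have hUU : ∀ u ∈ U, ∀ u' ∈ U, B u u' = 0 := fun u hu u' hu' => D.le_orthogonal hu' u hu
  let u : Fin 2 → V := fun i => A.1 (D.g i) - D.g i - l i
  have hu : ∀ i, u i ∈ U := hu
  have hAg : ∀ i, A.1 (D.g i) = D.g i + l i + u i := fun i => by simp only [u]; abel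
  -- Isometry on the pair `g i`, `g j` expresses the symmetrized coefficients of `u` in the basis `A
  -- e` through integers. On the diagonal this determines twice the coefficient, and evenness of `L`
  -- permits the division by two.
  have hc : ∀ i j, B (u i) (A.1 (D.g j)) + B (u j) (A.1 (D.g i)) =
      -(B (D.g i) (l j) + B (D.g j) (l i) + B (l i) (l j)) := by
    intro i j
    have h1 := A.2.1 (D.g i) (D.g j)
    rw [hAg, hAg] at h1
    rw [hAg, hAg]
    have e1 := hUU _ (hu i) _ (hu j)
    have e2 := hB.eq (D.g i) (u j)
    have e3 := hB.eq (l i) (u j)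
    have e4 := hB.eq (D.g j) (l i)
    have e5 := hUU _ (hu j) _ (hu i)
    simp only [map_add, LinearMap.add_apply] at h1 ⊢
    linarith
  have hgl : ∀ i j, ∃ n : ℤ, B (D.g i) (l j) = n := fun i j =>
    mem_dualSubmodule_iff.1 (D.g_mem i) _ (hl j)
  have hAe : ∀ i, A.1 (D.e i) ∈ L := by
    intro i
    rw [D.e_eq, hA.1]
    exact L.sum_mem fun m _ => L.smul_mem _ (ε m).2.2
  obtain ⟨c00, h00⟩ : ∃ n : ℤ, B (u 0) (A.1 (D.g 0)) = n := by
    obtain ⟨n, hn⟩ := hgl 0 0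
    obtain ⟨m, hm⟩ := hL _ (hl 0)
    refine ⟨-n - m, ?_⟩
    have := hc 0 0
    push_cast
    linarith
  obtain ⟨c11, h11⟩ : ∃ n : ℤ, B (u 1) (A.1 (D.g 1)) = n := by
    obtain ⟨n, hn⟩ := hgl 1 1
    obtain ⟨m, hm⟩ := hL _ (hl 1)
    refine ⟨-n - m, ?_⟩
    have := hc 1 1
    push_cast
    linarith
  obtain ⟨c, h01⟩ : ∃ n : ℤ, B (u 0) (A.1 (D.g 1)) + B (u 1) (A.1 (D.g 0)) = n := by
    obtain ⟨n, hn⟩ := hgl 0 1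
    obtain ⟨n', hn'⟩ := hgl 1 0
    obtain ⟨m, hm⟩ := mem_dualSubmodule_iff.1 (hLd (hl 0)) _ (hl 1)
    refine ⟨-n - n' - m, ?_⟩
    have := hc 0 1
    push_cast
    linarith
  -- Only the off-diagonal skew part is still uncontrolled. This value removes the coefficient of `u
  -- 0` at `A (e 1)` and turns that of `u 1` at `A (e 0)` into the integral sum `c`.
  let t := -B (u 0) (A.1 (D.g 1))
  -- Because `M` has determinant one, the central unipotent has the same formula in the basis `A e`
  -- as in `e`.
  have hdet : ∀ v, D.unipEnd 0 0 t v =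
      v + t • (B v (A.1 (D.e 0)) • A.1 (D.e 1) - B v (A.1 (D.e 1)) • A.1 (D.e 0)) := by
    intro v
    have hM := M.2
    rw [Matrix.det_fin_two] at hM
    have hMq : (M.1 0 0 : ℚ) * M.1 1 1 - M.1 0 1 * M.1 1 0 = 1 := by exact_mod_cast hM
    rw [D.unipEnd_apply, D.e_eq, D.e_eq, hA.1, hA.1]
    simp only [Fin.sum_univ_two, ← Int.cast_smul_eq_zsmul ℚ, map_add, map_smul, smul_eq_mul,
      map_zero, LinearMap.zero_apply]
    trans v + t • ((M.1 0 0 : ℚ) * M.1 1 1 - M.1 0 1 * M.1 1 0) •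
      (B v (ε 0) • (ε 1 : V) - B v (ε 1) • (ε 0 : V))
    · rw [hMq]
      module
    · module
  refine ⟨t, mem_trivialOnDiscriminant_of hLd (D.unip 0 0 t * A).2.1 fun v hv => ?_⟩
  have hN : ∀ v, (D.unip 0 0 t * A).1 v = D.unipEnd 0 0 t (A.1 v) := fun _ => rfl
  have hAA : ∀ i j, B (A.1 (D.g i)) (A.1 (D.e j)) = if i = j then 1 else 0 := fun i j => by
    rw [A.2.1, D.ge]
  have hg0 : (D.unip 0 0 t * A).1 (D.g 0) - D.g 0 ∈ L := by
    have h1 : (D.unip 0 0 t * A).1 (D.g 0) - D.g 0 = l 0 + c00 • A.1 (D.e 0) := by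
      have h2 := hE _ (hu 0)
      rw [Fin.sum_univ_two, h00] at h2
      rw [hN, hdet, hAA, hAA, hAg 0, h2]
      simp only [t, ← Int.cast_smul_eq_zsmul ℚ]
      simp
      abel
    rw [h1]
    exact L.add_mem (hl 0) (L.smul_mem _ (hAe 0))
  have hg1 : (D.unip 0 0 t * A).1 (D.g 1) - D.g 1 ∈ L := by
    have h1 : (D.unip 0 0 t * A).1 (D.g 1) - D.g 1 =
        l 1 + c • A.1 (D.e 0) + c11 • A.1 (D.e 1) := by
      have h2 := hE _ (hu 1)
      rw [Fin.sum_univ_two, h11] at h2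
      rw [hN, hdet, hAA, hAA, hAg 1, h2]
      simp only [t, ← Int.cast_smul_eq_zsmul ℚ, ← h01]
      simp
      module
    rw [h1]
    exact L.add_mem (L.add_mem (hl 1) (L.smul_mem _ (hAe 0))) (L.smul_mem _ (hAe 1))
  obtain ⟨hzd, hzU⟩ := D.sub_sum_mem hv
  set z := v - ∑ i, B v (D.e i) • D.g i with hzdef
  have hv2 : v = z + (B v (D.e 0) • D.g 0 + B v (D.e 1) • D.g 1) := by
    rw [hzdef, Fin.sum_univ_two, sub_add_cancel]
  obtain ⟨p, hp⟩ := mem_dualSubmodule_iff.1 hv _ (D.e_mem_lattice 0)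
  obtain ⟨q, hq⟩ := mem_dualSubmodule_iff.1 hv _ (D.e_mem_lattice 1)
  rw [hp, hq, Int.cast_smul_eq_zsmul, Int.cast_smul_eq_zsmul] at hv2
  have hNz : (D.unip 0 0 t * A).1 z - z ∈ L := by
    rw [hN, D.unipEnd_of_orthogonal _ _ _ (apply_mem_orthogonal A hzU)]
    simpa using hz z hzd hzU
  rw [hv2]
  have := L.add_mem hNz (L.add_mem (L.smul_mem p hg0) (L.smul_mem q hg1))
  convert this using 1
  simp only [map_add, map_zsmul, smul_sub]
  abel

end IntegralSplit

/-! ### The groups `SL(J, I)` without coordinates. -/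

section Coordinates

variable {V : Type*} [AddCommGroup V] [Module ℚ V] {B : LinearMap.BilinForm ℚ V}
  {L : Submodule ℤ V} {U : Submodule ℚ V} {ε : Module.Basis (Fin 2) ℤ (interLattice L U)}

lemma IsReduction.apply_ofCoords {A : parabolic B U} {M : SL(2, ℤ)} {γ : W B U ≃ₗ[ℚ] W B U}
    (h : IsReduction ε A M γ) (c : Fin 2 → ℚ) : A.1 (ofCoords ε c) =
      ofCoords ε (((M : SL(2, ℚ)) : Matrix (Fin 2) (Fin 2) ℚ).mulVec c) := by
  simp only [ofCoords, Fintype.linearCombination_apply, Fin.sum_univ_two, map_add, map_smul, h.1,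
    Matrix.mulVec, dotProduct, Matrix.SpecialLinearGroup.map_apply_coe, RingHom.mapMatrix_apply,
    Matrix.map_apply, eq_intCast, ← Int.cast_smul_eq_zsmul ℚ]
  module

lemma ofCoords_mem (c : Fin 2 → ℚ) : ofCoords ε c ∈ U := by
  rw [ofCoords, Fintype.linearCombination_apply]
  exact U.sum_mem fun i _ => U.smul_mem _ (ε i).2.1

lemma IsReduction.mem_SLJI_iff {A : parabolic B U} {M : SL(2, ℤ)} {γ : W B U ≃ₗ[ℚ] W B U}
    (h : IsReduction ε A M γ) (hspan : U ≤ Submodule.span ℚ (Set.range fun i => (ε i : V)))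
    {J : Submodule ℤ V} (hJ : ∀ u ∈ J, u ∈ U) :
    M ∈ SLJI ε J ↔ ∀ u ∈ J, A.1 u - u ∈ L := by
  constructor
  · intro hM u hu
    obtain ⟨c, rfl⟩ := (Submodule.mem_span_range_iff_exists_fun ℚ).1 (hspan (hJ u hu))
    have h1 := hM c hu
    rw [← h.apply_ofCoords, ← neg_mem_iff, neg_sub] at h1
    exact h1.2
  · intro hA c hc
    rw [← h.apply_ofCoords, ← neg_mem_iff, neg_sub]
    exact ⟨U.sub_mem ((A.2.2 _).2 (ofCoords_mem c)) (ofCoords_mem c), hA _ hc⟩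

end Coordinates

/-! ### Image, kernel and surjectivity of the reduction. -/

namespace IntegralSplit

variable {V : Type*} [AddCommGroup V] [Module ℚ V] {B : LinearMap.BilinForm ℚ V}
  {hB : B.IsSymm} {L : Submodule ℤ V} {U : Submodule ℚ V}
  {ε : Module.Basis (Fin 2) ℤ (interLattice L U)} (D : IntegralSplit B hB L U ε)

lemma le_span (D : IntegralSplit B hB L U ε) :
    U ≤ Submodule.span ℚ (Set.range fun i => (ε i : V)) := by
  have h := D.span_e.le
  rwa [show D.e = fun i => (ε i : V) from funext D.e_eq] at h

lemma sub_sum_mem_orthogonal (v : V) : v - ∑ i, B v (D.e i) • D.g i ∈ B.orthogonal U := by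
  rw [D.mem_orthogonal_iff]
  intro i
  fin_cases i <;> simp [D.ge, Fin.sum_univ_two]

lemma ext_parabolic {A A' : parabolic B U} (h : ∀ z ∈ B.orthogonal U, A.1 z = A'.1 z)
    (hg : ∀ i, A.1 (D.g i) = A'.1 (D.g i)) : A = A' := by
  apply Subtype.ext
  ext v
  have h1 := h _ (D.sub_sum_mem_orthogonal v)
  rw [map_sub, map_sub, map_sum, map_sum] at h1
  simp only [map_smul, hg] at h1
  exact sub_left_injective h1

lemma isReduction_unip (x y : W B U) (t : ℚ) : IsReduction ε (D.unip x y t) 1 1 := by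
  refine ⟨fun i => ?_, fun z => ?_⟩
  · rw [D.unip_apply, D.unipEnd_of_mem _ _ _ (ε i).2.1]
    simp [Matrix.one_apply]
  · symm
    refine (Submodule.Quotient.eq (U.submoduleOf (B.orthogonal U))).2 ?_
    change D.unipEnd x y t z.1 - z.1 ∈ U
    rw [D.unipEnd_of_orthogonal _ _ _ z.2, sub_sub _ (_ • D.e 0), sub_right_comm,
      sub_self, zero_sub, neg_mem_iff]
    exact U.add_mem (U.smul_mem _ (D.e_mem 0)) (U.smul_mem _ (D.e_mem 1))

lemma isReduction_leviInt (M : SL(2, ℤ)) (γ : orthogonalGroup (formW B hB U)) :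
    IsReduction ε (D.leviInt (M, γ)) M γ.1 := by
  refine ⟨fun i => ?_, fun z => ?_⟩
  · rw [D.leviInt_apply, D.levi_apply, D.leviEnd_of_mem _ _ _ (ε i).2.1, ← D.e_eq]
    fin_cases i <;> simp [D.ef, ← D.e_eq, ← Int.cast_smul_eq_zsmul ℚ]
  · rw [← D.proj_eq, ← D.proj_eq, D.leviInt_apply]
    exact (D.proj_leviEnd _ _ _ _).symm

/-- The functional on `U^⊥` given by pairing with `w` is integral on `L ∩ U^⊥`, so a vector of `L*`
represents it. It vanishes on `U`, which puts that vector into `U^⊥`; thus `L* ∩ U^⊥` maps onto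
`Λ*`. -/
lemma exists_dual_lift [FiniteDimensional ℚ V] [Submodule.IsLattice ℚ L] (hnd : B.Nondegenerate)
    {w : W B U} (hw : w ∈ (formW B hB U).dualSubmodule (latticeW B L U)) :
    ∃ z ∈ B.dualSubmodule L, z ∈ B.orthogonal U ∧ D.proj z = w := by
  obtain ⟨z, hz, h⟩ := exists_dual_extension hnd L (B.orthogonal U) (formW B hB U w ∘ₗ toW B U)
    (fun x hx => mem_dualSubmodule_iff.1 hw _ ⟨x, hx, rfl⟩)
  refine ⟨z, hz, fun u hu => ?_, ?_⟩
  · have h1 := h ⟨u, D.le_orthogonal hu⟩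
    rw [LinearMap.comp_apply, ← D.proj_eq, D.proj_of_mem hu, map_zero] at h1
    change B u z = 0
    rw [hB.eq]
    exact h1
  · rw [← sub_eq_zero]
    refine D.formW_separating hnd fun x => ?_
    rw [map_sub, LinearMap.sub_apply, sub_eq_zero, ← D.adj']
    have h1 := h ⟨D.sec x, D.sec_mem_orthogonal x⟩
    rw [LinearMap.comp_apply, ← D.proj_eq, D.proj_sec] at h1
    exact h1

lemma latticeW_le_dual (hL : IsEven B L) :
    latticeW B L U ≤ (formW B hB U).dualSubmodule (latticeW B L U) := fun x hx =>
  mem_dualSubmodule_iff.2 fun y hy => latticeW_integral B hB L hL U x hx y hy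

lemma exists_matrix {A : parabolic B U} (hA : A ∈ GammaLI B L U) :
    ∃ N : Matrix (Fin 2) (Fin 2) ℤ,
      D.mat (A.1 : V →ₗ[ℚ] V) = N.map (Int.castRingHom ℚ) := by
  have h : ∀ i j, ∃ n : ℤ, D.mat (A.1 : V →ₗ[ℚ] V) i j = n := by
    intro i j
    have h1 : A.1 (D.e j) ∈ L := ((mem_GammaLI_iff.1 hA).1.1 _).2 (D.e_mem_lattice j)
    obtain ⟨n, hn⟩ := D.apply_g_int h1 i
    refine ⟨n, ?_⟩
    rw [← hn, D.apply_g_of_orthogonal (D.le_orthogonal ((A.2.2 _).2 (D.e_mem j)))]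
    rfl
  choose N hN using h
  exact ⟨Matrix.of N, Matrix.ext hN⟩

/-- Triviality on `L*/L` restricts directly to `I_{L*}`, and passes to `Λ*/Λ` because every vector
of `Λ*` lifts to `L* ∩ U^⊥`. -/
lemma exists_isReduction (D : IntegralSplit B hB L U ε) [FiniteDimensional ℚ V] [Submodule.IsLattice ℚ L]
    (hnd : B.Nondegenerate) (hL : IsEven B L)
    {A : parabolic B U} (hA : A ∈ GammaLI B L U) :
    ∃ M ∈ GammaLdual B L U ε, ∃ γ ∈ GammaW B hB L U, IsReduction ε A M γ := by
  obtain ⟨hAt, hAr⟩ := mem_GammaLI_iff.1 hA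
  obtain ⟨N, hN⟩ := D.exists_matrix hA
  obtain ⟨N', hN'⟩ := D.exists_matrix ((GammaLI B L U).inv_mem hA)
  -- The inverse also has an integral matrix, so the determinant is `±1`; the identity component
  -- decides the sign.
  have hdet : N.det = 1 := by
    have h1 := D.mat_mul A.2 A⁻¹.2
    rw [← Subgroup.coe_mul, mul_inv_cancel] at h1
    have h2 := congrArg Matrix.det (h1.symm.trans D.mat_one)
    rw [Matrix.det_mul, Matrix.det_one, hN, hN', ← RingHom.mapMatrix_apply,
      ← RingHom.mapMatrix_apply, ← RingHom.map_det, ← RingHom.map_det, eq_intCast,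
      eq_intCast] at h2
    have h3 : N.det * N'.det = 1 := by exact_mod_cast h2
    have h4 := D.det_mat_pos A hAr
    rw [hN, ← RingHom.mapMatrix_apply, ← RingHom.map_det, eq_intCast] at h4
    have h5 : 0 < N.det := by exact_mod_cast h4
    rcases Int.isUnit_iff.1 (IsUnit.of_mul_eq_one _ h3) with h | h
    · exact h
    · omega
  have hred : IsReduction ε A ⟨N, hdet⟩ (D.actEquiv A) := by
    refine ⟨fun i => ?_, fun z => ?_⟩
    · have h := D.apply_e A.2 i
      rw [D.e_eq, hN] at h
      rw [h]
      simp [D.e_eq, Int.cast_smul_eq_zsmul]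
    · rw [← D.proj_eq, ← D.proj_eq]
      exact (D.proj_apply A.2 z.2).symm
  refine ⟨⟨N, hdet⟩, ?_, D.actEquiv A, ?_, hred⟩
  · refine (hred.mem_SLJI_iff D.le_span (J := interLattice (B.dualSubmodule L) U)
      (fun u hu => hu.1)).2 fun u hu => ?_
    exact hAt.2 u hu.2
  · refine ⟨⟨D.actEquiv_mem A, ?_⟩, D.realExt_actEquiv_mem A hAr⟩
    refine mem_trivialOnDiscriminant_of (latticeW_le_dual hL) (D.actEquiv_mem A) fun w hw => ?_
    obtain ⟨z, hz, hzU, rfl⟩ := D.exists_dual_lift hnd hw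
    change D.act _ _ - _ ∈ _
    rw [← D.proj_apply A.2 hzU, ← map_sub]
    exact D.proj_mem_lattice (Submodule.sub_mem _ (apply_mem_orthogonal A hzU) hzU) (hAt.2 z hz)

/-- The displacements of the `g i` lie in `L ∩ U^⊥`, and isometry shows that their classes in `Λ`
determine `A` on `U^⊥`. After division by the corresponding unipotent, the remaining factor fixes
`U^⊥` and is therefore central unipotent with an integral parameter. -/
lemma exists_eq_unip [FiniteDimensional ℚ V] (hnd : B.Nondegenerate) (hL : IsEven B L)
    {A : parabolic B U} (hA : A ∈ GammaLI B L U) (hred : IsReduction ε A 1 1) :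
    ∃ x ∈ latticeW B L U, ∃ y ∈ latticeW B L U, ∃ n : ℤ,
      A = D.unip x y (formW B hB U x y / 2 + n) := by
  have hAe : ∀ i, A.1 (D.e i) = D.e i := by
    intro i
    rw [D.e_eq, hred.1]
    simp [Matrix.one_apply]
  have hlU : ∀ i, A.1 (D.g i) - D.g i ∈ B.orthogonal U := by
    intro i
    rw [D.mem_orthogonal_iff]
    intro j
    have h := A.2.1 (D.g i) (D.e j)
    rw [hAe] at h
    rw [map_sub, LinearMap.sub_apply, h, sub_self]
  have hlL : ∀ i, A.1 (D.g i) - D.g i ∈ L := fun i =>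
    (mem_GammaLI_iff.1 hA).1.2 _ (D.g_mem i)
  set x : Fin 2 → W B U := fun i => D.proj (A.1 (D.g i) - D.g i) with hx
  have hxL : ∀ i, x i ∈ latticeW B L U := fun i => D.proj_mem_lattice (hlU i) (hlL i)
  have hAz : ∀ z ∈ B.orthogonal U, A.1 z = D.unipEnd (x 0) (x 1) (formW B hB U (x 0) (x 1) / 2) z := by
    intro z hz
    have hu : A.1 z - z ∈ U :=
      (Submodule.Quotient.eq (U.submoduleOf (B.orthogonal U))).1 (hred.2 ⟨z, hz⟩).symm
    -- The displacement of `z` lies in `U` and that of `g i` in `U^⊥`, so the cross term in the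
    -- isometry relation vanishes.
    have hc : ∀ i, B (A.1 z - z) (D.f i) = - formW B hB U (x i) (D.proj z) := by
      intro i
      have h1 := A.2.1 z (D.g i)
      have h2 : B (A.1 z - z) (A.1 (D.g i) - D.g i) = 0 := hlU i _ hu
      have h3 : B z (A.1 (D.g i) - D.g i) = formW B hB U (D.proj z) (x i) := by
        simp only [hx]
        rw [D.proj_eq ⟨z, hz⟩, D.proj_eq ⟨_, hlU i⟩]
        rfl
      rw [(formW_symm B hB U).eq, ← h3, ← D.apply_g_of_orthogonal (D.le_orthogonal hu)]
      simp only [map_sub, LinearMap.sub_apply] at h2 ⊢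
      linarith
    have h := D.eq_sum_of_mem hu
    rw [Fin.sum_univ_two, hc, hc, sub_eq_iff_eq_add] at h
    rw [D.unipEnd_of_orthogonal _ _ _ hz, h]
    module
  set N := D.unip (x 0) (x 1) (formW B hB U (x 0) (x 1) / 2) with hNdef
  have hN : N ∈ GammaLI B L U := D.unip_mem hL (hxL 0) (hxL 1) (n := 0) (by simp)
  have hC : N⁻¹ * A ∈ GammaLI B L U := mul_mem (inv_mem hN) hA
  obtain ⟨C, hCdef⟩ : ∃ C, C = N⁻¹ * A := ⟨_, rfl⟩
  rw [← hCdef] at hC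
  have hNC : A = N * C := by rw [hCdef, mul_inv_cancel_left]
  have hCz : ∀ z ∈ B.orthogonal U, C.1 z = z := by
    intro z hz
    apply N.1.injective
    have h := hAz z hz
    rw [hNC] at h
    exact h
  have hmU : ∀ i, C.1 (D.g i) - D.g i ∈ U := by
    intro i
    refine (LinearMap.BilinForm.orthogonal_orthogonal hnd hB.isRefl U).le fun z hz => ?_
    have h := C.2.1 z (D.g i)
    rw [hCz z hz] at h
    change B z _ = 0
    rw [map_sub, h, sub_self]
  have hmL : ∀ i, C.1 (D.g i) - D.g i ∈ L := fun i => (mem_GammaLI_iff.1 hC).1.2 _ (D.g_mem i)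
  -- The displacements under `C` lie in `U` and are mutually orthogonal, so isometry leaves a skew
  -- matrix. It has a single free entry, an integer because the displacements lie in `L`.
  have hsk : ∀ i j, B (C.1 (D.g i) - D.g i) (D.g j) + B (C.1 (D.g j) - D.g j) (D.g i) = 0 := by
    intro i j
    have h1 := C.2.1 (D.g i) (D.g j)
    have h2 : B (C.1 (D.g i) - D.g i) (C.1 (D.g j) - D.g j) = 0 :=
      D.le_orthogonal (hmU j) _ (hmU i)
    have h3 := hB.eq (C.1 (D.g j)) (D.g i)
    have h4 := hB.eq (D.g j) (D.g i)
    simp only [map_sub, LinearMap.sub_apply] at h2 ⊢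
    linarith
  obtain ⟨n, hn⟩ := D.apply_g_int (hmL 0) 1
  have hCn : C = D.unip 0 0 (n : ℚ) := by
    apply D.ext_parabolic
    · intro z hz
      rw [hCz z hz, D.unip_apply, D.unipEnd_of_orthogonal _ _ _ hz]
      simp
    · intro i
      have h := D.eq_sum_of_mem (hmU i)
      simp only [← D.apply_g_of_orthogonal (D.le_orthogonal (hmU i))] at h
      rw [sub_eq_iff_eq_add] at h
      rw [h, D.unip_apply, D.unipEnd_apply, Fin.sum_univ_two]
      have h00 := hsk 0 0
      have h11 := hsk 1 1
      have h01 := hsk 0 1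
      have k0 : B (C.1 (D.g 0) - D.g 0) (D.g 0) = 0 := by linarith
      have k1 : B (C.1 (D.g 1) - D.g 1) (D.g 1) = 0 := by linarith
      have k2 : B (C.1 (D.g 1) - D.g 1) (D.g 0) = -n := by linarith
      fin_cases i
      · simp [k0, hn, D.ge, -map_sub]
        abel
      · simp [k1, k2, D.ge, -map_sub]
        abel
  refine ⟨x 0, hxL 0, x 1, hxL 1, n, ?_⟩
  rw [hNC, hCn, hNdef, D.unip_mul]
  simp

/-- Membership in `Γ_{L,I}` is thereby tested on `L* ∩ U^⊥` only: the central correction changes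
neither the reduction nor the identity component. -/
lemma exists_mem_isReduction [FiniteDimensional ℚ V] [Submodule.IsLattice ℚ L]
    (hnd : B.Nondegenerate) (hL : IsEven B L) {A : parabolic B U} {M : SL(2, ℤ)}
    {γ : W B U ≃ₗ[ℚ] W B U} (hγ : γ ∈ GammaW B hB L U) (hred : IsReduction ε A M γ)
    (hA : realExt A.1 ∈ SplitData.realComponent B U)
    (hz : ∀ z ∈ B.dualSubmodule L, z ∈ B.orthogonal U → A.1 z - z ∈ L) :
    ∃ t, D.unip 0 0 t * A ∈ GammaLI B L U ∧ IsReduction ε (D.unip 0 0 t * A) M γ := by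
  obtain ⟨t, ht⟩ := D.exists_unip_mul_trivial hnd hL hred hγ.1.2.1 hz
  refine ⟨t, mem_GammaLI_iff.2 ⟨ht, ?_⟩, ?_⟩
  · rw [Subgroup.coe_mul, map_mul]
    exact mul_mem (D.realExt_unip_mem _ _ _) hA
  · simpa using (D.isReduction_unip 0 0 t).mul hred

/-- The Levi element over `(M, γ)` may fail to move `L* ∩ U^⊥` by vectors of `L`, since `sec` need
not map `Λ*` into `L*`. A unipotent built from a second section, one that does respect dual
lattices, repairs this. -/
lemma exists_lift (D : IntegralSplit B hB L U ε) [FiniteDimensional ℚ V] [hlat : Submodule.IsLattice ℚ L]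
    (hnd : B.Nondegenerate) (hL : IsEven B L) {M : SL(2, ℤ)} (hM : M ∈ GammaLdual B L U ε)
    {γ : W B U ≃ₗ[ℚ] W B U} (hγ : γ ∈ GammaW B hB L U) :
    ∃ A ∈ GammaLI B L U, IsReduction ε A M γ := by
  have hLd := le_dual_of_isEven hB hL
  have hdlat := dual_isLattice hnd L
  have hfg : ((B.dualSubmodule L).comap ((B.orthogonal U).subtype.restrictScalars ℤ)).FG := by
    have h1 : (((B.dualSubmodule L).comap ((B.orthogonal U).subtype.restrictScalars ℤ)).map
        ((B.orthogonal U).subtype.restrictScalars ℤ)).FG := by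
      refine Submodule.FG.of_le hdlat.fg ?_
      exact Submodule.map_comap_le _ _
    exact Submodule.fg_of_fg_map_injective _ Subtype.val_injective h1
  obtain ⟨τ, hτ, hτL⟩ := exists_lattice_section (toW B U) _ hfg (by
    rw [eq_top_iff]
    rintro x -
    obtain ⟨z, rfl⟩ := Submodule.mkQ_surjective _ x
    obtain ⟨n, hn, h⟩ := exists_smul_mem hlat.span_eq_top z.1
    have h1 : toW B U (n • z) ∈ Submodule.span ℚ (toW B U ''
        ((B.dualSubmodule L).comap ((B.orthogonal U).subtype.restrictScalars ℤ) : Set _)) :=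
      Submodule.subset_span ⟨n • z, hLd h, rfl⟩
    rw [map_nsmul, ← Nat.cast_smul_eq_nsmul ℚ] at h1
    exact (Submodule.smul_mem_iff _ (Nat.cast_ne_zero.2 hn)).1 h1)
  let A₀ := D.leviInt (M, ⟨γ, hγ.1.1⟩)
  have hred₀ : IsReduction ε A₀ M γ := D.isReduction_leviInt M ⟨γ, hγ.1.1⟩
  have hreal₀ : realExt A₀.1 ∈ SplitData.realComponent B U :=
    D.realExt_leviInt_mem M ⟨γ, hγ.1.1⟩ hγ.2
  -- At `γ w` this is the displacement under `A₀` of the vector `τ w - sec w` of `U`. Subtracting it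
  -- by a unipotent leaves `sec (γ w - w)` as the displacement of `τ w`.
  let ψ : W B U →ₗ[ℚ] V := ((A₀.1 : V →ₗ[ℚ] V) - LinearMap.id) ∘ₗ
    ((B.orthogonal U).subtype ∘ₗ τ - D.sec) ∘ₗ (γ.symm : W B U →ₗ[ℚ] W B U)
  have hφ : ∀ i, ∃ x, ∀ v, formW B hB U x v = B (ψ v) (D.f i) := fun i =>
    exists_apply_eq (D.formW_nondegenerate hnd) (B.flip (D.f i) ∘ₗ ψ)
  choose x hx using hφ
  have hτU : ∀ w, (τ w : V) - D.sec w ∈ U := by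
    intro w
    have h := D.sub_sec_mem (τ w).2
    rwa [D.proj_eq, hτ] at h
  have hAU : ∀ u ∈ U, A₀.1 u - u ∈ U := fun u hu => U.sub_mem ((A₀.2.2 _).2 hu) hu
  have hψU : ∀ v, ψ v ∈ U := fun v => hAU _ (hτU (γ.symm v))
  have hred : IsReduction ε (D.unip (x 0) (x 1) 0 * A₀) M γ := by
    simpa using (D.isReduction_unip (x 0) (x 1) 0).mul hred₀
  have hreal : realExt (D.unip (x 0) (x 1) 0 * A₀).1 ∈ SplitData.realComponent B U := by
    rw [Subgroup.coe_mul, map_mul]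
    exact mul_mem (D.realExt_unip_mem _ _ _) hreal₀
  obtain ⟨t, ht, ht'⟩ := D.exists_mem_isReduction hnd hL hγ hred hreal (by
    intro z hzd hzU
    have hw := D.proj_mem_dual hzd
    have hA₀sec : A₀.1 (D.sec (D.proj z)) = D.sec (γ (D.proj z)) := by
      change D.leviEnd _ _ _ _ = _
      have h := D.sec_mem_orthogonal (D.proj z)
      rw [D.mem_orthogonal_iff] at h
      rw [D.leviEnd_apply, D.proj_sec]
      simp [D.adj, D.proj_f, D.proj_e]
    have hproj : D.proj (A₀.1 z) = γ (D.proj z) := D.proj_leviEnd _ _ _ _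
    have hsum := D.eq_sum_of_mem (hψU (γ (D.proj z)))
    rw [Fin.sum_univ_two, ← hx, ← hx] at hsum
    have hψ : ψ (γ (D.proj z)) = A₀.1 (τ (D.proj z)) - D.sec (γ (D.proj z)) -
        (τ (D.proj z) - D.sec (D.proj z)) := by
      change A₀.1 (τ (γ.symm (γ (D.proj z))) - D.sec (γ.symm (γ (D.proj z)))) -
        (τ (γ.symm (γ (D.proj z))) - D.sec (γ.symm (γ (D.proj z)))) = _
      rw [LinearEquiv.symm_apply_apply, map_sub, hA₀sec]
    -- The first summand lies in `L` because `γ` acts trivially on `Λ*/Λ`. The second is the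
    -- displacement of a vector of `I_{L*}`, to which the hypothesis on `M` applies.
    have key : (D.unip (x 0) (x 1) 0 * A₀).1 z - z = D.sec (γ (D.proj z) - D.proj z) +
        (A₀.1 (z - τ (D.proj z)) - (z - τ (D.proj z))) := by
      change D.unipEnd _ _ _ (A₀.1 z) - z = _
      rw [D.unipEnd_of_orthogonal _ _ _ (apply_mem_orthogonal A₀ hzU), hproj,
        sub_sub (A₀.1 z), ← hsum, hψ, map_sub, map_sub]
      abel
    rw [key]
    refine L.add_mem (D.sec_mem (hγ.1.2.2 _ hw)) ?_
    refine (hred₀.mem_SLJI_iff D.le_span (J := interLattice (B.dualSubmodule L) U)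
      (fun u hu => hu.1)).1 hM _ ⟨?_, ?_⟩
    · have h := U.sub_mem (D.sub_sec_mem hzU) (hτU (D.proj z))
      rwa [sub_sub_sub_cancel_right] at h
    · refine Submodule.sub_mem _ hzd (hτL _ ?_)
      obtain ⟨z', hz', hzU', h⟩ := D.exists_dual_lift hnd hw
      rw [← h]
      exact ⟨⟨z', hzU'⟩, hz', (D.proj_eq ⟨z', hzU'⟩).symm⟩)
  exact ⟨_, ht, ht'⟩

end IntegralSplit

/-! ### Existence of dual systems, and the congruence property. -/

section Existence

variable {V : Type*} [AddCommGroup V] [Module ℚ V] {B : LinearMap.BilinForm ℚ V}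
  {L : Submodule ℤ V} {U : Submodule ℚ V}

lemma eq_span_basis (hU : Module.finrank ℚ U = 2)
    (ε : Module.Basis (Fin 2) ℤ (interLattice L U)) :
    U = Submodule.span ℚ (Set.range fun i => (ε i : V)) := by
  have : FiniteDimensional ℚ U := Module.finite_of_finrank_pos (by omega)
  symm
  apply Submodule.eq_of_le_of_finrank_eq
  · rw [Submodule.span_le]
    rintro _ ⟨i, rfl⟩
    exact (ε i).2.1
  · rw [finrank_span_eq_card (linearIndependent_coe ε), hU, Fintype.card_fin]

/-- The decomposition that is determined by a dual system of the basis `ε` in the dual lattice. -/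
noncomputable def integralSplitOf (hB : B.IsSymm) (hU : Module.finrank ℚ U = 2)
    (hiso : U ≤ B.orthogonal U) (ε : Module.Basis (Fin 2) ℤ (interLattice L U)) (g : Fin 2 → V)
    (hgL : ∀ i, g i ∈ B.dualSubmodule L)
    (hg : ∀ i j, B (ε i) (g j) = if i = j then 1 else 0) : IntegralSplit B hB L U ε :=
  { splitOf hB (eq_span_basis hU ε) hiso hg with
    e_eq := fun _ => rfl
    proj_eq := splitOf_proj hB (eq_span_basis hU ε) hiso hg
    g := g
    g_mem := hgL
    sub_g := fun i => by
      change isotropize B _ g i - g i ∈ U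
      rw [isotropize, sub_sub_cancel_left, neg_mem_iff]
      exact U.sum_mem fun i _ => U.smul_mem _ (ε i).2.1 }

/-- The coordinate functionals of `ε` on `U` are integral on `L ∩ U`, so `exists_dual_extension`
represents them in `L*`. -/
lemma exists_dual_system [FiniteDimensional ℚ V] [Submodule.IsLattice ℚ L]
    (hB : B.IsSymm) (hnd : B.Nondegenerate) (hU : Module.finrank ℚ U = 2)
    (ε : Module.Basis (Fin 2) ℤ (interLattice L U)) :
    ∃ g : Fin 2 → V, (∀ i, g i ∈ B.dualSubmodule L) ∧
      ∀ i j, B (ε i) (g j) = if i = j then 1 else 0 := by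
  have hspan := eq_span_basis hU ε
  let c : Module.Basis (Fin 2) ℚ U := (Module.Basis.span (linearIndependent_coe ε)).map
    (LinearEquiv.ofEq _ _ hspan.symm)
  have hc : ∀ i, (c i : V) = ε i := by
    intro i
    simp [c, Module.Basis.span_apply]
  have hc' : ∀ i, c i = ⟨ε i, (ε i).2.1⟩ := fun i => Subtype.ext (hc i)
  have h : ∀ j, ∃ v ∈ B.dualSubmodule L, ∀ x : U, B v x = c.coord j x := by
    intro j
    refine exists_dual_extension hnd L U (c.coord j) fun x hx => ?_
    have hx' : x = ∑ i, (ε.repr ⟨x.1, x.2, hx⟩ i : ℚ) • c i := by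
      apply Subtype.ext
      have h1 := congrArg Subtype.val (ε.sum_repr ⟨x.1, x.2, hx⟩)
      simp only [Submodule.coe_sum, Submodule.coe_smul, hc] at h1 ⊢
      simp only [Int.cast_smul_eq_zsmul]
      exact h1.symm
    refine ⟨ε.repr ⟨x.1, x.2, hx⟩ j, ?_⟩
    conv_lhs => rw [hx']
    rw [map_sum, Finset.sum_eq_single j]
    · simp
    · intro i _ hij
      simp [hij]
    · simp
  choose g hgL hg using h
  refine ⟨g, hgL, fun i j => ?_⟩
  have h1 := hg j ⟨ε i, (ε i).2.1⟩
  rw [← hc', Module.Basis.coord_apply, Module.Basis.repr_self, Finsupp.single_apply] at h1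
  rw [hB.eq, ← hc, h1]

/-- If `N J ⊆ I`, a matrix congruent to one modulo `N` moves `J` by vectors of `I`; so `Γ(N)` is
contained in `SL(J, I)`. -/
lemma isCongruenceSubgroup_SLJI (ε : Module.Basis (Fin 2) ℤ (interLattice L U))
    {J : Submodule ℤ V} {N : ℕ} (hN : N ≠ 0) (hJ : ∀ u ∈ J, N • u ∈ L) :
    CongruenceSubgroup.IsCongruenceSubgroup (SLJI ε J) := by
  refine ⟨N, hN, fun M hM c hc => ?_⟩
  have h1 : ofCoords ε ((N : ℚ) • c) ∈ interLattice L U := by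
    refine ⟨ofCoords_mem _, ?_⟩
    rw [map_smul, Nat.cast_smul_eq_nsmul]
    exact hJ _ hc
  obtain ⟨n, hn⟩ := (ofCoords_mem_iff ε _).1 h1
  rw [CongruenceSubgroup.Gamma_mem] at hM
  obtain ⟨h00, h01, h10, h11⟩ := hM
  have hd00 : (N : ℤ) ∣ M.1 0 0 - 1 := by
    rw [← ZMod.intCast_zmod_eq_zero_iff_dvd]; push_cast; rw [h00, sub_self]
  have hd01 : (N : ℤ) ∣ M.1 0 1 := by rw [← ZMod.intCast_zmod_eq_zero_iff_dvd]; exact h01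
  have hd10 : (N : ℤ) ∣ M.1 1 0 := by rw [← ZMod.intCast_zmod_eq_zero_iff_dvd]; exact h10
  have hd11 : (N : ℤ) ∣ M.1 1 1 - 1 := by
    rw [← ZMod.intCast_zmod_eq_zero_iff_dvd]; push_cast; rw [h11, sub_self]
  obtain ⟨a, ha⟩ := hd00
  obtain ⟨b, hb⟩ := hd01
  obtain ⟨d, hd⟩ := hd10
  obtain ⟨f, hf⟩ := hd11
  have ha' : (M.1 0 0 : ℚ) = 1 + N * a := by
    have : M.1 0 0 = 1 + N * a := by linarith
    exact_mod_cast this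
  have hb' : (M.1 0 1 : ℚ) = N * b := by exact_mod_cast hb
  have hd' : (M.1 1 0 : ℚ) = N * d := by exact_mod_cast hd
  have hf' : (M.1 1 1 : ℚ) = 1 + N * f := by
    have : M.1 1 1 = 1 + N * f := by linarith
    exact_mod_cast this
  have hn0 : (N : ℚ) * c 0 = n 0 := congrFun hn 0
  have hn1 : (N : ℚ) * c 1 = n 1 := congrFun hn 1
  rw [← map_sub, ofCoords_mem_iff]
  -- These are the coordinates of `-((M - 1) / N)` applied to the integral vector `N c`.
  refine ⟨![-(a * n 0 + b * n 1), -(d * n 0 + f * n 1)], ?_⟩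
  ext i
  fin_cases i
  · simp [ha', hb', ← hn0, ← hn1]
    ring
  · simp [hd', hf', ← hn0, ← hn1]
    ring

lemma mk'_eq_mk'_iff {A A' : parabolic B U} :
    QuotientGroup.mk' (homAs B U) A = QuotientGroup.mk' (homAs B U) A' ↔
      ∀ z ∈ B.orthogonal U, A.1 z = A'.1 z := by
  rw [QuotientGroup.mk'_apply, QuotientGroup.mk'_apply, QuotientGroup.eq]
  refine forall₂_congr fun z _ => ?_
  change A.1.symm (A'.1 z) = z ↔ _
  rw [LinearEquiv.symm_apply_eq, eq_comm]

lemma toBar_eq_iff {A A' : GammaLI B L U} :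
    toBar B L U A = toBar B L U A' ↔ ∀ z ∈ B.orthogonal U, A.1.1 z = A'.1.1 z := by
  have h : toBar B L U A = toBar B L U A' ↔
      QuotientGroup.mk' (homAs B U) A.1 = QuotientGroup.mk' (homAs B U) A'.1 :=
    Subtype.ext_iff
  rw [h, mk'_eq_mk'_iff]

end Existence

/-! ### The Heisenberg embedding and the two exact sequences. -/

namespace IntegralSplit

variable {V : Type*} [AddCommGroup V] [Module ℚ V] {B : LinearMap.BilinForm ℚ V}
  {hB : B.IsSymm} {L : Submodule ℤ V} {U : Submodule ℚ V}
  {ε : Module.Basis (Fin 2) ℤ (interLattice L U)} (D : IntegralSplit B hB L U ε)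

/-- The embedding of the integral Heisenberg group. -/
noncomputable def heisenberg (hL : IsEven B L) : HeisenbergW B hB L hL U →* GammaLI B L U where
  toFun h := ⟨D.unip h.1.fst h.1.snd h.1.t,
    D.unip_mem hL h.2.1 h.2.2.1 h.2.2.2.choose_spec⟩
  map_one' := Subtype.ext D.unip_zero
  map_mul' _ _ := Subtype.ext (D.unip_mul _ _ _ _ _ _).symm

lemma heisenberg_apply (hL : IsEven B L) (h : HeisenbergW B hB L hL U) (v : V) :
    (D.heisenberg hL h).1.1 v = D.unipEnd h.1.fst h.1.snd h.1.t v := rfl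

lemma heisenberg_apply_orthogonal (hL : IsEven B L) (h : HeisenbergW B hB L hL U)
    (z : B.orthogonal U) : (D.heisenberg hL h).1.1 z =
      z - (formW B hB U h.1.fst (toW B U z) • (ε 0 : V) +
        formW B hB U h.1.snd (toW B U z) • (ε 1 : V)) := by
  rw [D.heisenberg_apply, D.unipEnd_of_orthogonal _ _ _ z.2, D.proj_eq, D.e_eq, D.e_eq, sub_sub]

lemma heisenberg_apply_central (hL : IsEven B L) (h : HeisenbergW B hB L hL U)
    (h1 : h.1.fst = 0) (h2 : h.1.snd = 0) (v : V) : (D.heisenberg hL h).1.1 v =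
      v - h.1.t • (B v (ε 1) • (ε 0 : V) - B v (ε 0) • (ε 1 : V)) := by
  rw [D.heisenberg_apply, h1, h2, D.unipEnd_apply, D.e_eq, D.e_eq]
  simp only [map_zero, LinearMap.zero_apply]
  module

/-- Looking at `U^⊥` alone already detects `x` and `y`, by non-degeneracy of `W`; so this serves the
injectivity of both embeddings. -/
lemma eq_zero_of_unip {x y : W B U} {t : ℚ} (hnd : B.Nondegenerate)
    (h : ∀ z ∈ B.orthogonal U, D.unipEnd x y t z = z) : x = 0 ∧ y = 0 := by
  have h1 : ∀ w, formW B hB U x w = 0 ∧ formW B hB U y w = 0 := by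
    intro w
    have h2 := h _ (D.sec_mem_orthogonal w)
    rw [D.unipEnd_of_orthogonal _ _ _ (D.sec_mem_orthogonal w), D.proj_sec, sub_sub,
      sub_eq_self] at h2
    have h3 := congrArg (fun v => B v (D.f 0)) h2
    have h4 := congrArg (fun v => B v (D.f 1)) h2
    simp [D.ef] at h3 h4
    exact ⟨h3, h4⟩
  exact ⟨D.formW_separating hnd fun w => (h1 w).1, D.formW_separating hnd fun w => (h1 w).2⟩

lemma heisenberg_injective (hnd : B.Nondegenerate) (hL : IsEven B L) :
    Function.Injective (D.heisenberg hL) := by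
  rw [injective_iff_map_eq_one]
  intro h hh
  have hv : ∀ v, D.unipEnd h.1.fst h.1.snd h.1.t v = v := fun v =>
    congrArg (fun A : GammaLI B L U => A.1.1 v) hh
  obtain ⟨h1, h2⟩ := D.eq_zero_of_unip hnd fun z _ => hv z
  -- For a central element, `t` is the pairing of the image of `f 0` with `f 1`.
  have h3 := congrArg (fun v => B v (D.f 1)) (hv (D.f 0))
  rw [h1, h2] at h3
  simp [D.unipEnd_apply, D.fe, D.ef, D.ff] at h3
  apply Subtype.ext
  exact Heisenberg.ext h1 h2 h3

/-- The action on `I` and on `W`, as a homomorphism. -/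
lemma exists_reduction [FiniteDimensional ℚ V] [Submodule.IsLattice ℚ L]
    (D : IntegralSplit B hB L U ε) (hnd : B.Nondegenerate) (hL : IsEven B L) :
    ∃ r : GammaLI B L U →* GammaLdual B L U ε × GammaW B hB L U,
      ∀ A, IsReduction ε A.1 (r A).1.1 (r A).2.1 := by
  have h : ∀ A : GammaLI B L U, ∃ p : GammaLdual B L U ε × GammaW B hB L U,
      IsReduction ε A.1 p.1.1 p.2.1 := by
    intro A
    obtain ⟨M, hM, γ, hγ, h⟩ := D.exists_isReduction hnd hL A.2
    exact ⟨(⟨M, hM⟩, ⟨γ, hγ⟩), h⟩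
  choose r hr using h
  refine ⟨MonoidHom.mk' r fun A A' => ?_, hr⟩
  obtain ⟨h1, h2⟩ := (hr (A * A')).eq ((hr A).mul (hr A'))
  exact Prod.ext (Subtype.ext h1) (Subtype.ext h2)

lemma toBar_heisenberg_eq (hL : IsEven B L) {h h' : HeisenbergW B hB L hL U}
    (h1 : h.1.fst = h'.1.fst) (h2 : h.1.snd = h'.1.snd) :
    toBar B L U (D.heisenberg hL h) = toBar B L U (D.heisenberg hL h') := by
  refine toBar_eq_iff.2 fun z hz => ?_
  rw [D.heisenberg_apply, D.heisenberg_apply, D.unipEnd_of_orthogonal _ _ _ hz,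
    D.unipEnd_of_orthogonal _ _ _ hz, h1, h2]

/-- An element of the integral Heisenberg group with given first coordinates. -/
noncomputable def liftHeisenberg (hL : IsEven B L) (x y : latticeW B L U) :
    HeisenbergW B hB L hL U :=
  ⟨⟨x, y, formW B hB U x y / 2⟩, x.2, y.2, 0, by simp⟩

/-- The translation part of the Heisenberg group, modulo elements acting trivially on `U^⊥`. -/
noncomputable def translation (hL : IsEven B L) :
    Multiplicative (latticeW B L U × latticeW B L U) →* GammaLIBar B L U :=
  MonoidHom.mk' (fun p => toBar B L U (D.heisenberg hL
    (liftHeisenberg hL p.toAdd.1 p.toAdd.2))) fun p q => by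
    rw [← map_mul, ← map_mul]
    exact D.toBar_heisenberg_eq hL rfl rfl

lemma translation_apply (hL : IsEven B L) (h : HeisenbergW B hB L hL U) :
    D.translation hL (Multiplicative.ofAdd (⟨h.1.fst, h.2.1⟩, ⟨h.1.snd, h.2.2.1⟩)) =
      toBar B L U (D.heisenberg hL h) :=
  D.toBar_heisenberg_eq hL rfl rfl

lemma translation_injective (hnd : B.Nondegenerate) (hL : IsEven B L) :
    Function.Injective (D.translation hL) := by
  rw [injective_iff_map_eq_one]
  intro p hp
  have h1 : toBar B L U (D.heisenberg hL (liftHeisenberg hL p.toAdd.1 p.toAdd.2)) =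
      toBar B L U 1 := hp.trans (map_one _).symm
  rw [toBar_eq_iff] at h1
  obtain ⟨h2, h3⟩ := D.eq_zero_of_unip hnd h1
  exact Multiplicative.toAdd.injective (Prod.ext (Subtype.ext h2) (Subtype.ext h3))

lemma heisenberg_range [FiniteDimensional ℚ V] (hnd : B.Nondegenerate) (hL : IsEven B L)
    {r : GammaLI B L U →* GammaLdual B L U ε × GammaW B hB L U}
    (hr : ∀ A, IsReduction ε A.1 (r A).1.1 (r A).2.1) : (D.heisenberg hL).range = r.ker := by
  ext A
  constructor
  · rintro ⟨h, rfl⟩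
    obtain ⟨h1, h2⟩ := (hr (D.heisenberg hL h)).eq (D.isReduction_unip _ _ _)
    exact Prod.ext (Subtype.ext h1) (Subtype.ext h2)
  · intro hA
    have h := hr A
    rw [MonoidHom.mem_ker.1 hA] at h
    obtain ⟨x, hx, y, hy, n, hxy⟩ := D.exists_eq_unip hnd hL A.2 h
    exact ⟨⟨⟨x, y, _⟩, hx, hy, n, rfl⟩, Subtype.ext hxy.symm⟩

lemma reduction_surjective [FiniteDimensional ℚ V] [Submodule.IsLattice ℚ L]
    (D : IntegralSplit B hB L U ε) (hnd : B.Nondegenerate) (hL : IsEven B L)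
    {r : GammaLI B L U →* GammaLdual B L U ε × GammaW B hB L U}
    (hr : ∀ A, IsReduction ε A.1 (r A).1.1 (r A).2.1) : Function.Surjective r := by
  rintro ⟨⟨M, hM⟩, ⟨γ, hγ⟩⟩
  obtain ⟨A, hA, h⟩ := D.exists_lift hnd hL hM hγ
  obtain ⟨h1, h2⟩ := (hr ⟨A, hA⟩).eq h
  exact ⟨⟨A, hA⟩, Prod.ext (Subtype.ext h1) (Subtype.ext h2)⟩

end IntegralSplit

/-! ### Passage to the quotient by `Hom^as(U*, U)`. -/

section Bar

variable {V : Type*} [AddCommGroup V] [Module ℚ V] {B : LinearMap.BilinForm ℚ V}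
  {hB : B.IsSymm} {L : Submodule ℤ V} {U : Submodule ℚ V}
  {ε : Module.Basis (Fin 2) ℤ (interLattice L U)}

lemma toBar_surjective : Function.Surjective (toBar B L U) :=
  MonoidHom.subgroupMap_surjective _ _

/-- The action on `I` and on `W` factors through the quotient by the elements that act trivially
on `U^⊥`. -/
lemma exists_reductionBar (hiso : U ≤ B.orthogonal U)
    {r : GammaLI B L U →* GammaLdual B L U ε × GammaW B hB L U}
    (hr : ∀ A, IsReduction ε A.1 (r A).1.1 (r A).2.1) :
    ∃ rbar : GammaLIBar B L U →* GammaLdual B L U ε × GammaW B hB L U,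
      ∀ A, rbar (toBar B L U A) = r A := by
  have hker : (toBar B L U).ker ≤ r.ker := by
    intro A hA
    have h1 : toBar B L U A = toBar B L U 1 := (MonoidHom.mem_ker.1 hA).trans (map_one _).symm
    rw [toBar_eq_iff] at h1
    have h2 : IsReduction ε A.1 1 1 := by
      refine ⟨fun i => ?_, fun z => ?_⟩
      · rw [h1 _ (hiso (ε i).2.1), (isReduction_one (B := B) (ε := ε)).1 i |>.symm]
        rfl
      · change toW B U z = _
        congr 1
        exact Subtype.ext (h1 z z.2).symm
    obtain ⟨h3, h4⟩ := (hr A).eq h2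
    exact Prod.ext (Subtype.ext h3) (Subtype.ext h4)
  exact ⟨(toBar B L U).liftOfSurjective toBar_surjective ⟨r, hker⟩, fun A =>
    MonoidHom.liftOfRightInverse_comp_apply _ _ _ ⟨r, hker⟩ A⟩

end Bar

/-! ### Unimodular complements: `α`, `ι`, `I_ι` and the splitting. -/

namespace IntegralSplit

variable {V : Type*} [AddCommGroup V] [Module ℚ V] {B : LinearMap.BilinForm ℚ V}
  {hB : B.IsSymm} {L : Submodule ℤ V} {U : Submodule ℚ V}
  {ε : Module.Basis (Fin 2) ℤ (interLattice L U)} (D : IntegralSplit B hB L U ε)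
  {Itilde : Submodule ℤ V}

lemma eq_sum_g (hI : Itilde = Submodule.span ℤ (Set.range D.g)) {x : V}
    (hx : x ∈ Submodule.span ℚ (Itilde : Set V)) : x = ∑ i, B x (D.e i) • D.g i := by
  rw [hI, Submodule.span_span_of_tower] at hx
  obtain ⟨c, rfl⟩ := (Submodule.mem_span_range_iff_exists_fun ℚ).1 hx
  simp [D.ge]

lemma g_mem_complement (hI : Itilde = Submodule.span ℤ (Set.range D.g)) (i : Fin 2) :
    D.g i ∈ Itilde := hI.ge (Submodule.subset_span ⟨i, rfl⟩)

lemma mem_complement (hI : Itilde = Submodule.span ℤ (Set.range D.g)) {x : V}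
    (hx : x ∈ Submodule.span ℚ (Itilde : Set V)) (h : ∀ i, ∃ n : ℤ, B x (D.e i) = n) :
    x ∈ Itilde := by
  rw [D.eq_sum_g hI hx]
  refine Submodule.sum_mem _ fun i _ => ?_
  obtain ⟨n, hn⟩ := h i
  rw [hn, Int.cast_smul_eq_zsmul]
  exact Submodule.smul_mem _ _ (D.g_mem_complement hI i)

lemma proj_g (i : Fin 2) : D.proj (D.g i) = 0 := by
  have h := D.proj_of_mem (D.sub_g i)
  rw [map_sub, D.proj_f, zero_sub, neg_eq_zero] at h
  exact h

lemma proj_complement (hI : Itilde = Submodule.span ℤ (Set.range D.g)) {x : V}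
    (hx : x ∈ Submodule.span ℚ (Itilde : Set V)) : D.proj x = 0 := by
  rw [D.eq_sum_g hI hx]
  simp [D.proj_g]

/-- The correction map `α`. -/
noncomputable def correction (Itilde : Submodule ℤ V) :
    Submodule.span ℚ (Itilde : Set V) →ₗ[ℚ] U :=
  LinearMap.codRestrict U ((∑ i, (B.flip (D.g i)).smulRight ((1 / 2 : ℚ) • D.e i)) ∘ₗ
    (Submodule.span ℚ (Itilde : Set V)).subtype) fun x => by
      simp only [LinearMap.comp_apply, LinearMap.sum_apply, LinearMap.smulRight_apply]
      exact U.sum_mem fun i _ => U.smul_mem _ (U.smul_mem _ (D.e_mem i))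

lemma correction_apply (x : Submodule.span ℚ (Itilde : Set V)) :
    (D.correction Itilde x : V) = ∑ i, B x.1 (D.g i) • (1 / 2 : ℚ) • D.e i := by
  simp [correction]

/-- This relation characterizes `α` as half of the Gram operator on `Ũ`; symmetry and isotropy of
the corrected complement both follow from it. -/
lemma apply_correction (hI : Itilde = Submodule.span ℤ (Set.range D.g))
    (x y : Submodule.span ℚ (Itilde : Set V)) :
    B (D.correction Itilde x).1 y.1 = B x.1 y.1 / 2 := by
  have h := D.eq_sum_g hI y.2
  conv_rhs => rw [h]
  rw [D.correction_apply]
  simp only [Fin.sum_univ_two, map_add, map_smul, LinearMap.add_apply, LinearMap.smul_apply,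
    smul_eq_mul, hB.eq (D.e _) y.1]
  ring

lemma isCorrectionMap (hI : Itilde = Submodule.span ℤ (Set.range D.g)) :
    IsCorrectionMap B U (Submodule.span ℚ (Itilde : Set V)) (D.correction Itilde) := by
  have h : ∀ x y : Submodule.span ℚ (Itilde : Set V),
      B x.1 (D.correction Itilde y).1 = B x.1 y.1 / 2 := fun x y => by
    rw [hB.eq, D.apply_correction hI, hB.eq]
  refine ⟨fun x y => by rw [D.apply_correction hI, h], fun x y => ?_⟩
  have h0 : B (D.correction Itilde x).1 (D.correction Itilde y).1 = 0 :=
    D.le_orthogonal (Subtype.property _) _ (Subtype.property _)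
  simp only [map_sub, LinearMap.sub_apply, D.apply_correction hI, h, h0]
  ring

lemma apply_eq_of_mem {x y : V} (h : ∀ i, B x (D.e i) = B y (D.e i)) {u : V} (hu : u ∈ U) :
    B u x = B u y := by
  obtain ⟨c, rfl⟩ := D.exists_of_mem hu
  simp only [map_sum, map_smul, LinearMap.sum_apply, LinearMap.smul_apply, hB.eq (D.e _), h]

lemma e_mem_interLattice (i : Fin 2) : D.e i ∈ interLattice L U :=
  ⟨D.e_mem i, D.e_mem_lattice i⟩

/-- The value of `ι` at `x` is the class of `proj ν` for any `ν ∈ L` with the same pairings with `I`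
as `x`. Two choices of `ν` differ by a vector of `L ∩ U^⊥`, whose projection lies in `Λ`. -/
lemma exists_iota (hL : IsEven B L) (hI : Itilde = Submodule.span ℤ (Set.range D.g)) :
    ∃ ι : tildeIL B L U Itilde →ₗ[ℤ] discriminantGroup (formW B hB U) (latticeW B L U),
      IsIota B hB L U Itilde (D.correction Itilde) ι := by
  have hLd := le_dual_of_isEven hB hL
  have hν : ∀ x : tildeIL B L U Itilde, ∃ ν ∈ L, ∀ i, B x.1 (D.e i) = B ν (D.e i) := by
    intro x
    obtain ⟨-, ν, hν, h⟩ := x.2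
    exact ⟨ν, hν, fun i => h _ (D.e_mem_interLattice i)⟩
  choose ν hνL hν using hν
  have hsub : ∀ v ∈ L, ∀ v' ∈ L, (∀ i, B v (D.e i) = B v' (D.e i)) →
      D.proj v - D.proj v' ∈ latticeW B L U := by
    intro v hv v' hv' h
    rw [← map_sub]
    refine D.proj_mem_lattice ?_ (L.sub_mem hv hv')
    rw [D.mem_orthogonal_iff]
    intro i
    rw [map_sub, LinearMap.sub_apply, h, sub_self]
  let cl (v : V) (hv : v ∈ L) : discriminantGroup (formW B hB U) (latticeW B L U) :=
    Submodule.Quotient.mk ⟨D.proj v, D.proj_mem_dual (hLd hv)⟩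
  have hcl : ∀ v (hv : v ∈ L) v' (hv' : v' ∈ L), (∀ i, B v (D.e i) = B v' (D.e i)) →
      cl v hv = cl v' hv' := fun v hv v' hv' h =>
    (Submodule.Quotient.eq _).2 (hsub v hv v' hv' h)
  let ι : tildeIL B L U Itilde →ₗ[ℤ] discriminantGroup (formW B hB U) (latticeW B L U) :=
    { toFun := fun x => cl (ν x) (hνL x)
      map_add' := fun x y => by
        refine (hcl _ (hνL (x + y)) _ (L.add_mem (hνL x) (hνL y)) fun i => ?_).trans ?_
        · rw [← hν, map_add, LinearMap.add_apply, ← hν, ← hν]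
          simp
        · change Submodule.Quotient.mk _ = Submodule.Quotient.mk _
          congr 1
          exact Subtype.ext (map_add _ _ _)
      map_smul' := fun n x => by
        refine (hcl _ (hνL (n • x)) _ (L.smul_mem n (hνL x)) fun i => ?_).trans ?_
        · rw [← hν, map_zsmul, LinearMap.smul_apply, ← hν]
          simp
        · change Submodule.Quotient.mk _ = Submodule.Quotient.mk _
          congr 1
          exact Subtype.ext (map_zsmul _ _ _) }
  have hι : ∀ x, ι x = cl (ν x) (hνL x) := fun _ => rfl
  refine ⟨ι, fun u w x hw => ?_⟩
  have hxe : ∀ i, B (u.1 + w.1 + x.1) (D.e i) = B x.1 (D.e i) := by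
    intro i
    have h1 : B u.1 (D.e i) = 0 := D.le_orthogonal (D.e_mem i) _ u.2
    have h2 := D.mem_orthogonal_iff.1 w.2 i
    simp [h1, h2]
  have hproj : D.proj (u.1 + w.1 + x.1) = toW B U w := by
    rw [map_add, map_add, D.proj_of_mem u.2, D.proj_complement hI x.2, D.proj_eq, zero_add,
      add_zero]
  have hwg : ∀ i, B w.1 (D.g i) = 0 := by
    intro i
    rw [hB.eq]
    exact hw _ (Submodule.mem_sup_right (Submodule.subset_span (D.g_mem_complement hI i)))
  -- The vector `2 α x` pairs with `g i` as `x` does, and `w` is orthogonal to `g i`. Thus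
  -- integrality of `u + 2 α x` is read off from the pairings of the whole sum with the `g i`.
  have hug : ∀ i, B (u.1 + (2 : ℚ) • (D.correction Itilde x).1) (D.g i) =
      B (u.1 + w.1 + x.1) (D.g i) := by
    intro i
    have h := D.apply_correction hI x
      ⟨D.g i, Submodule.subset_span (D.g_mem_complement hI i)⟩
    simp only [map_add, map_smul, LinearMap.add_apply, LinearMap.smul_apply, smul_eq_mul, hwg, h]
    ring
  have huU : u.1 + (2 : ℚ) • (D.correction Itilde x).1 ∈ U :=
    U.add_mem u.2 (U.smul_mem _ (Subtype.property _))
  constructor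
  · intro hv
    have hxI : x.1 ∈ Itilde := by
      refine D.mem_complement hI x.2 fun i => ?_
      obtain ⟨n, hn⟩ := mem_dualSubmodule_iff.1 (hLd hv) _ (D.e_mem_lattice i)
      exact ⟨n, by rw [← hn, hxe]⟩
    have hx : x.1 ∈ tildeIL B L U Itilde := by
      refine ⟨hxI, _, hv, fun y hy => ?_⟩
      rw [hB.eq, hB.eq _ y]
      exact D.apply_eq_of_mem (fun i => (hxe i).symm) hy.1
    have hwd := D.proj_mem_dual (hLd hv)
    rw [hproj] at hwd
    refine ⟨hx, hwd, ?_, huU, D.mem_of_apply_g huU fun i => ?_⟩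
    · rw [hι]
      refine Eq.trans ?_ (hcl _ hv _ (hνL _) fun i => (hxe i).trans (hν ⟨x.1, hx⟩ i))
      change Submodule.Quotient.mk _ = Submodule.Quotient.mk _
      congr 1
      exact Subtype.ext hproj.symm
    · rw [hug]
      exact D.apply_g_int hv i
  · rintro ⟨hx, hwd, hwι, -, hu⟩
    rw [hι] at hwι
    have h1 : toW B U w - D.proj (ν ⟨x.1, hx⟩) ∈ latticeW B L U :=
      (Submodule.Quotient.eq ((latticeW B L U).submoduleOf
        ((formW B hB U).dualSubmodule (latticeW B L U)))).1 hwι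
    rw [← hproj, ← map_sub] at h1
    have h2 : u.1 + w.1 + x.1 - ν ⟨x.1, hx⟩ ∈ B.orthogonal U := by
      rw [D.mem_orthogonal_iff]
      intro i
      rw [map_sub, LinearMap.sub_apply, hxe, hν ⟨x.1, hx⟩, sub_self]
    -- After subtracting `ν` the sum lies in `U^⊥` with projection in `Λ`, so only the integrality
    -- of its `U`-component remains to be checked.
    have h3 : u.1 + w.1 + x.1 - ν ⟨x.1, hx⟩ -
        D.sec (D.proj (u.1 + w.1 + x.1 - ν ⟨x.1, hx⟩)) ∈ L := by
      refine D.mem_of_apply_g (D.sub_sec_mem h2) fun i => ?_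
      have h : B (D.sec (D.proj (u.1 + w.1 + x.1 - ν ⟨x.1, hx⟩))) (D.g i) = 0 := by
        rw [D.adj, D.proj_g, map_zero]
      rw [map_sub, LinearMap.sub_apply, h, sub_zero, map_sub, LinearMap.sub_apply, ← hug]
      obtain ⟨n, hn⟩ := D.apply_g_int hu i
      obtain ⟨m, hm⟩ := D.apply_g_int (hνL ⟨x.1, hx⟩) i
      exact ⟨n - m, by rw [hn, hm]; push_cast; rfl⟩
    have h4 := L.add_mem h3 (D.sec_mem h1)
    rw [sub_add_cancel] at h4
    have h5 := L.add_mem h4 (hνL ⟨x.1, hx⟩)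
    rwa [sub_add_cancel] at h5

variable {ι : tildeIL B L U Itilde →ₗ[ℤ] discriminantGroup (formW B hB U) (latticeW B L U)}

lemma latticeIota_le (u : V) (hu : u ∈ latticeIota B hB L U Itilde ι) : u ∈ U := hu.1

/-- Elements of `Ĩ_L` pair with `U` like vectors of `L`, so `I_{L*}` is accounted for by the zero
class of `Δ_Λ`. -/
lemma interLattice_dual_le_latticeIota (D : IntegralSplit B hB L U ε) :
    interLattice (B.dualSubmodule L) U ≤ latticeIota B hB L U Itilde ι := by
  rintro u ⟨hu, huL⟩
  refine ⟨hu, 0, Submodule.zero_mem _, fun x w' _ => ?_⟩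
  obtain ⟨-, ν, hν, h⟩ := x.2
  obtain ⟨n, hn⟩ := mem_dualSubmodule_iff.1 huL _ hν
  refine ⟨n, ?_⟩
  rw [map_zero, LinearMap.zero_apply, zero_add, ← hn]
  exact D.apply_eq_of_mem (fun i => h _ (D.e_mem_interLattice i)) hu

lemma GammaIota_le (D : IntegralSplit B hB L U ε) :
    GammaIota B hB L U ε Itilde ι ≤ GammaLdual B L U ε :=
  fun _ hM c hc => hM c (D.interLattice_dual_le_latticeIota hc)

/-- Let `n L* ⊆ L`. The vector `u` pairs with `L` as `w` pairs with elements of `Λ*`, up to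
integers, and `n w ∈ Λ`; hence `n u ∈ L*`, and a second factor `n` leads into `L`. -/
lemma exists_smul_latticeIota_mem [FiniteDimensional ℚ V] [hlat : Submodule.IsLattice ℚ L]
    (hnd : B.Nondegenerate) (hL : IsEven B L)
    (hI : Itilde = Submodule.span ℤ (Set.range D.g)) :
    ∃ n : ℕ, n ≠ 0 ∧ ∀ u ∈ latticeIota B hB L U Itilde ι, n • u ∈ L := by
  have hLd := le_dual_of_isEven hB hL
  obtain ⟨n, hn, h⟩ := exists_forall_smul_mem hlat.span_eq_top (dual_isLattice hnd L).fg
  refine ⟨n * n, mul_ne_zero hn hn, fun u hu => ?_⟩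
  rw [mul_smul]
  refine h _ (mem_dualSubmodule_iff.2 fun v hv => ?_)
  obtain ⟨huU, w, hw, hι⟩ := hu
  have hxU : ∑ i, B v (D.e i) • D.g i ∈ Submodule.span ℚ (Itilde : Set V) :=
    Submodule.sum_mem _ fun i _ => Submodule.smul_mem _ _
      (Submodule.subset_span (D.g_mem_complement hI i))
  have hxe : ∀ i, B (∑ i, B v (D.e i) • D.g i) (D.e i) = B v (D.e i) := by
    intro i
    fin_cases i <;> simp [D.ge]
  have hx : ∑ i, B v (D.e i) • D.g i ∈ tildeIL B L U Itilde := by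
    refine ⟨D.mem_complement hI hxU fun i => ?_, v, hv, fun y hy => ?_⟩
    · rw [hxe]
      exact mem_dualSubmodule_iff.1 (hLd hv) _ (D.e_mem_lattice i)
    · rw [hB.eq, hB.eq _ y]
      exact D.apply_eq_of_mem hxe hy.1
  obtain ⟨w', hw'⟩ := Submodule.Quotient.mk_surjective _ (ι ⟨_, hx⟩)
  obtain ⟨m, hm⟩ := hι ⟨_, hx⟩ w' hw'
  obtain ⟨z, hz, hzU, rfl⟩ := D.exists_dual_lift hnd hw
  have h1 : n • D.proj z ∈ latticeW B L U := by
    rw [← map_nsmul]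
    exact D.proj_mem_lattice ((B.orthogonal U).smul_of_tower_mem n hzU) (h z hz)
  obtain ⟨k, hk⟩ := mem_dualSubmodule_iff.1 w'.2 _ h1
  have h2 : B u v = B u (∑ i, B v (D.e i) • D.g i) :=
    D.apply_eq_of_mem (fun i => (hxe i).symm) huU
  rw [(formW_symm B hB U).eq, map_nsmul, LinearMap.smul_apply, nsmul_eq_mul] at hk
  refine ⟨k + n * m, ?_⟩
  rw [map_nsmul, LinearMap.smul_apply, nsmul_eq_mul, h2, hm, mul_add, hk]
  push_cast
  ring

/-- The crux is that the `U`-component of `z` lies in `I_ι`, with `-proj z` as the witness in `Λ*`.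
Then `M` moves this component by a vector of `I`, and `γ` moves the `W`-component by a vector of
`sec Λ ⊆ L`. -/
lemma leviInt_sub_mem (hI : Itilde = Submodule.span ℤ (Set.range D.g))
    (hι : IsIota B hB L U Itilde (D.correction Itilde) ι) {M : SL(2, ℤ)}
    (hM : M ∈ GammaIota B hB L U ε Itilde ι) {γ : orthogonalGroup (formW B hB U)}
    (hγ : γ.1 ∈ GammaW B hB L U) {z : V} (hz : z ∈ B.dualSubmodule L)
    (hzU : z ∈ B.orthogonal U) : (D.leviInt (M, γ)).1 z - z ∈ L := by
  have hw := D.proj_mem_dual hz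
  have hu : z - D.sec (D.proj z) ∈ latticeIota B hB L U Itilde ι := by
    refine ⟨D.sub_sec_mem hzU, -D.proj z, Submodule.neg_mem _ hw, fun x w' hw' => ?_⟩
    have hxU : x.1 ∈ Submodule.span ℚ (Itilde : Set V) := Submodule.subset_span x.2.1
    have hsec : D.sec w'.1 ∈ B.orthogonal (U ⊔ Submodule.span ℚ (Itilde : Set V)) := by
      intro v hv
      obtain ⟨u, hu, y, hy, rfl⟩ := Submodule.mem_sup.1 hv
      change B (u + y) _ = 0
      rw [D.adj', map_add, D.proj_of_mem hu, D.proj_complement hI hy, add_zero, map_zero,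
        LinearMap.zero_apply]
    have htoW : toW B U ⟨D.sec w'.1, D.sec_mem_orthogonal _⟩ = w'.1 := by
      rw [← D.proj_eq, D.proj_sec]
    -- By the defining property of `ι`, the vector `-2 α x + sec w' + x` lies in `L`. Its integral
    -- pairing with `z`, in which the `U`-term drops out, is the required congruence.
    have hmem := (hι (-((2 : ℚ) • D.correction Itilde ⟨x.1, hxU⟩))
      ⟨D.sec w'.1, D.sec_mem_orthogonal _⟩ ⟨x.1, hxU⟩ hsec).2
      ⟨x.2, by rw [htoW]; exact w'.2, by
        refine Eq.trans ?_ hw'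
        congr 1
        exact Subtype.ext htoW, by
        rw [Submodule.coe_neg, Submodule.coe_smul, neg_add_cancel]
        exact Submodule.zero_mem _⟩
    obtain ⟨n, hn⟩ := mem_dualSubmodule_iff.1 hz _ hmem
    have h1 : B z (-((2 : ℚ) • D.correction Itilde ⟨x.1, hxU⟩) : U).1 = 0 := by
      rw [hB.eq]
      exact hzU _ (Subtype.property _)
    have h2 : B (D.sec (D.proj z)) x.1 = 0 := by
      rw [D.adj, D.proj_complement hI hxU, map_zero]
    refine ⟨n, ?_⟩
    rw [map_add, map_add, h1, D.adj', zero_add] at hn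
    rw [map_sub, LinearMap.sub_apply, h2, map_neg, LinearMap.neg_apply]
    linarith
  have hred := D.isReduction_leviInt M γ
  have h1 := (hred.mem_SLJI_iff D.le_span latticeIota_le).1 hM _ hu
  have hsec : (D.leviInt (M, γ)).1 (D.sec (D.proj z)) = D.sec (γ.1 (D.proj z)) := by
    change D.leviEnd _ _ _ _ = _
    have h := D.sec_mem_orthogonal (D.proj z)
    rw [D.mem_orthogonal_iff] at h
    rw [D.leviEnd_apply, D.proj_sec]
    simp [D.adj, D.proj_f, D.proj_e]
  have key : (D.leviInt (M, γ)).1 z - z = D.sec (γ.1 (D.proj z) - D.proj z) +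
      ((D.leviInt (M, γ)).1 (z - D.sec (D.proj z)) - (z - D.sec (D.proj z))) := by
    rw [map_sub, map_sub, hsec]
    abel
  rw [key]
  exact L.add_mem (D.sec_mem (hγ.1.2.2 _ hw)) h1

lemma leviInt_exists_mem [FiniteDimensional ℚ V] [Submodule.IsLattice ℚ L]
    (hnd : B.Nondegenerate) (hL : IsEven B L) (hI : Itilde = Submodule.span ℤ (Set.range D.g))
    (hι : IsIota B hB L U Itilde (D.correction Itilde) ι) {M : SL(2, ℤ)}
    (hM : M ∈ GammaIota B hB L U ε Itilde ι) {γ : orthogonalGroup (formW B hB U)}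
    (hγ : γ.1 ∈ GammaW B hB L U) :
    ∃ A : GammaLI B L U, QuotientGroup.mk' (homAs B U) A.1 =
      QuotientGroup.mk' (homAs B U) (D.leviInt (M, γ)) ∧ IsReduction ε A.1 M γ.1 := by
  obtain ⟨t, ht, ht'⟩ := D.exists_mem_isReduction hnd hL hγ (D.isReduction_leviInt M γ)
    (D.realExt_leviInt_mem M γ hγ.2) (fun z hz hzU => D.leviInt_sub_mem hI hι hM hγ hz hzU)
  refine ⟨⟨_, ht⟩, mk'_eq_mk'_iff.2 fun z hz => ?_, ht'⟩
  change D.unipEnd _ _ _ _ = _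
  refine (D.unipEnd_of_orthogonal _ _ _ (apply_mem_orthogonal (D.leviInt (M, γ)) hz)).trans ?_
  simp

/-- Two isometries agreeing on `U^⊥` differ on any vector by an element of `U^⊥⊥ = U`. The Levi
element preserves the span of `e` and `f`, which is `U ⊕ Ũ` because `f i - g i ∈ U`. -/
lemma mem_sup_of_mk'_eq [FiniteDimensional ℚ V] (hnd : B.Nondegenerate)
    (hI : Itilde = Submodule.span ℤ (Set.range D.g)) {M : SL(2, ℤ)}
    {γ : orthogonalGroup (formW B hB U)} {A : parabolic B U}
    (hA : QuotientGroup.mk' (homAs B U) A = QuotientGroup.mk' (homAs B U) (D.leviInt (M, γ)))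
    {v : V} (hv : v ∈ U ⊔ Submodule.span ℚ (Itilde : Set V)) :
    A.1 v ∈ U ⊔ Submodule.span ℚ (Itilde : Set V) := by
  rw [mk'_eq_mk'_iff] at hA
  have h1 : A.1 v - (D.leviInt (M, γ)).1 v ∈ U := by
    refine (LinearMap.BilinForm.orthogonal_orthogonal hnd hB.isRefl U).le fun z hz => ?_
    have hz' : A.1.symm z ∈ B.orthogonal U := apply_mem_orthogonal A⁻¹ hz
    have h2 : A.1 (A.1.symm z) = z := A.1.apply_symm_apply z
    have h3 := hA _ hz'
    change B z _ = 0
    rw [map_sub, sub_eq_zero]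
    conv_lhs => rw [← h2]
    conv_rhs => rw [← h2, h3]
    rw [A.2.1, (D.leviInt (M, γ)).2.1]
  have he : ∀ i, D.e i ∈ U ⊔ Submodule.span ℚ (Itilde : Set V) := fun i =>
    Submodule.mem_sup_left (D.e_mem i)
  have hf : ∀ i, D.f i ∈ U ⊔ Submodule.span ℚ (Itilde : Set V) := fun i => by
    rw [← sub_add_cancel (D.f i) (D.g i)]
    exact Submodule.add_mem _ (Submodule.mem_sup_left (D.sub_g i))
      (Submodule.mem_sup_right (Submodule.subset_span (D.g_mem_complement hI i)))
  have hpv : D.proj v = 0 := by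
    obtain ⟨u, hu, y, hy, rfl⟩ := Submodule.mem_sup.1 hv
    rw [map_add, D.proj_of_mem hu, D.proj_complement hI hy, add_zero]
  have h2 : (D.leviInt (M, γ)).1 v ∈ U ⊔ Submodule.span ℚ (Itilde : Set V) := by
    change D.leviEnd _ _ _ _ ∈ _
    rw [D.leviEnd_apply, hpv, map_zero, map_zero, add_zero]
    exact Submodule.add_mem _
      (Submodule.sum_mem _ fun i _ => Submodule.smul_mem _ _
        (Submodule.sum_mem _ fun j _ => Submodule.smul_mem _ _ (he j)))
      (Submodule.sum_mem _ fun i _ => Submodule.smul_mem _ _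
        (Submodule.sum_mem _ fun j _ => Submodule.smul_mem _ _ (hf j)))
  have h3 := Submodule.add_mem _ (Submodule.mem_sup_left h1) h2
  rwa [sub_add_cancel] at h3

lemma translation_range [FiniteDimensional ℚ V] (hnd : B.Nondegenerate) (hL : IsEven B L)
    {r : GammaLI B L U →* GammaLdual B L U ε × GammaW B hB L U}
    {rbar : GammaLIBar B L U →* GammaLdual B L U ε × GammaW B hB L U}
    (hr : ∀ A, IsReduction ε A.1 (r A).1.1 (r A).2.1)
    (hrbar : ∀ A, rbar (toBar B L U A) = r A) : (D.translation hL).range = rbar.ker := by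
  have hrange := D.heisenberg_range hnd hL hr
  ext x
  constructor
  · rintro ⟨p, rfl⟩
    refine MonoidHom.mem_ker.2 ((hrbar (D.heisenberg hL
      (liftHeisenberg hL p.toAdd.1 p.toAdd.2))).trans ?_)
    exact MonoidHom.mem_ker.1 (hrange.le ⟨_, rfl⟩)
  · obtain ⟨A, rfl⟩ := toBar_surjective x
    intro hA
    rw [MonoidHom.mem_ker, hrbar] at hA
    obtain ⟨h, rfl⟩ := hrange.ge (MonoidHom.mem_ker.2 hA)
    exact ⟨_, D.translation_apply hL h⟩

/-- The splitting over `Γ_ι × Γ_Λ` that is defined by the Levi subgroup. -/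
lemma exists_splitting [FiniteDimensional ℚ V] [Submodule.IsLattice ℚ L]
    (hnd : B.Nondegenerate) (hL : IsEven B L) (hI : Itilde = Submodule.span ℤ (Set.range D.g))
    (hι : IsIota B hB L U Itilde (D.correction Itilde) ι)
    {r : GammaLI B L U →* GammaLdual B L U ε × GammaW B hB L U}
    {rbar : GammaLIBar B L U →* GammaLdual B L U ε × GammaW B hB L U}
    (hr : ∀ A, IsReduction ε A.1 (r A).1.1 (r A).2.1)
    (hrbar : ∀ A, rbar (toBar B L U A) = r A) :
    ∃ s : GammaIota B hB L U ε Itilde ι × GammaW B hB L U →* GammaLIBar B L U,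
      (∀ x, (rbar (s x)).1.1 = x.1.1 ∧ (rbar (s x)).2 = x.2) ∧
      ∀ x, ∀ A : parabolic B U, QuotientGroup.mk' (homAs B U) A = (s x).1 →
        ∀ v ∈ U ⊔ Submodule.span ℚ (Itilde : Set V),
          A.1 v ∈ U ⊔ Submodule.span ℚ (Itilde : Set V) := by
  have hle : GammaW B hB L U ≤ orthogonalGroup (formW B hB U) := fun γ hγ => hγ.1.1
  let φ : GammaIota B hB L U ε Itilde ι × GammaW B hB L U →* ParabolicBar B U :=
    (QuotientGroup.mk' (homAs B U)).comp (D.leviInt.comp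
      ((Subgroup.subtype _).prodMap (Subgroup.inclusion hle)))
  have hφ : ∀ x, ∃ A : GammaLI B L U, QuotientGroup.mk' (homAs B U) A.1 = φ x ∧
      IsReduction ε A.1 x.1.1 x.2.1 := fun x =>
    D.leviInt_exists_mem hnd hL hI hι x.1.2 (γ := Subgroup.inclusion hle x.2) x.2.2
  refine ⟨φ.codRestrict (GammaLIBar B L U) fun x => ?_, fun x => ?_, fun x A hA v hv => ?_⟩
  · obtain ⟨A, hA, -⟩ := hφ x
    exact ⟨A.1, A.2, hA⟩
  · obtain ⟨A, hA, hred⟩ := hφ x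
    have h1 : φ.codRestrict (GammaLIBar B L U) (fun x => by
        obtain ⟨A, hA, -⟩ := hφ x
        exact ⟨A.1, A.2, hA⟩) x = toBar B L U A := Subtype.ext hA.symm
    rw [h1, hrbar]
    obtain ⟨h2, h3⟩ := (hr A).eq hred
    exact ⟨h2, Subtype.ext h3⟩
  · exact D.mem_sup_of_mk'_eq hnd hI hA hv

end IntegralSplit

/-! ### Generators of a unimodular complement. -/

section Complement

variable {V : Type*} [AddCommGroup V] [Module ℚ V] {B : LinearMap.BilinForm ℚ V}
  {L : Submodule ℤ V} {U : Submodule ℚ V}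

/-- A unimodular complement is generated by a dual system of the basis `ε`. -/
lemma IsUnimodularPairing.exists_dual_system {ε : Module.Basis (Fin 2) ℤ (interLattice L U)}
    {Itilde : Submodule ℤ V} (h : IsUnimodularPairing B (interLattice L U) Itilde) :
    ∃ g : Fin 2 → V, Itilde = Submodule.span ℤ (Set.range g) ∧
      ∀ i j, B (ε i) (g j) = if i = j then 1 else 0 := by
  obtain ⟨hint, hex⟩ := h
  have h : ∀ j, ∃ y : Itilde, ∀ x : interLattice L U, B x.1 y.1 = (ε.coord j x : ℚ) := fun j =>
    (hex (ε.coord j)).exists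
  choose g hg using h
  have hεg : ∀ i j, B (ε i) (g j).1 = if i = j then 1 else 0 := by
    intro i j
    rw [hg]
    simp [Finsupp.single_apply]
  refine ⟨fun i => (g i).1, ?_, hεg⟩
  apply le_antisymm
  · intro y hy
    have hy' : ∀ i, ∃ n : ℤ, B (ε i) y = n := fun i => hint _ (ε i).2 y hy
    choose n hn using hy'
    -- Both `y` and the combination of the `g i` with the same coefficients represent one functional
    -- on `I`; uniqueness identifies them.
    have huniq := (hex (ε.constr ℤ n)).unique (y₁ := ⟨y, hy⟩) (y₂ := ∑ i, n i • g i) ?_ ?_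
    · have h2 : y = ∑ i, n i • (g i).1 := by
        have h3 := congrArg Subtype.val huniq
        simpa using h3
      rw [h2]
      exact Submodule.sum_mem _ fun i _ => Submodule.smul_mem _ _ (Submodule.subset_span ⟨i, rfl⟩)
    · intro x
      rw [Module.Basis.constr_apply_fintype]
      have hx := congrArg Subtype.val (ε.sum_repr x)
      simp only [Submodule.coe_add, Submodule.coe_smul, Fin.sum_univ_two] at hx
      conv_lhs => rw [← hx]
      simp only [map_add, map_zsmul, LinearMap.add_apply, LinearMap.smul_apply, hn]
      simp
    · intro x
      rw [Module.Basis.constr_apply_fintype]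
      simp [hg, mul_comm]
  · rw [Submodule.span_le]
    rintro _ ⟨i, rfl⟩
    exact (g i).2

end Complement

end IntegralParabolic

open IntegralParabolic in
theorem corollary3p7 {V : Type*} [AddCommGroup V] [Module ℚ V] [FiniteDimensional ℚ V]
    (B : LinearMap.BilinForm ℚ V) (hB : B.IsSymm) (hnd : B.Nondegenerate)
    (L : Submodule ℤ V) [Submodule.IsLattice ℚ L] (hL : IsEven B L)
    (U : Submodule ℚ V) (hU : Module.finrank ℚ U = 2) (hiso : U ≤ B.orthogonal U)
    (e : Module.Basis (Fin 2) ℤ (interLattice L U)) :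
    CongruenceSubgroup.IsCongruenceSubgroup (GammaLdual B L U e) ∧
    ∃ (j : HeisenbergW B hB L hL U →* GammaLI B L U)
      (r : GammaLI B L U →* GammaLdual B L U e × GammaW B hB L U)
      (k : Multiplicative (latticeW B L U × latticeW B L U) →* GammaLIBar B L U)
      (rbar : GammaLIBar B L U →* GammaLdual B L U e × GammaW B hB L U),
      -- `r` takes `A` to the matrix of its restriction to `I` and to its action on `W`
      (∀ A : GammaLI B L U, ∀ i, A.1.1 (e i) = ∑ m, (r A).1.1.1 m i • (e m : V)) ∧
      (∀ A : GammaLI B L U, ∀ z : B.orthogonal U,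
        (r A).2.1 (toW B U z) = toW B U ⟨A.1.1 z, apply_mem_orthogonal A.1 z.2⟩) ∧
      -- the action of the element `j (λ, μ, t)` on `U^⊥`, and of `j (0, 0, t)` on all of `V`
      (∀ h : HeisenbergW B hB L hL U, ∀ z : B.orthogonal U, (j h).1.1 z =
        z - (formW B hB U h.1.fst (toW B U z) • (e 0 : V) +
          formW B hB U h.1.snd (toW B U z) • (e 1 : V))) ∧
      (∀ h : HeisenbergW B hB L hL U, h.1.fst = 0 → h.1.snd = 0 → ∀ v : V, (j h).1.1 v =
        v - h.1.t • (B v (e 1) • (e 0 : V) - B v (e 0) • (e 1 : V))) ∧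
      -- `k` and `rbar` are induced from `j` and `r`
      (∀ h : HeisenbergW B hB L hL U,
        k (Multiplicative.ofAdd (⟨h.1.fst, h.2.1⟩, ⟨h.1.snd, h.2.2.1⟩)) = toBar B L U (j h)) ∧
      (∀ A : GammaLI B L U, rbar (toBar B L U A) = r A) ∧
      -- the two sequences are exact
      (Function.Injective j ∧ j.range = r.ker ∧ Function.Surjective r) ∧
      (Function.Injective k ∧ k.range = rbar.ker ∧ Function.Surjective rbar) ∧
      -- the splitting that is associated with a unimodular complement
      ∀ Itilde : Submodule ℤ V, Itilde ≤ B.dualSubmodule L →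
        IsUnimodularPairing B (interLattice L U) Itilde →
        ∃ (α : Submodule.span ℚ (Itilde : Set V) →ₗ[ℚ] U)
          (ι : tildeIL B L U Itilde →ₗ[ℤ]
            discriminantGroup (formW B hB U) (latticeW B L U)),
          IsCorrectionMap B U (Submodule.span ℚ (Itilde : Set V)) α ∧
          IsIota B hB L U Itilde α ι ∧
          CongruenceSubgroup.IsCongruenceSubgroup (GammaIota B hB L U e Itilde ι) ∧
          GammaIota B hB L U e Itilde ι ≤ GammaLdual B L U e ∧
          ∃ s : GammaIota B hB L U e Itilde ι × GammaW B hB L U →* GammaLIBar B L U,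
            -- `s` is a section over `Γ_ι × Γ_Λ`
            (∀ x, (rbar (s x)).1.1 = x.1.1 ∧ (rbar (s x)).2 = x.2) ∧
            -- the image of `s` stabilizes `U ⊕ Ũ`, i.e., it comes from the Levi subgroup
            ∀ x, ∀ A : parabolic B U, QuotientGroup.mk' (homAs B U) A = (s x).1 →
              ∀ v ∈ U ⊔ Submodule.span ℚ (Itilde : Set V),
                A.1 v ∈ U ⊔ Submodule.span ℚ (Itilde : Set V) := by
  have hlat : Submodule.IsLattice ℚ L := inferInstance
  obtain ⟨n, hn, h⟩ := exists_forall_smul_mem hlat.span_eq_top (dual_isLattice hnd L).fg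
  obtain ⟨g, hgL, hg⟩ := exists_dual_system hB hnd hU e
  let D := integralSplitOf hB hU hiso e g hgL hg
  obtain ⟨r, hr⟩ := D.exists_reduction hnd hL
  obtain ⟨rbar, hrbar⟩ := exists_reductionBar hiso hr
  refine ⟨isCongruenceSubgroup_SLJI e hn fun u hu => h u hu.2, D.heisenberg hL, r,
    D.translation hL, rbar, fun A => (hr A).1, fun A => (hr A).2,
    D.heisenberg_apply_orthogonal hL, D.heisenberg_apply_central hL, D.translation_apply hL, hrbar,
    ⟨D.heisenberg_injective hnd hL, D.heisenberg_range hnd hL hr,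
      D.reduction_surjective hnd hL hr⟩,
    ⟨D.translation_injective hnd hL, D.translation_range hnd hL hr hrbar, fun p => ?_⟩,
    fun Itilde hle hun => ?_⟩
  · obtain ⟨A, hA⟩ := D.reduction_surjective hnd hL hr p
    exact ⟨toBar B L U A, (hrbar A).trans hA⟩
  · obtain ⟨g', hI, hg'⟩ := hun.exists_dual_system (ε := e)
    -- The splitting uses a decomposition adapted to `Ĩ`, generally different from `D`. The maps `r`
    -- and `rbar` can be kept, since they are characterized by `IsReduction` without reference to a
    -- decomposition.
    let D' := integralSplitOf hB hU hiso e g'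
      (fun i => hle (hI.ge (Submodule.subset_span ⟨i, rfl⟩))) hg'
    obtain ⟨ι, hι⟩ := D'.exists_iota hL hI
    obtain ⟨m, hm, h'⟩ := D'.exists_smul_latticeIota_mem (ι := ι) hnd hL hI
    exact ⟨D'.correction Itilde, ι, D'.isCorrectionMap hI, hι, isCongruenceSubgroup_SLJI e hm h',
      D'.GammaIota_le, D'.exists_splitting hnd hL hI hι hr hrbar⟩
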